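/- There are a polynomial $p$ and an algorithm (a program for a random access machine) that, given a finite simple graph $G$ on $n$ vertices (by its adjacency matrix), vertices $a,b\in V(G)$ and an integer $k\ge 0$, enumerates, without repetition, all minimal $a,b$-separators of $G$ of size at most $k$ and then halts, such that for every $R\ge 1$ the first $R$ of them are output within time $p(n)\cdot R\cdot\min(4^k,R)$ (if there are fewer than $R$ of them, then all of them are output and the algorithm halts within this time). In particular, the algorithm is both fixed-parameter-delay (for every $R\ge1$, the first $R$ separators are output within time $R\cdot p(n)\cdot 4^k$) and incremental-polynomial (for some polynomial $q$ and every $R\ge1$, the first $R$ separators are output within time $R\cdot q(n+R)$), with the same convention when there are fewer than $R$ separators. Here a minimal $a,b$-separator of $G$ is an inclusion-wise minimal set $S\subseteq V(G)$ such that $a$ and $b$ lie outside $S$ and in different connected components of $G\setminus S$. -/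

import Mathlib

/-! ## Minimal separators -/

/-- `S` separates `a` from `b` in `G`: both vertices lie outside `S`, and they are in different
connected components of `G \ S`. -/
def SimpleGraph.IsSep {V : Type*} (G : SimpleGraph V) (a b : V) (S : Finset V) : Prop :=
  ∃ (ha : a ∈ ((S : Set V)ᶜ)) (hb : b ∈ ((S : Set V)ᶜ)),
    (G.induce ((S : Set V)ᶜ)).connectedComponentMk ⟨a, ha⟩ ≠
      (G.induce ((S : Set V)ᶜ)).connectedComponentMk ⟨b, hb⟩

/-- `S` is a minimal `a,b`-separator of `G`: inclusion-wise minimal among the vertex sets that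
separate `a` from `b`. -/
def SimpleGraph.IsMinSep {V : Type*} (G : SimpleGraph V) (a b : V) (S : Finset V) : Prop :=
  Minimal (G.IsSep a b) S

/-! ## A random access machine

The memory consists of arrays of natural numbers. The arrays are named by constants of the program
(so a program uses finitely many of them), are indexed by computed values, and have no length limit.
The arithmetic is restricted to successor, predecessor and comparison. Hence a number held in memory
never exceeds the largest number in the input or the program by more than the number of steps made,
and charging one unit per elementary operation does not hide any work on long numbers. -/

namespace RAM

/-- Memory contents: `m x i` is the entry with index `i` of the array `x`. -/
abbrev Mem : Type := ℕ → ℕ → ℕ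

/-- Expressions: literals, array look-ups, successor, predecessor and comparisons. -/
inductive Expr : Type
  | lit (c : ℕ)
  | get (x : ℕ) (i : Expr)
  | succ (e : Expr)
  | pred (e : Expr)
  | lt (e f : Expr)
  | eq (e f : Expr)

/-- The value of an expression. Comparisons have the value `1` (true) or `0` (false). -/
def Expr.eval (m : Mem) : Expr → ℕ
  | .lit c => c
  | .get x i => m x (i.eval m)
  | .succ e => e.eval m + 1
  | .pred e => e.eval m - 1
  | .lt e f => if e.eval m < f.eval m then 1 else 0
  | .eq e f => if e.eval m = f.eval m then 1 else 0

/-- The time for evaluating an expression: one unit for each operation. -/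
def Expr.cost : Expr → ℕ
  | .lit _ => 1
  | .get _ i => i.cost + 1
  | .succ e => e.cost + 1
  | .pred e => e.cost + 1
  | .lt e f => e.cost + f.cost + 1
  | .eq e f => e.cost + f.cost + 1

/-- Programs. `set x i e` is the assignment `x[i] := e`; `ite` and `loop` (a while loop) test whether
an expression is nonzero; `write e` appends the value of `e` to the record that is being written;
`emit` outputs that record and starts a new, empty one. -/
inductive Prog : Type
  | skip
  | set (x : ℕ) (i e : Expr)
  | seq (c d : Prog)
  | ite (e : Expr) (c d : Prog)
  | loop (e : Expr) (c : Prog)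
  | write (e : Expr)
  | emit

/-- The state of the machine: memory, the record being written, the records output so far (in the
order of output, each with the time of its output), and the time used so far. -/
structure State : Type where
  mem : Mem
  cur : List ℕ
  out : List (List ℕ × ℕ)
  time : ℕ

/-- Let `t` units of time pass. -/
def State.tick (s : State) (t : ℕ) : State := { s with time := s.time + t }

/-- `Exec c s s'`: the program `c`, started in the state `s`, halts in the state `s'`. -/
inductive Exec : Prog → State → State → Prop
  | skip (s : State) : Exec .skip s (s.tick 1)
  | set (s : State) (x : ℕ) (i e : Expr) :
      Exec (.set x i e) s
        { s with
          mem := Function.update s.mem x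
            (Function.update (s.mem x) (i.eval s.mem) (e.eval s.mem))
          time := s.time + (i.cost + e.cost + 1) }
  | seq {c d : Prog} {s s' s'' : State} (h : Exec c s s') (h' : Exec d s' s'') :
      Exec (.seq c d) s s''
  | ite_true {e : Expr} {c d : Prog} {s s' : State} (he : e.eval s.mem ≠ 0)
      (h : Exec c (s.tick (e.cost + 1)) s') : Exec (.ite e c d) s s'
  | ite_false {e : Expr} {c d : Prog} {s s' : State} (he : e.eval s.mem = 0)
      (h : Exec d (s.tick (e.cost + 1)) s') : Exec (.ite e c d) s s'
  | loop_true {e : Expr} {c : Prog} {s s' s'' : State} (he : e.eval s.mem ≠ 0)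
      (h : Exec c (s.tick (e.cost + 1)) s') (h' : Exec (.loop e c) s' s'') :
      Exec (.loop e c) s s''
  | loop_false {e : Expr} {c : Prog} {s : State} (he : e.eval s.mem = 0) :
      Exec (.loop e c) s (s.tick (e.cost + 1))
  | write (s : State) (e : Expr) :
      Exec (.write e) s
        { s with cur := s.cur ++ [e.eval s.mem], time := s.time + (e.cost + 1) }
  | emit (s : State) :
      Exec .emit s
        { s with cur := [], out := s.out ++ [(s.cur, s.time + 1)], time := s.time + 1 }

/-- A halted run, described by its final state `t`, enumerates with delay `f`: for all `R ≥ 1`, if at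
least `R` records are output, then the first `R` are output within time `R * f R`; and if fewer than
`R` records are output, then the run halts (with all of them output) within time `R * f R`. -/
def State.HasDelay (t : State) (f : ℕ → ℕ) : Prop :=
  ∀ R : ℕ, 1 ≤ R →
    (∀ i : ℕ, ∀ hi : i < t.out.length, i < R → t.out[i].2 ≤ R * f R) ∧
    (t.out.length < R → t.time ≤ R * f R)

open Classical in
/-- The memory that holds an input: array `0` contains `n, a, b, k`, and array `1` contains the
adjacency matrix of `G`, row by row. All other entries are `0`. -/
noncomputable def inputMem {n : ℕ} (G : SimpleGraph (Fin n)) (a b : Fin n) (k : ℕ) : Mem :=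
  fun x i =>
    if x = 0 then
      if i = 0 then n else if i = 1 then (a : ℕ) else if i = 2 then (b : ℕ)
      else if i = 3 then k else 0
    else if x = 1 then
      if ∃ u v : Fin n, i = (u : ℕ) * n + (v : ℕ) ∧ G.Adj u v then 1 else 0
    else 0

/-- The initial state on the input `G, a, b, k`. -/
noncomputable def initial {n : ℕ} (G : SimpleGraph (Fin n)) (a b : Fin n) (k : ℕ) : State where
  mem := inputMem G a b k
  cur := []
  out := []
  time := 0

/-- The record that represents a set of vertices: its elements in increasing order. -/
def vertexRecord {n : ℕ} (S : Finset (Fin n)) : List ℕ :=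
  (S.sort (· ≤ ·)).map Fin.val

end RAM

/-! A minimal `a,b`-separator is the boundary of the component `A` of `a` that it cuts off, and this
side `A` is determined by its boundary (`exists_isSide_iff`, `RConn.eq_of_bdry_eq`). So it suffices
to enumerate the sides whose boundary has at most `k` vertices.

Call `B` closest to a start `X` if no other set between `X` and `B` has a boundary as small as that
of `B`. Suppose that a side `B` has been found and lies properly inside a side `A`. As `A` is
connected, it contains a vertex `v` of the boundary of `B`. The least set of minimum boundary
between `B ∪ {v}` and `A` is again a side (`IsClosest.rconn`, `IsClosest.fullTo`), it is closest to
`B ∪ {v}`, and its boundary is no larger than that of `A`. Hence every side is reached if, for each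
`B` found and each boundary vertex `v`, all sides closest to `B ∪ {v}` are searched for
(`Inv.mem_iff`).

For one start these sides are found by branching, as for important separators. Let `A` be the
closest set in the current region. By submodularity every other target `B` in the region lies inside
`A`, and some vertex of the boundary of `A` is not in the boundary of `B` (`good_of_fits`). The
branching is on the least such vertex `t`: neighbours of `t` leave the region and the earlier
boundary vertices are forced to stay in the boundary. The boundary of the next closest set is
strictly larger and the forced set grows, so a weight of at most `4 ^ k` pays for all successful
tasks of a start (`weight_children`).

The scopes of the branches are disjoint, so one start never finds the same set twice. When `R` sets
are known, there are at most `1 + n * R` starts, each with at most `min (4 ^ k) R` successful tasks,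
each of which creates at most `n` subtasks (`Inv.le_taskBound`).

It remains to process a task in time polynomial in `n`, whatever `R` is. Closest sets are computed
by augmenting paths in a network with split vertices (`minCut_sem`), known sets are recognized by a
trie of depth `n` (`insertSet_sem`), and all loops inside a round are bounded by `n` or `2 * n`
(`Cmd.exec`). -/

/-! ## Boundaries, closest sets and minimal separators -/

namespace SimpleGraph

variable {V : Type*} [Fintype V] [DecidableEq V] (G : SimpleGraph V)

open Classical in
/-- The vertices outside `A` that have a neighbour in `A`. -/
noncomputable def bdry (A : Finset V) : Finset V :=
  Finset.univ.filter fun v => v ∉ A ∧ ∃ u ∈ A, G.Adj u v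

variable {G}

@[simp] theorem mem_bdry {A : Finset V} {v : V} :
    v ∈ G.bdry A ↔ v ∉ A ∧ ∃ u ∈ A, G.Adj u v := by
  simp [bdry]

/-- Submodularity of the boundary, by counting vertices with multiplicity: a vertex in one of the
boundaries on the left is in one of those on the right, and a vertex in both on the left is in both
on the right. -/
theorem card_bdry_inter_add_card_bdry_union (A B : Finset V) :
    (G.bdry (A ∩ B)).card + (G.bdry (A ∪ B)).card ≤ (G.bdry A).card + (G.bdry B).card := by
  rw [← Finset.card_union_add_card_inter, ← Finset.card_union_add_card_inter (G.bdry A)]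
  have h1 : G.bdry (A ∩ B) ∪ G.bdry (A ∪ B) ⊆ G.bdry A ∪ G.bdry B := by
    intro v
    simp only [Finset.mem_union, mem_bdry, Finset.mem_inter]
    grind
  have h2 : G.bdry (A ∩ B) ∩ G.bdry (A ∪ B) ⊆ G.bdry A ∩ G.bdry B := by
    intro v
    simp only [Finset.mem_union, mem_bdry, Finset.mem_inter]
    grind
  exact Nat.add_le_add (Finset.card_le_card h1) (Finset.card_le_card h2)

variable (G) in
/-- `A` is the least minimizer of the size of the boundary among the sets between `X` and `Q`. -/
structure IsClosest (X Q A : Finset V) : Prop where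
  le : X ⊆ A
  ge : A ⊆ Q
  min : ∀ B, X ⊆ B → B ⊆ Q → (G.bdry A).card ≤ (G.bdry B).card
  least : ∀ B, X ⊆ B → B ⊆ Q → (G.bdry B).card ≤ (G.bdry A).card → A ⊆ B

theorem IsClosest.unique {X Q A B : Finset V} (hA : G.IsClosest X Q A) (hB : G.IsClosest X Q B) :
    A = B :=
  (hA.least B hB.le hB.ge (hB.min A hA.le hA.ge)).antisymm
    (hB.least A hA.le hA.ge (hA.min B hB.le hB.ge))

-- By submodularity the minimizers are closed under intersection, so one of least cardinality is
-- contained in all of them.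
variable (G) in
theorem exists_isClosest {X Q : Finset V} (h : X ⊆ Q) : ∃ A, G.IsClosest X Q A := by
  obtain ⟨M, hM, hmin⟩ := Finset.exists_min_image (Finset.univ.filter fun B => X ⊆ B ∧ B ⊆ Q)
    (fun B => (G.bdry B).card) ⟨X, by simp [h]⟩
  obtain ⟨A, hA, hleast⟩ := Finset.exists_min_image
    (Finset.univ.filter fun B => X ⊆ B ∧ B ⊆ Q ∧ (G.bdry B).card = (G.bdry M).card)
    (fun B => B.card) ⟨M, by simpa using hM⟩
  simp only [Finset.mem_filter, Finset.mem_univ, true_and] at hM hmin hA hleast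
  refine ⟨A, hA.1, hA.2.1, fun B h1 h2 => hA.2.2 ▸ hmin B ⟨h1, h2⟩, fun B h1 h2 h3 => ?_⟩
  have hi := card_bdry_inter_add_card_bdry_union (G := G) A B
  have hu := hmin (A ∪ B) ⟨h1.trans Finset.subset_union_right, Finset.union_subset hA.2.1 h2⟩
  have hi' := hmin (A ∩ B)
    ⟨Finset.subset_inter hA.1 h1, Finset.inter_subset_left.trans hA.2.1⟩
  have := hleast (A ∩ B)
    ⟨Finset.subset_inter hA.1 h1, Finset.inter_subset_left.trans hA.2.1, by omega⟩
  rw [← Finset.eq_of_subset_of_card_le Finset.inter_subset_left this]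
  exact Finset.inter_subset_right

/-! ### Rooted connectivity and the side of `b` -/

variable (G) in
/-- The vertex set `A` contains `r` and is connected. -/
def RConn (r : V) (A : Finset V) : Prop :=
  r ∈ A ∧ ∀ C, r ∈ C → C ⊂ A → ∃ v ∈ A, v ∈ G.bdry C

variable (G) in
/-- There is a connected set containing `b`, away from `Q`, whose boundary contains that of `Q`. -/
def FullTo (b : V) (Q : Finset V) : Prop :=
  ∃ W, G.RConn b W ∧ Disjoint W (Q ∪ G.bdry Q) ∧ G.bdry Q ⊆ G.bdry W

/-- A closed set that contains the root of a connected set contains the whole of it. -/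
theorem RConn.subset_of_closed {r : V} {A C : Finset V} (hA : G.RConn r A) (hr : r ∈ C)
    (hC : ∀ u ∈ A, u ∈ C → ∀ v ∈ A, G.Adj u v → v ∈ C) : A ⊆ C := by
  by_contra h
  obtain ⟨v, hv, hv'⟩ := hA.2 (A ∩ C) (by simp [hr, hA.1])
    (Finset.inter_subset_left.ssubset_of_ne fun e => h (Finset.inter_eq_left.1 e))
  simp only [mem_bdry, Finset.mem_inter] at hv'
  grind

theorem rconn_of_closed {r : V} {A : Finset V} (hr : r ∈ A)
    (h : ∀ C ⊆ A, r ∈ C → (∀ u ∈ C, ∀ v ∈ A, G.Adj u v → v ∈ C) → A ⊆ C) : G.RConn r A := by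
  refine ⟨hr, fun C hrC hCA => ?_⟩
  by_contra hcon
  push Not at hcon
  exact hCA.2 (h C hCA.1 hrC fun u hu v hv huv => by
    by_contra hvC
    exact hcon v hv (mem_bdry.2 ⟨hvC, u, hu, huv⟩))

theorem rconn_singleton (r : V) : G.RConn r {r} :=
  rconn_of_closed (by simp) fun C _ hr _ => by simpa using hr

theorem RConn.insert {r v : V} {A : Finset V} (hA : G.RConn r A) (hv : v ∈ G.bdry A) :
    G.RConn r (insert v A) := by
  obtain ⟨-, u, hu, huv⟩ := mem_bdry.1 hv
  refine rconn_of_closed (by simp [hA.1]) fun C _ hr hC => ?_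
  have hAC : A ⊆ C := hA.subset_of_closed hr fun u _ huC v hv huv => hC u huC v (by simp [hv]) huv
  exact Finset.insert_subset (hC u (hAC hu) v (by simp) huv) hAC

/-- The part `C` of `A` that is reached from `a` inside `A` contains `X`, and its boundary is
contained in that of `A`; leastness gives `A ⊆ C`. -/
theorem IsClosest.rconn {a : V} {X Q A : Finset V} (h : G.IsClosest X Q A) (hX : G.RConn a X) :
    G.RConn a A := by
  refine rconn_of_closed (h.le hX.1) fun C hCA ha hC => ?_
  have hXC : X ⊆ C :=
    hX.subset_of_closed ha fun u _ huC v hv huv => hC u huC v (h.le hv) huv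
  refine h.least C hXC (hCA.trans h.ge) (Finset.card_le_card fun v hv => ?_)
  simp only [mem_bdry] at hv ⊢
  grind

open Classical in
variable (G) in
/-- The vertices that can be reached from `r` avoiding `S`. -/
noncomputable def comp (S : Finset V) (r : V) : Finset V :=
  Finset.univ.filter fun v => Relation.ReflTransGen (fun u w => G.Adj u w ∧ w ∉ S) r v

theorem mem_comp {V : Type*} [Fintype V] {G : SimpleGraph V} {S : Finset V} {r v : V} :
    v ∈ G.comp S r ↔ Relation.ReflTransGen (fun u w => G.Adj u w ∧ w ∉ S) r v := by
  simp [comp]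

theorem rconn_comp (S : Finset V) (r : V) : G.RConn r (G.comp S r) := by
  refine rconn_of_closed (mem_comp.2 .refl) fun C _ hr hC v hv => ?_
  rw [mem_comp] at hv
  induction hv with
  | refl => exact hr
  | tail h1 h2 ih => exact hC _ ih _ (mem_comp.2 (h1.tail h2)) h2.1

theorem notMem_of_mem_comp {V : Type*} [Fintype V] {G : SimpleGraph V} {S : Finset V} {r v : V}
    (hr : r ∉ S) (hv : v ∈ G.comp S r) : v ∉ S := by
  rw [mem_comp] at hv
  cases hv with
  | refl => exact hr
  | tail _ h => exact h.2

theorem bdry_comp_subset (S : Finset V) (r : V) : G.bdry (G.comp S r) ⊆ S := by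
  intro v hv
  obtain ⟨h1, u, hu, huv⟩ := mem_bdry.1 hv
  by_contra h
  exact h1 (mem_comp.2 ((mem_comp.1 hu).tail ⟨huv, h⟩))

theorem RConn.subset_comp {S W : Finset V} {r : V} (hW : G.RConn r W) (h : Disjoint W S) :
    W ⊆ G.comp S r := by
  refine hW.subset_of_closed (rconn_comp S r).1 fun u _ hu v hv huv => ?_
  exact mem_comp.2 ((mem_comp.1 hu).tail ⟨huv, Finset.disjoint_left.1 h hv⟩)

/-- Let `B` be the component of `b` outside the boundary of `A`; it contains `W`, and its boundary
lies in that of `A`. Deleting `B` and its boundary from `Q` leaves a competitor of `A` whose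
boundary lies in that of `B`. Minimality of `A` therefore makes the two boundaries equal. -/
theorem IsClosest.fullTo {b : V} {X Q A : Finset V} (h : G.IsClosest X Q A)
    (hQ : G.FullTo b Q) : G.FullTo b A := by
  obtain ⟨W, hW, hdisj, hsub⟩ := hQ
  rw [Finset.disjoint_left] at hdisj
  simp only [Finset.mem_union, mem_bdry] at hdisj
  have hge := h.ge
  have hWA : Disjoint W (G.bdry A) := by
    rw [Finset.disjoint_left]
    intro w hw
    have := hdisj hw
    simp only [mem_bdry]
    grind
  have hb : b ∉ G.bdry A := Finset.disjoint_left.1 hWA hW.1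
  have hbA : b ∉ A := fun hA => hdisj hW.1 (.inl (hge hA))
  set B := G.comp (G.bdry A) b with hBdef
  have hWB : W ⊆ B := hW.subset_comp hWA
  have hBconn : G.RConn b B := rconn_comp _ _
  have hBA : ∀ v ∈ B, v ∉ G.bdry A := fun v hv => notMem_of_mem_comp hb hv
  have hBA' : ∀ v ∈ B, v ∉ A := by
    have : B ⊆ Aᶜ := hBconn.subset_of_closed (by simpa using hbA) fun u hu hu' v hv huv => by
      have := hBA u hu
      simp only [Finset.mem_compl, mem_bdry] at *
      intro hvA
      exact this ⟨hu', v, hvA, huv.symm⟩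
    intro v hv
    simpa using this hv
  have hBb : G.bdry B ⊆ G.bdry A := bdry_comp_subset _ _
  -- A boundary vertex `y` inside `Q` was deleted, and it is not in `B` because its neighbour `u`
  -- was kept. If `y` is outside `Q`, it is in the boundary of `Q` and thus has a neighbour in `W ⊆
  -- B`.
  have key : G.bdry (Q \ (B ∪ G.bdry B)) ⊆ G.bdry B := by
    intro y hy
    simp only [mem_bdry, Finset.mem_sdiff, Finset.mem_union] at hy
    obtain ⟨hy1, u, ⟨huQ, hu⟩, huy⟩ := hy
    have hyB : y ∉ B := fun hyB => hu (.inr ⟨fun h => hu (.inl h), y, hyB, huy.symm⟩)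
    by_cases hyQ : y ∈ Q
    · have := mt (fun h => hy1 ⟨hyQ, h⟩) 
      simp only [mem_bdry]
      grind
    · have : y ∈ G.bdry W := hsub (mem_bdry.2 ⟨hyQ, u, huQ, huy⟩)
      obtain ⟨_, w, hw, hwy⟩ := mem_bdry.1 this
      exact mem_bdry.2 ⟨hyB, w, hWB hw, hwy⟩
  have hle := h.min (Q \ (B ∪ G.bdry B)) (fun x hx => by
    have hxA := h.le hx
    have : x ∉ G.bdry B := fun hxB => (mem_bdry.1 (hBb hxB)).1 hxA
    simp only [Finset.mem_sdiff, Finset.mem_union]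
    exact ⟨hge hxA, fun h => h.elim (fun h => hBA' x h hxA) this⟩) Finset.sdiff_subset
  have heq : G.bdry B = G.bdry A :=
    Finset.eq_of_subset_of_card_le hBb (hle.trans (Finset.card_le_card key))
  refine ⟨B, hBconn, ?_, heq.ge⟩
  rw [Finset.disjoint_left]
  intro v hv
  simpa using ⟨hBA' v hv, by simpa using hBA v hv⟩

/-- Separation in terms of reachability. -/
theorem isSep_iff {V : Type*} [Fintype V] {G : SimpleGraph V} {a b : V} {S : Finset V} :
    G.IsSep a b S ↔ a ∉ S ∧ b ∉ S ∧ b ∉ G.comp S a := by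
  have key : ∀ (ha : a ∈ ((S : Set V)ᶜ)) (hb : b ∈ ((S : Set V)ᶜ)),
      (G.induce ((S : Set V)ᶜ)).Reachable ⟨a, ha⟩ ⟨b, hb⟩ ↔ b ∈ G.comp S a := by
    intro ha hb
    rw [mem_comp, SimpleGraph.reachable_iff_reflTransGen]
    constructor
    · intro h
      have lift : ∀ x : ((S : Set V)ᶜ : Set V),
          Relation.ReflTransGen (G.induce ((S : Set V)ᶜ)).Adj ⟨a, ha⟩ x →
            Relation.ReflTransGen (fun u w => G.Adj u w ∧ w ∉ S) a x := by
        intro x hx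
        induction hx with
        | refl => exact .refl
        | @tail y z _ h2 ih => exact ih.tail ⟨h2, z.2⟩
      exact lift _ h
    · intro h
      have : ∀ v, Relation.ReflTransGen (fun u w => G.Adj u w ∧ w ∉ S) a v →
          ∃ hv : v ∈ ((S : Set V)ᶜ),
            Relation.ReflTransGen (G.induce ((S : Set V)ᶜ)).Adj ⟨a, ha⟩ ⟨v, hv⟩ := by
        intro v hv
        induction hv with
        | refl => exact ⟨ha, .refl⟩
        | tail _ h2 ih =>
          obtain ⟨hv, ih⟩ := ih
          exact ⟨h2.2, ih.tail h2.1⟩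
      exact (this b h).2
  constructor
  · rintro ⟨ha, hb, hne⟩
    rw [Ne, SimpleGraph.ConnectedComponent.eq, key] at hne
    exact ⟨ha, hb, hne⟩
  · rintro ⟨ha, hb, hne⟩
    refine ⟨ha, hb, ?_⟩
    rwa [Ne, SimpleGraph.ConnectedComponent.eq, key]

theorem isSep_of_bdry_subset {a b : V} {S C : Finset V} (ha : a ∈ C) (hb : b ∉ C)
    (hS : Disjoint C S) (hC : G.bdry C ⊆ S) (hbS : b ∉ S) : G.IsSep a b S := by
  have haS := Finset.disjoint_left.1 hS ha
  refine isSep_iff.2 ⟨haS, hbS, fun h => hb ?_⟩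
  refine (rconn_comp S a).subset_of_closed ha (fun u _ huC v hv huv => ?_) h
  by_contra hvC
  exact notMem_of_mem_comp haS hv (hC (mem_bdry.2 ⟨hvC, u, huC, huv⟩))

/-! ### Sides and minimal separators -/

variable (G) in
/-- The side of `a` of a minimal `a,b`-separator of size at most `k`. -/
structure IsSide (a b : V) (k : ℕ) (A : Finset V) : Prop where
  rconn : G.RConn a A
  fullTo : G.FullTo b A
  card_le : (G.bdry A).card ≤ k

/-- Each boundary vertex `s` has a neighbour in `A` and one in `W`, and a separator `T` inside the
boundary leaves `A` and `W` intact. If `s ∉ T`, then `s` links them outside `T`. -/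
theorem RConn.isMinSep_bdry {a b : V} {A : Finset V} (hA : G.RConn a A) (hb : G.FullTo b A) :
    G.IsMinSep a b (G.bdry A) := by
  obtain ⟨W, hW, hdisj, hsub⟩ := hb
  rw [Finset.disjoint_left] at hdisj
  simp only [Finset.mem_union, not_or] at hdisj
  refine ⟨isSep_of_bdry_subset hA.1 (hdisj hW.1).1 ?_ subset_rfl (hdisj hW.1).2, ?_⟩
  · exact Finset.disjoint_left.2 fun v hv hv' => (mem_bdry.1 hv').1 hv
  intro T hT hTS s hs
  obtain ⟨haT, hbT, hbC⟩ := isSep_iff.1 hT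
  set C := G.comp T a
  have hCb : G.bdry C ⊆ T := bdry_comp_subset _ _
  have hAC : A ⊆ C := hA.subset_comp (Finset.disjoint_left.2 fun v hv hv' =>
    (mem_bdry.1 (hTS hv')).1 hv)
  by_contra hsT
  have hsC : s ∈ C := by
    by_contra hsC
    obtain ⟨-, u, hu, hus⟩ := mem_bdry.1 hs
    exact hsT (hCb (mem_bdry.2 ⟨hsC, u, hAC hu, hus⟩))
  have hWC : W ⊆ Cᶜ := hW.subset_of_closed (by simpa using hbC) fun u hu huC v hv huv => by
    rw [Finset.mem_compl] at huC ⊢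
    intro hvC
    exact (hdisj hu).2 (hTS (hCb (mem_bdry.2 ⟨huC, v, hvC, huv.symm⟩)))
  obtain ⟨-, w, hw, hws⟩ := mem_bdry.1 (hsub hs)
  exact (hdisj hw).2 (hTS (hCb (mem_bdry.2 ⟨by simpa using hWC hw, s, hsC, hws.symm⟩)))

/-- The components of `a` and of `b` outside `S` have boundaries inside `S`, and each of these
boundaries already separates `a` from `b`. Minimality makes both equal to `S`. -/
theorem IsMinSep.exists_side {a b : V} {S : Finset V} (h : G.IsMinSep a b S) :
    ∃ A, G.RConn a A ∧ G.FullTo b A ∧ G.bdry A = S := by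
  obtain ⟨haS, hbS, hbA⟩ := isSep_iff.1 h.1
  set A := G.comp S a with hAdef
  set B := G.comp S b with hBdef
  have hA : G.bdry A ⊆ S := bdry_comp_subset _ _
  have hB : G.bdry B ⊆ S := bdry_comp_subset _ _
  have hdA : ∀ v ∈ A, v ∉ S := fun v => notMem_of_mem_comp haS
  have hdB : ∀ v ∈ B, v ∉ S := fun v => notMem_of_mem_comp hbS
  have hBA : B ⊆ Aᶜ := (rconn_comp S b).subset_of_closed (by simpa using hbA)
    fun u hu huA v hv huv => by
      rw [Finset.mem_compl] at huA ⊢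
      intro hvA
      exact hdB u hu (hA (mem_bdry.2 ⟨huA, v, hvA, huv.symm⟩))
  have haB : a ∉ B := fun h => Finset.mem_compl.1 (hBA h) (rconn_comp S a).1
  have eA : G.bdry A = S := hA.antisymm (h.2 (isSep_of_bdry_subset (rconn_comp S a).1 hbA
    (Finset.disjoint_left.2 fun v hv hv' => hdA v hv (hA hv')) subset_rfl
    fun h => hbS (hA h)) hA)
  have eB : S ⊆ G.bdry B := by
    refine h.2 ?_ hB
    have hsub : Disjoint A (G.bdry B) := Finset.disjoint_left.2 fun v hv hv' => hdA v hv (hB hv')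
    refine isSep_iff.2 ⟨fun h => haS (hB h), fun h => hbS (hB h), fun hb => ?_⟩
    have : G.comp (G.bdry B) a ⊆ Bᶜ := (rconn_comp _ a).subset_of_closed (by simpa using haB)
      fun u hu huB v hv huv => by
        rw [Finset.mem_compl] at huB ⊢
        intro hvB
        exact notMem_of_mem_comp (fun h => haS (hB h)) hu
          (mem_bdry.2 ⟨huB, v, hvB, huv.symm⟩)
    exact Finset.mem_compl.1 (this hb) (rconn_comp S b).1
  refine ⟨A, rconn_comp S a, ⟨B, rconn_comp S b, ?_, eA ▸ eB⟩, eA⟩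
  rw [Finset.disjoint_left]
  intro v hv
  rw [Finset.mem_union, eA, not_or]
  exact ⟨Finset.mem_compl.1 (hBA hv), hdB v hv⟩

/-- A path from `a` inside `A` can only leave `B` through the common boundary, which `A` avoids.
This turns an enumeration of sides without repetition into one of separators without repetition. -/
theorem RConn.eq_of_bdry_eq {a : V} {A B : Finset V} (hA : G.RConn a A) (hB : G.RConn a B)
    (h : G.bdry A = G.bdry B) : A = B := by
  have key : ∀ {A B : Finset V}, G.RConn a A → G.RConn a B → G.bdry A = G.bdry B → A ⊆ B := by
    intro A B hA hB h
    refine hA.subset_of_closed hB.1 fun u _ huB v hv huv => ?_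
    by_contra hvB
    have : v ∈ G.bdry A := h ▸ mem_bdry.2 ⟨hvB, u, huB, huv⟩
    exact (mem_bdry.1 this).1 hv
  exact (key hA hB h).antisymm (key hB hA h.symm)

end SimpleGraph

/-! ## The enumeration, as an abstract work-list algorithm -/

namespace SimpleGraph

/-- The elements of `S` in increasing order. -/
def verts {n : ℕ} (S : Finset (Fin n)) : List (Fin n) :=
  (List.finRange n).filter (· ∈ S)

section Verts

variable {n : ℕ} {S : Finset (Fin n)}

@[simp] theorem mem_verts {v : Fin n} : v ∈ verts S ↔ v ∈ S := by simp [verts]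

theorem nodup_verts : (verts S).Nodup := (List.nodup_finRange n).filter _

theorem pairwise_verts : (verts S).Pairwise (· < ·) :=
  (List.pairwise_lt_finRange n).filter _

theorem length_verts_le : (verts S).length ≤ n :=
  (List.length_filter_le _ _).trans (List.length_finRange).le

theorem verts_eq_sort : verts S = S.sort (· ≤ ·) := by
  refine List.Perm.eq_of_pairwise (le := (· ≤ ·)) (fun _ _ _ _ => le_antisymm)
    (pairwise_verts.imp le_of_lt) (Finset.pairwise_sort S _) ?_
  exact (List.perm_ext_iff_of_nodup nodup_verts (Finset.sort_nodup S _)).2 (by simp)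

/-- Used for the forced set of the subtask with index `i`: it gains at least `i` vertices. -/
theorem le_card_filter_lt_verts (i : ℕ) (hi : i < (verts S).length) :
    i ≤ (S.filter (· < (verts S)[i])).card := by
  have h : ((verts S).take i).toFinset ⊆ S.filter (· < (verts S)[i]) := by
    intro v hv
    rw [List.mem_toFinset, List.mem_take_iff_getElem] at hv
    obtain ⟨j, hj, rfl⟩ := hv
    have hj' : j < i := by omega
    rw [Finset.mem_filter]
    exact ⟨mem_verts.1 (List.getElem_mem _), List.pairwise_iff_getElem.1 pairwise_verts j i _ hi hj'⟩
  have := Finset.card_le_card h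
  rw [List.toFinset_card_of_nodup (nodup_verts.sublist (List.take_sublist _ _)),
    List.length_take] at this
  omega

end Verts

/-- The geometric sum `2 ^ (μ - 1) + 2 ^ (μ - 2) + ⋯ + 1 = 2 ^ μ - 1`. The unit left over pays for
the task whose subtasks have the weights in `l`. -/
theorem sum_add_one_le_two_pow (l : List ℕ) (μ : ℕ)
    (h : ∀ i (hi : i < l.length), l[i] = 0 ∨ i + 1 ≤ μ ∧ l[i] ≤ 2 ^ (μ - (i + 1))) :
    l.sum + 1 ≤ 2 ^ μ := by
  induction l generalizing μ with
  | nil => simpa using Nat.one_le_two_pow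
  | cons w ws ih =>
    cases μ with
    | zero =>
      have : (w :: ws).sum = 0 := by
        rw [List.sum_eq_zero_iff]
        intro x hx
        obtain ⟨i, hi, rfl⟩ := List.getElem_of_mem hx
        rcases h i hi with h | h
        · exact h
        · omega
      rw [this]; simp
    | succ μ =>
      have h0 := h 0 (by simp)
      have := ih μ fun i hi => by
        have := h (i + 1) (by simpa using hi)
        simpa using this
      simp only [List.getElem_cons_zero, zero_add, Nat.add_sub_cancel] at h0
      rw [List.sum_cons, pow_succ]
      omega

variable {n : ℕ}

/-- A task of the enumeration: find the closest set between `X` and `Q`, with `Z` in its boundary.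
Its origin is `none` for the initial task and `some (A, v)` for the tasks that look for the sets
containing `A` and the vertex `v`. -/
structure Task (n : ℕ) where
  origin : Option (Finset (Fin n) × Fin n)
  X : Finset (Fin n)
  Q : Finset (Fin n)
  Z : Finset (Fin n)

variable (G : SimpleGraph (Fin n)) (a b : Fin n) (k : ℕ)

open Classical in
/-- The vertices outside the closed neighbourhood of `b`. -/
noncomputable def far : Finset (Fin n) := Finset.univ.filter fun v => v ≠ b ∧ ¬ G.Adj b v

theorem fullTo_far : G.FullTo b (G.far b) := by
  refine ⟨{b}, rconn_singleton b, ?_, ?_⟩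
  · rw [Finset.disjoint_left]
    intro v hv
    rw [Finset.mem_singleton] at hv
    subst hv
    simp only [far, Finset.mem_union, mem_bdry, Finset.mem_filter, Finset.mem_univ, true_and]
    rintro (h | ⟨-, u, h, h'⟩)
    · exact h.1 rfl
    · exact h.2 h'.symm
  · intro v hv
    simp only [far, mem_bdry, Finset.mem_filter, Finset.mem_univ, true_and] at hv
    obtain ⟨h1, u, h2, h3⟩ := hv
    simp only [mem_bdry, Finset.mem_singleton, exists_eq_left]
    have : v ≠ b := by rintro rfl; exact h2.2 h3.symm
    exact ⟨this, by tauto⟩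

variable {G b} in
theorem FullTo.subset_far {A : Finset (Fin n)} (h : G.FullTo b A) : A ⊆ G.far b := by
  obtain ⟨W, hW, hdisj, -⟩ := h
  have := Finset.disjoint_left.1 hdisj hW.1
  simp only [Finset.mem_union, mem_bdry, not_or] at this
  intro v hv
  simp only [far, Finset.mem_filter, Finset.mem_univ, true_and]
  refine ⟨fun h => this.1 (h ▸ hv), fun h => this.2 ⟨this.1, v, hv, h.symm⟩⟩

open Classical in
/-- The closest set of a task. -/
noncomputable def closest (X Q : Finset (Fin n)) : Finset (Fin n) :=
  if h : X ⊆ Q then (G.exists_isClosest h).choose else ∅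

variable {G} in
theorem isClosest_closest {X Q : Finset (Fin n)} (h : X ⊆ Q) :
    G.IsClosest X Q (G.closest X Q) := by
  rw [closest, dif_pos h]
  exact (G.exists_isClosest h).choose_spec

/-- The set `A` is in the scope of a task. -/
def Fits (A : Finset (Fin n)) (τ : Task n) : Prop := A ⊆ τ.Q ∧ τ.Z ⊆ G.bdry A

/-- A task that finds a separator. -/
structure Good (τ : Task n) : Prop where
  sub : τ.X ⊆ τ.Q
  forced : τ.Z ⊆ G.bdry (G.closest τ.X τ.Q)
  card_le : (G.bdry (G.closest τ.X τ.Q)).card ≤ k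

variable {G k} in
theorem Good.fits {τ : Task n} (h : G.Good k τ) : G.Fits (G.closest τ.X τ.Q) τ :=
  ⟨(isClosest_closest h.sub).ge, h.forced⟩

open Classical in
/-- The subtask that looks for closer sets, away from the neighbours of `t`. -/
noncomputable def child (τ : Task n) (A : Finset (Fin n)) (t : Fin n) : Task n where
  origin := τ.origin
  X := τ.X
  Q := A.filter fun v => ¬ G.Adj t v
  Z := τ.Z ∪ (G.bdry A).filter (· < t)

/-- All subtasks of a task with closest set `A`. -/
noncomputable def children (τ : Task n) (A : Finset (Fin n)) : List (Task n) :=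
  (verts (G.bdry A \ τ.Z)).map (G.child τ A)

/-- The tasks created when `A` is found. -/
noncomputable def newTasks (A : Finset (Fin n)) : List (Task n) :=
  (verts (G.bdry A)).map fun v => ⟨some (A, v), insert v A, G.far b, ∅⟩

/-- The origins of the tasks created when the sets in `L` have been found. -/
noncomputable def origins (L : List (Finset (Fin n))) : List (Option (Finset (Fin n) × Fin n)) :=
  none :: L.flatMap fun A => (verts (G.bdry A)).map fun v => some (A, v)

/-- The set from which the tasks of a given origin start. -/
def originSet : Option (Finset (Fin n) × Fin n) → Finset (Fin n)
  | none => {a}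
  | some (A, v) => insert v A

open Classical in
/-- A bound for the number of good tasks among a task and its descendants. -/
noncomputable def weight (τ : Task n) : ℕ :=
  if G.Good k τ then 2 ^ (2 * k - τ.Z.card - (G.bdry (G.closest τ.X τ.Q)).card) else 0

theorem weight_le (τ : Task n) : G.weight k τ ≤ 4 ^ k := by
  rw [weight]
  split_ifs
  · rw [show 4 = 2 ^ 2 by rfl, ← pow_mul]
    exact Nat.pow_le_pow_right (by norm_num) (by omega)
  · exact Nat.zero_le _

/-- Invariants along the branching: `rconn` and `fullTo` make every set that is found a side, and
`disj` keeps the forced vertices out of every set in the region, so that a forced vertex with a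
neighbour in the set is a boundary vertex. -/
structure TaskOK (τ : Task n) : Prop where
  start : τ.X = originSet a τ.origin
  rconn : G.RConn a τ.X
  fullTo : G.FullTo b τ.Q
  disj : Disjoint τ.Z τ.Q

variable {G a b k}

theorem mem_origins {L : List (Finset (Fin n))} {r : Option (Finset (Fin n) × Fin n)} :
    r ∈ G.origins L ↔ r = none ∨ ∃ A ∈ L, ∃ v ∈ G.bdry A, r = some (A, v) := by
  simp [origins, eq_comm]

theorem length_origins_le (L : List (Finset (Fin n))) :
    (G.origins L).length ≤ 1 + n * L.length := by
  rw [origins, List.length_cons, add_comm, Nat.add_le_add_iff_left]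
  induction L with
  | nil => simp
  | cons A L ih =>
    rw [List.flatMap_cons, List.length_append, List.length_map, List.length_cons]
    have := length_verts_le (S := G.bdry A)
    rw [Nat.mul_add]
    omega

theorem origins_append (L : List (Finset (Fin n))) (A : Finset (Fin n)) :
    G.origins (L ++ [A]) = G.origins L ++ (verts (G.bdry A)).map fun v => some (A, v) := by
  simp [origins]

theorem TaskOK.isSide {τ : Task n} (h : G.TaskOK a b τ) (hg : G.Good k τ) :
    G.IsSide a b k (G.closest τ.X τ.Q) :=
  ⟨(isClosest_closest hg.sub).rconn h.rconn, (isClosest_closest hg.sub).fullTo h.fullTo, hg.card_le⟩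

theorem mem_child_Q {τ : Task n} {A : Finset (Fin n)} {t v : Fin n} :
    v ∈ (G.child τ A t).Q ↔ v ∈ A ∧ ¬ G.Adj t v := by
  simp [child]

theorem child_Q_subset {τ : Task n} {A : Finset (Fin n)} {t : Fin n} :
    (G.child τ A t).Q ⊆ A := fun _ h => (mem_child_Q.1 h).1

theorem fits_of_fits_child {τ : Task n} {A B : Finset (Fin n)} {t : Fin n} (hA : A ⊆ τ.Q)
    (h : G.Fits B (G.child τ A t)) : G.Fits B τ :=
  ⟨h.1.trans (child_Q_subset.trans hA), Finset.subset_union_left.trans h.2⟩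

theorem not_fits_child_self {τ : Task n} {A : Finset (Fin n)} {t : Fin n} (ht : t ∈ G.bdry A) :
    ¬ G.Fits A (G.child τ A t) := by
  intro h
  obtain ⟨-, u, hu, hut⟩ := mem_bdry.1 ht
  exact (mem_child_Q.1 (h.1 hu)).2 hut.symm

/-- A set in the scope of the earlier subtask contains no neighbour of `s`, while the later subtask
forces `s` into the boundary. Disjointness of scopes is what prevents a start from finding a set
twice. -/
theorem not_fits_child_child {τ : Task n} {A B : Finset (Fin n)} {s t : Fin n}
    (hs : s ∈ G.bdry A) (hst : s < t) (h : G.Fits B (G.child τ A s))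
    (h' : G.Fits B (G.child τ A t)) : False := by
  have : s ∈ G.bdry B := h'.2 (Finset.mem_union_right _ (Finset.mem_filter.2 ⟨hs, hst⟩))
  obtain ⟨-, u, hu, hus⟩ := mem_bdry.1 this
  exact (mem_child_Q.1 (h.1 hu)).2 hus.symm

/-- The side of `b` grows to `W ∪ {t}`, which is connected since `t` is in the boundary of `W`. A
boundary vertex of the new region is adjacent to `t` if it lies in `A`, as only neighbours of `t`
were removed, and otherwise it is in the boundary of `A` and has a neighbour in `W`. -/
theorem TaskOK.child {τ : Task n} {t : Fin n} (h : G.TaskOK a b τ) (hg : G.Good k τ)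
    (ht : t ∈ G.bdry (G.closest τ.X τ.Q)) : G.TaskOK a b (G.child τ (G.closest τ.X τ.Q) t) := by
  have hs := h.isSide hg
  set A := G.closest τ.X τ.Q with hA
  have hAQ : A ⊆ τ.Q := (isClosest_closest hg.sub).ge
  refine ⟨h.start, h.rconn, ?_, ?_⟩
  · obtain ⟨W, hW, hdisj, hsub⟩ := hs.fullTo
    rw [Finset.disjoint_left] at hdisj
    simp only [Finset.mem_union, not_or] at hdisj
    have hQ : ∀ v, v ∈ (G.child τ A t).Q ↔ v ∈ A ∧ ¬ G.Adj t v := fun _ => mem_child_Q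
    have htA := (mem_bdry.1 ht).1
    refine ⟨insert t W, hW.insert (hsub ht), ?_, ?_⟩
    · rw [Finset.disjoint_left]
      intro w hw hw'
      rw [Finset.mem_union, mem_bdry, hQ] at hw'
      rcases hw' with hw' | ⟨hw1, u, hu, huw⟩
      · rcases Finset.mem_insert.1 hw with rfl | hw
        · exact htA hw'.1
        · exact (hdisj hw).1 hw'.1
      · rw [hQ] at hu
        rcases Finset.mem_insert.1 hw with rfl | hw
        · exact hu.2 huw.symm
        · exact (hdisj hw).2 (mem_bdry.2 ⟨(hdisj hw).1, u, hu.1, huw⟩)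
    · intro y hy
      rw [mem_bdry, hQ] at hy
      obtain ⟨hy1, u, hu, huy⟩ := hy
      rw [hQ] at hu
      have hyt : y ≠ t := by rintro rfl; exact hu.2 huy.symm
      by_cases hyA : y ∈ A
      · have hyW : y ∉ W := fun h => (hdisj h).1 hyA
        exact mem_bdry.2 ⟨by simp [hyt, hyW], t, by simp, by tauto⟩
      · have := hsub (mem_bdry.2 ⟨hyA, u, hu.1, huy⟩)
        obtain ⟨hyW, w, hw, hwy⟩ := mem_bdry.1 this
        exact mem_bdry.2 ⟨by simp [hyt, hyW], w, by simp [hw], hwy⟩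
  · rw [Finset.disjoint_left]
    intro v hv hv'
    have hvA : v ∈ A := child_Q_subset hv'
    rcases Finset.mem_union.1 hv with hv | hv
    · exact Finset.disjoint_left.1 h.disj hv (hAQ hvA)
    · exact (mem_bdry.1 (Finset.mem_filter.1 hv).1).1 hvA

/-- From the task to its subtask with index `i`, the boundary grows by at least one and the forced
set by at least `i`. So the exponent of the weight drops by at least `i + 1`, and the weights form a
geometric series. -/
theorem weight_children {τ : Task n} (hg : G.Good k τ) :
    ((G.children τ (G.closest τ.X τ.Q)).map (G.weight k)).sum + 1 ≤ G.weight k τ := by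
  have hw : G.weight k τ =
      2 ^ (2 * k - τ.Z.card - (G.bdry (G.closest τ.X τ.Q)).card) := if_pos hg
  rw [hw]
  have hc := isClosest_closest (G := G) hg.sub
  have hforced := hg.forced
  set A := G.closest τ.X τ.Q with hA
  refine sum_add_one_le_two_pow _ _ fun i hi => ?_
  simp only [children, List.map_map, List.length_map] at hi
  simp only [children, List.map_map, List.getElem_map, Function.comp]
  have hcount := le_card_filter_lt_verts i hi
  have htm : (verts (G.bdry A \ τ.Z))[i] ∈ G.bdry A \ τ.Z := mem_verts.1 (List.getElem_mem _)
  set t := (verts (G.bdry A \ τ.Z))[i] with ht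
  by_cases hgc : G.Good k (G.child τ A t)
  swap
  · exact .inl (if_neg hgc)
  right
  have hwc : G.weight k (G.child τ A t) = 2 ^ (2 * k - (G.child τ A t).Z.card -
    (G.bdry (G.closest (G.child τ A t).X (G.child τ A t).Q)).card) := if_pos hgc
  rw [hwc]
  have hcc := isClosest_closest (G := G) hgc.sub
  have hle := hgc.card_le
  have hfc := Finset.card_le_card hgc.forced
  set A' := G.closest (G.child τ A t).X (G.child τ A t).Q with hA'
  have hQA : (G.child τ A t).Q ⊆ A := child_Q_subset
  -- Otherwise the leastness of `A` puts `A` inside the region of the subtask, which lacks the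
  -- neighbours of `t` in `A`.
  have hlt : (G.bdry A).card < (G.bdry A').card := by
    by_contra hcon
    have : A ⊆ A' := hc.least A' hcc.le ((hcc.ge.trans hQA).trans hc.ge) (not_lt.1 hcon)
    have h1 := hcc.ge
    obtain ⟨-, u, hu, hut⟩ := mem_bdry.1 (Finset.mem_sdiff.1 htm).1
    exact (mem_child_Q.1 (h1 (this hu))).2 hut.symm
  -- The `i` earlier vertices of the list are boundary vertices below `t` outside `τ.Z`, hence newly
  -- forced.
  have hZ : τ.Z.card + i ≤ (G.child τ A t).Z.card := by
    have hd : Disjoint τ.Z ((G.bdry A \ τ.Z).filter (· < t)) :=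
      Finset.disjoint_left.2 fun v hv hv' =>
        (Finset.mem_sdiff.1 (Finset.mem_filter.1 hv').1).2 hv
    have := Finset.card_union_of_disjoint hd
    have hsub : τ.Z ∪ (G.bdry A \ τ.Z).filter (· < t) ⊆ (G.child τ A t).Z :=
      Finset.union_subset_union_right (Finset.filter_subset_filter _ Finset.sdiff_subset)
    have := Finset.card_le_card hsub
    omega
  -- The exponent does not run out: the forced set of a good subtask is contained in a boundary of
  -- size at most `k`, so both quantities subtracted from `2 * k` are at most `k`.
  refine ⟨by omega, Nat.pow_le_pow_right (by norm_num) (by omega)⟩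

/-- A set that fits a task and is closest to the start is found by the task or one of its
subtasks. -/
theorem good_of_fits {τ : Task n} {B : Finset (Fin n)} (h : G.TaskOK a b τ)
    (hB : G.IsClosest τ.X B B) (hs : G.IsSide a b k B) (hfit : G.Fits B τ) :
    G.Good k τ ∧ (B = G.closest τ.X τ.Q ∨
      ∃ σ ∈ G.children τ (G.closest τ.X τ.Q), G.Fits B σ) := by
  have hXQ : τ.X ⊆ τ.Q := hB.le.trans hfit.1
  have hc := isClosest_closest (G := G) hXQ
  set A := G.closest τ.X τ.Q with hA
  have hle : (G.bdry A).card ≤ (G.bdry B).card := hc.min B hB.le hfit.1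
  -- Uncrossing: `B ∪ A` has at least the boundary size of `A`, so `B ∩ A` has at most that of `B`,
  -- and `B` is closest to the start.
  have hBA : B ⊆ A := by
    have h1 := card_bdry_inter_add_card_bdry_union (G := G) B A
    have h2 := hc.min (B ∪ A) (hB.le.trans Finset.subset_union_left)
      (Finset.union_subset hfit.1 hc.ge)
    exact (hB.least (B ∩ A) (Finset.subset_inter hB.le hc.le) Finset.inter_subset_left
      (by omega)).trans Finset.inter_subset_right
  -- A forced vertex has a neighbour in `B ⊆ A`, and it is outside the region and hence outside `A`.
  have hforced : τ.Z ⊆ G.bdry A := by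
    intro z hz
    obtain ⟨hzB, u, hu, huz⟩ := mem_bdry.1 (hfit.2 hz)
    exact mem_bdry.2 ⟨fun hzA => Finset.disjoint_left.1 h.disj hz (hc.ge hzA), u, hBA hu, huz⟩
  have hg : G.Good k τ := ⟨hXQ, hforced, hle.trans hs.card_le⟩
  refine ⟨hg, or_iff_not_imp_left.2 fun hne => ?_⟩
  -- If the boundary of `A` were contained in that of `B`, then `W` could not enter `A`, since it
  -- avoids the boundary of `B`. But connectivity of `A` yields a boundary vertex `y` of `B` inside
  -- `A`, and the neighbour of `y` in `W` would lie in the boundary of `A`.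
  have hex : ((G.bdry A).filter (· ∉ G.bdry B)).Nonempty := by
    rw [Finset.nonempty_iff_ne_empty]
    intro hemp
    have hsub : G.bdry A ⊆ G.bdry B := by
      intro v hv
      by_contra hvB
      exact Finset.notMem_empty v (hemp ▸ Finset.mem_filter.2 ⟨hv, hvB⟩)
    have hAconn := hc.rconn h.rconn
    obtain ⟨y, hyA, hyB⟩ := hAconn.2 B (hB.le h.rconn.1) (hBA.ssubset_of_ne hne)
    obtain ⟨W, hW, hdisj, hWsub⟩ := hs.fullTo
    rw [Finset.disjoint_left] at hdisj
    simp only [Finset.mem_union, not_or] at hdisj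
    have hbA : b ∉ A := fun hb => by
      have := FullTo.subset_far h.fullTo (hc.ge hb)
      simp [far] at this
    have hWA : W ⊆ Aᶜ := hW.subset_of_closed (by simpa using hbA) fun u hu huA v hv huv => by
      rw [Finset.mem_compl] at huA ⊢
      intro hvA
      exact (hdisj hu).2 (hsub (mem_bdry.2 ⟨huA, v, hvA, huv.symm⟩))
    obtain ⟨-, w, hw, hwy⟩ := mem_bdry.1 (hWsub hyB)
    exact (hdisj hw).2 (hsub (mem_bdry.2 ⟨by simpa using hWA hw, y, hyA, hwy.symm⟩))
  -- The least vertex missing from the boundary of `B` selects the right subtask: all smaller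
  -- boundary vertices of `A` are in the boundary of `B`, as the subtask requires.
  obtain ⟨t, ht, hmin⟩ := Finset.exists_min_image _ id hex
  rw [Finset.mem_filter] at ht
  refine ⟨G.child τ A t, List.mem_map_of_mem (mem_verts.2 (Finset.mem_sdiff.2
    ⟨ht.1, fun hz => ht.2 (hfit.2 hz)⟩)), ?_, ?_⟩
  · intro v hv
    refine mem_child_Q.2 ⟨hBA hv, fun htv => ht.2 (mem_bdry.2 ⟨fun htB => ?_, v, hv, htv.symm⟩)⟩
    exact (mem_bdry.1 ht.1).1 (hBA htB)
  · refine Finset.union_subset hfit.2 fun s hs' => ?_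
    rw [Finset.mem_filter] at hs'
    by_contra hsB
    exact absurd (hmin s (Finset.mem_filter.2 ⟨hs'.1, hsB⟩)) (not_le.2 hs'.2)

end SimpleGraph

/-! ### The invariant of the work list and the number of tasks -/

namespace SimpleGraph

variable {n : ℕ}

/-- The invariant of the enumeration: `i` tasks have been processed, `pend` is the list of pending
tasks, `L` the list of sets found, and `found` the list of the sets found by the good tasks, each
with the origin of the task. -/
structure Inv (G : SimpleGraph (Fin n)) (a b : Fin n) (k i : ℕ) (pend : List (Task n))
    (L : List (Finset (Fin n)))
    (found : List (Option (Finset (Fin n) × Fin n) × Finset (Fin n))) : Prop where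
  taskOK : ∀ τ ∈ pend, G.TaskOK a b τ
  origin_mem : ∀ τ ∈ pend, τ.origin ∈ G.origins L
  nodup : L.Nodup
  isSide : ∀ A ∈ L, G.IsSide a b k A
  found_nodup : found.Nodup
  found_mem : ∀ r ∈ found, r.1 ∈ G.origins L ∧ r.2 ∈ L
  pairwise : pend.Pairwise fun τ σ => τ.origin = σ.origin → ∀ A, G.Fits A τ → ¬ G.Fits A σ
  found_fits : ∀ r ∈ found, ∀ τ ∈ pend, r.1 = τ.origin → ¬ G.Fits r.2 τ
  weight_le : found.length + (pend.map (G.weight k)).sum ≤ (G.origins L).length * 4 ^ k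
  count_le : i + pend.length ≤ (G.origins L).length + n * found.length
  complete : ∀ r ∈ G.origins L, ∀ B, G.IsClosest (originSet a r) B B → G.IsSide a b k B →
    B ∈ L ∨ ∃ τ ∈ pend, τ.origin = r ∧ G.Fits B τ

variable {G : SimpleGraph (Fin n)} {a b : Fin n} {k i : ℕ} {pend : List (Task n)}
  {L : List (Finset (Fin n))} {found : List (Option (Finset (Fin n) × Fin n) × Finset (Fin n))}

variable (G a b) in
/-- The task with which the enumeration starts. -/
noncomputable def firstTask : Task n := ⟨none, {a}, G.far b, ∅⟩

theorem inv_init : G.Inv a b k 0 [G.firstTask a b] [] [] where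
  taskOK τ hτ := by
    rw [List.mem_singleton.1 hτ]
    exact ⟨rfl, rconn_singleton a, G.fullTo_far b, by simp [firstTask]⟩
  origin_mem τ hτ := by
    rw [List.mem_singleton.1 hτ]
    simp [origins, firstTask]
  nodup := List.nodup_nil
  isSide := by simp
  found_nodup := List.nodup_nil
  found_mem := by simp
  pairwise := List.pairwise_singleton _ _
  found_fits := by simp
  weight_le := by simpa [origins] using G.weight_le k (G.firstTask a b)
  count_le := by simp [origins]
  complete r hr B hB hs := by
    refine .inr ⟨_, List.mem_singleton_self _, ?_, hs.fullTo.subset_far, by simp [firstTask]⟩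
    simpa [origins, firstTask, eq_comm] using hr

/-- A set that has not been found before is added. -/
theorem Inv.add {A : Finset (Fin n)} (h : G.Inv a b k i pend L found) (hA : G.IsSide a b k A)
    (hAL : A ∉ L) : G.Inv a b k i (pend ++ G.newTasks b A) (L ++ [A]) found where
  taskOK τ hτ := by
    rcases List.mem_append.1 hτ with hτ | hτ
    · exact h.taskOK τ hτ
    · obtain ⟨v, hv, rfl⟩ := List.mem_map.1 hτ
      exact ⟨rfl, hA.rconn.insert (mem_verts.1 hv), G.fullTo_far b, by simp⟩
  origin_mem τ hτ := by
    rw [origins_append, List.mem_append]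
    rcases List.mem_append.1 hτ with hτ | hτ
    · exact .inl (h.origin_mem τ hτ)
    · obtain ⟨v, hv, rfl⟩ := List.mem_map.1 hτ
      exact .inr (List.mem_map_of_mem hv)
  nodup := by
    rw [List.nodup_append]
    exact ⟨h.nodup, by simp, by simpa using fun B hB (e : B = A) => hAL (e ▸ hB)⟩
  isSide B hB := by
    rcases List.mem_append.1 hB with hB | hB
    · exact h.isSide B hB
    · exact List.mem_singleton.1 hB ▸ hA
  found_nodup := h.found_nodup
  found_mem r hr := by
    rw [origins_append]
    exact ⟨List.mem_append_left _ (h.found_mem r hr).1, List.mem_append_left _ (h.found_mem r hr).2⟩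
  pairwise := by
    rw [List.pairwise_append]
    -- The new tasks have pairwise different origins, and no older task has an origin that mentions
    -- `A`, because `A` was not in the list. So nothing has to be shown about their scopes.
    refine ⟨h.pairwise, ?_, ?_⟩
    · rw [newTasks, List.pairwise_map]
      exact nodup_verts.imp fun hne e => absurd (by simpa using e) hne
    · intro τ hτ σ hσ e
      obtain ⟨v, -, rfl⟩ := List.mem_map.1 hσ
      have := h.origin_mem τ hτ
      rw [e, mem_origins] at this
      simp_all
  found_fits r hr τ hτ e := by
    rcases List.mem_append.1 hτ with hτ | hτ
    · exact h.found_fits r hr τ hτ e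
    · obtain ⟨v, -, rfl⟩ := List.mem_map.1 hτ
      have := (h.found_mem r hr).1
      rw [e, mem_origins] at this
      simp_all
  weight_le := by
    have h1 := h.weight_le
    have h2 : ((G.newTasks b A).map (G.weight k)).sum ≤ (verts (G.bdry A)).length * 4 ^ k := by
      have := List.sum_le_card_nsmul ((G.newTasks b A).map (G.weight k)) (4 ^ k) (by
        intro x hx
        obtain ⟨τ, -, rfl⟩ := List.mem_map.1 hx
        exact G.weight_le k τ)
      simpa [newTasks] using this
    rw [List.map_append, List.sum_append, origins_append, List.length_append, List.length_map,
      Nat.add_mul]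
    omega
  count_le := by
    have := h.count_le
    rw [origins_append, List.length_append, List.length_append, newTasks, List.length_map,
      List.length_map]
    omega
  complete r hr B hB hs := by
    rw [origins_append, List.mem_append] at hr
    rcases hr with hr | hr
    · rcases h.complete r hr B hB hs with h1 | ⟨τ, hτ, h1⟩
      · exact .inl (List.mem_append_left _ h1)
      · exact .inr ⟨τ, List.mem_append_left _ hτ, h1⟩
    · obtain ⟨v, hv, rfl⟩ := List.mem_map.1 hr
      refine .inr ⟨_, List.mem_append_right _ (List.mem_map_of_mem hv), rfl,
        hs.fullTo.subset_far, by simp⟩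

/-- A task that finds nothing is dropped. -/
theorem Inv.drop {τ : Task n} (h : G.Inv a b k i (τ :: pend) L found) (hτ : ¬ G.Good k τ) :
    G.Inv a b k (i + 1) pend L found where
  taskOK σ hσ := h.taskOK σ (List.mem_cons_of_mem _ hσ)
  origin_mem σ hσ := h.origin_mem σ (List.mem_cons_of_mem _ hσ)
  nodup := h.nodup
  isSide := h.isSide
  found_nodup := h.found_nodup
  found_mem := h.found_mem
  pairwise := (List.pairwise_cons.1 h.pairwise).2
  found_fits r hr σ hσ := h.found_fits r hr σ (List.mem_cons_of_mem _ hσ)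
  weight_le := by
    have := h.weight_le
    rw [List.map_cons, List.sum_cons] at this
    omega
  count_le := by
    have := h.count_le
    rw [List.length_cons] at this
    omega
  complete r hr B hB hs := by
    rcases h.complete r hr B hB hs with h1 | ⟨σ, hσ, h1, h2⟩
    · exact .inl h1
    · rcases List.mem_cons.1 hσ with rfl | hσ
      -- By `good_of_fits`, a task with a target in its scope is good, so dropping a task that is
      -- not good loses no target.
      · have hok := h.taskOK σ List.mem_cons_self
        rw [← h1, ← hok.start] at hB
        exact absurd (good_of_fits hok hB hs h2).1 hτ
      · exact .inr ⟨σ, hσ, h1, h2⟩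

/-- A task that finds a known set is replaced with its subtasks. -/
theorem Inv.expand {τ : Task n} (h : G.Inv a b k i (τ :: pend) L found) (hτ : G.Good k τ)
    (hL : G.closest τ.X τ.Q ∈ L) :
    G.Inv a b k (i + 1) (pend ++ G.children τ (G.closest τ.X τ.Q)) L
      ((τ.origin, G.closest τ.X τ.Q) :: found) := by
  have hok := h.taskOK τ List.mem_cons_self
  have horig := h.origin_mem τ List.mem_cons_self
  have hpw := List.pairwise_cons.1 h.pairwise
  have hwc := weight_children hτ
  have hAQ : G.closest τ.X τ.Q ⊆ τ.Q := (isClosest_closest hτ.sub).ge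
  have hfitA := hτ.fits
  have hgf := fun B h1 h2 h3 => (good_of_fits (k := k) (B := B) hok h1 h2 h3).2
  have hcok := fun t ht => hok.child (t := t) hτ ht
  set A := G.closest τ.X τ.Q with hA
  have hchild : ∀ σ ∈ G.children τ A, ∃ t ∈ G.bdry A, σ = G.child τ A t := by
    intro σ hσ
    obtain ⟨t, ht, rfl⟩ := List.mem_map.1 hσ
    exact ⟨t, (Finset.mem_sdiff.1 (mem_verts.1 ht)).1, rfl⟩
  refine ⟨?_, ?_, h.nodup, h.isSide, ?_, ?_, ?_, ?_, ?_, ?_, ?_⟩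
  · intro σ hσ
    rcases List.mem_append.1 hσ with hσ | hσ
    · exact h.taskOK σ (List.mem_cons_of_mem _ hσ)
    · obtain ⟨t, ht, rfl⟩ := hchild σ hσ
      exact hcok t ht
  · intro σ hσ
    rcases List.mem_append.1 hσ with hσ | hσ
    · exact h.origin_mem σ (List.mem_cons_of_mem _ hσ)
    · obtain ⟨t, ht, rfl⟩ := hchild σ hσ
      exact horig
  · refine List.nodup_cons.2 ⟨fun hmem => ?_, h.found_nodup⟩
    -- The closest set is in the scope of its own task, whereas sets found earlier from the same
    -- origin are outside the scopes of all pending tasks.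
    exact h.found_fits _ hmem τ List.mem_cons_self rfl hfitA
  · intro r hr
    rcases List.mem_cons.1 hr with rfl | hr
    · exact ⟨horig, hL⟩
    · exact h.found_mem r hr
  · rw [List.pairwise_append]
    refine ⟨hpw.2, ?_, ?_⟩
    · rw [children, List.pairwise_map]
      refine List.Pairwise.imp_of_mem ?_ pairwise_verts
      intro s t hs _ hst _ B h1 h2
      exact not_fits_child_child (Finset.mem_sdiff.1 (mem_verts.1 hs)).1 hst h1 h2
    · intro σ hσ ρ hρ e B h1 h2
      obtain ⟨t, ht, rfl⟩ := hchild ρ hρ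
      exact hpw.1 σ hσ e.symm B (fits_of_fits_child hAQ h2) h1
  · intro r hr σ hσ e hf
    rcases List.mem_append.1 hσ with hσ | hσ
    · rcases List.mem_cons.1 hr with rfl | hr
      · exact hpw.1 σ hσ e A hfitA hf
      · exact h.found_fits r hr σ (List.mem_cons_of_mem _ hσ) e hf
    · obtain ⟨t, ht, rfl⟩ := hchild σ hσ
      rcases List.mem_cons.1 hr with rfl | hr
      · exact not_fits_child_self ht hf
      · exact h.found_fits r hr τ List.mem_cons_self e (fits_of_fits_child hAQ hf)
  · have := h.weight_le
    rw [List.map_cons, List.sum_cons] at this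
    rw [List.map_append, List.sum_append, List.length_cons]
    omega
  · have := h.count_le
    have hlen : (G.children τ A).length ≤ n := by
      rw [children, List.length_map]
      exact length_verts_le
    rw [List.length_cons] at this
    rw [List.length_append, List.length_cons, Nat.mul_add]
    omega
  · intro r hr B hB hs
    rcases h.complete r hr B hB hs with h1 | ⟨σ, hσ, h1, h2⟩
    · exact .inl h1
    · rcases List.mem_cons.1 hσ with rfl | hσ
      · rw [← h1, ← hok.start] at hB
        rcases hgf B hB hs h2 with rfl | ⟨ρ, hρ, hf⟩
        · exact .inl hL
        · refine .inr ⟨ρ, List.mem_append_right _ hρ, ?_, hf⟩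
          obtain ⟨t, ht, rfl⟩ := hchild ρ hρ
          exact h1
      · exact .inr ⟨σ, List.mem_append_left _ hσ, h1, h2⟩

/-- A bound for the number of tasks processed until `R` sets have been found. -/
def taskBound (n k R : ℕ) : ℕ := (1 + n * R) * (1 + n * min (4 ^ k) R)

theorem taskBound_mono (n k : ℕ) : Monotone (taskBound n k) := by
  intro R S h
  unfold taskBound
  gcongr

theorem taskBound_le {R : ℕ} (hR : 1 ≤ R) :
    taskBound n k R ≤ (n + 1) ^ 2 * (R * min (4 ^ k) R) := by
  have h1 : 1 ≤ min (4 ^ k) R := le_min (Nat.one_le_pow _ _ (by norm_num)) hR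
  unfold taskBound
  calc (1 + n * R) * (1 + n * min (4 ^ k) R)
      ≤ (R + n * R) * (min (4 ^ k) R + n * min (4 ^ k) R) := by gcongr
    _ = (n + 1) ^ 2 * (R * min (4 ^ k) R) := by ring

/-- The number of good tasks has two bounds: the weights allow `4 ^ k` per origin, and the pairs of
origin and set are distinct, which allows `L.length` per origin. All other tasks are initial tasks
or subtasks of good ones. -/
theorem Inv.le_taskBound (h : G.Inv a b k i pend L found) : i ≤ taskBound n k L.length := by
  have h1 : found.length ≤ (G.origins L).length * 4 ^ k := (Nat.le_add_right _ _).trans h.weight_le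
  have h2 : found.length ≤ (G.origins L).length * L.length := by
    have : found.Subperm ((G.origins L) ×ˢ L) := h.found_nodup.subperm fun r hr =>
      List.mem_product.2 (h.found_mem r hr)
    exact this.length_le.trans (List.length_product _ _).le
  have h3 : found.length ≤ (G.origins L).length * min (4 ^ k) L.length := by
    rcases min_choice (4 ^ k) L.length with e | e <;> rw [e] <;> assumption
  have h4 := length_origins_le (G := G) L
  calc i ≤ (G.origins L).length + n * found.length := (Nat.le_add_right _ _).trans h.count_le
    _ ≤ (G.origins L).length + n * ((G.origins L).length * min (4 ^ k) L.length) := by gcongr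
    _ = (G.origins L).length * (1 + n * min (4 ^ k) L.length) := by ring
    _ ≤ _ := by unfold taskBound; gcongr

/-- Needed only for termination, where any bound independent of the run will do. -/
theorem Inv.length_le (h : G.Inv a b k i pend L found) : L.length ≤ 2 ^ n := by
  simpa using h.nodup.length_le_card

/-- When no tasks are left, all minimal separators of size at most `k` have been found. -/
theorem Inv.mem_iff (h : G.Inv a b k i [] L found) (A : Finset (Fin n)) :
    A ∈ L ↔ G.IsSide a b k A := by
  refine ⟨h.isSide A, fun hA => ?_⟩
  -- The closest set between a start and `A` stays closest when the region shrinks to that set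
  -- itself, and it inherits from `A` the properties of a side. With no task pending, completeness
  -- puts it into `L`.
  have hcl : ∀ r ∈ G.origins L, originSet a r ⊆ A → ∃ B ∈ L, originSet a r ⊆ B ∧ B ⊆ A := by
    intro r hr hrA
    obtain ⟨B, hB⟩ := G.exists_isClosest hrA
    have hBB : G.IsClosest (originSet a r) B B :=
      ⟨hB.le, subset_rfl, fun C h1 h2 => hB.min C h1 (h2.trans hB.ge),
        fun C h1 h2 h3 => hB.least C h1 (h2.trans hB.ge) h3⟩
    have hconn : G.RConn a (originSet a r) := by
      rcases mem_origins.1 hr with rfl | ⟨C, hC, v, hv, rfl⟩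
      · exact rconn_singleton a
      · exact (h.isSide C hC).rconn.insert hv
    rcases h.complete r hr B hBB ⟨hB.rconn hconn, hB.fullTo hA.fullTo,
      (hB.min A hrA subset_rfl).trans hA.card_le⟩ with h1 | ⟨τ, hτ, -⟩
    · exact ⟨B, h1, hB.le, hB.ge⟩
    · simp at hτ
  obtain ⟨B₀, hB₀, -, hB₀A⟩ := hcl none (mem_origins.2 (.inl rfl))
    (by simpa [originSet] using hA.rconn.1)
  -- A largest found set inside `A` is `A`: otherwise `A` contains a boundary vertex `v` of it, and
  -- the origin `(B, v)` yields a larger one.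
  obtain ⟨B, hB, hmax⟩ := Finset.exists_max_image (L.toFinset.filter (· ⊆ A)) Finset.card
    ⟨B₀, by simp [hB₀, hB₀A]⟩
  rw [Finset.mem_filter, List.mem_toFinset] at hB
  by_cases e : B = A
  · exact e ▸ hB.1
  exfalso
  obtain ⟨v, hvA, hvB⟩ := hA.rconn.2 B (h.isSide B hB.1).rconn.1 (hB.2.ssubset_of_ne e)
  obtain ⟨C, hC, hBC, hCA⟩ := hcl (some (B, v)) (mem_origins.2 (.inr ⟨B, hB.1, v, hvB, rfl⟩))
    (Finset.insert_subset hvA hB.2)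
  have h1 := Finset.card_le_card hBC
  have h2 := hmax C (by simp [hC, hCA])
  have h3 : v ∉ B := (mem_bdry.1 hvB).1
  simp only [originSet, Finset.card_insert_of_notMem h3] at h1
  omega

theorem exists_isSide_iff {S : Finset (Fin n)} :
    (∃ A, G.IsSide a b k A ∧ G.bdry A = S) ↔ G.IsMinSep a b S ∧ S.card ≤ k := by
  constructor
  · rintro ⟨A, hA, rfl⟩
    exact ⟨hA.rconn.isMinSep_bdry hA.fullTo, hA.card_le⟩
  · rintro ⟨h, hk⟩
    obtain ⟨A, h1, h2, h3⟩ := h.exists_side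
    exact ⟨A, ⟨h1, h2, h3 ▸ hk⟩, h3⟩

end SimpleGraph

/-! ## Programs with bounded loops -/

namespace RAM

/-- Memory with one entry changed. -/
def upd (m : Mem) (x i v : ℕ) : Mem := Function.update m x (Function.update (m x) i v)

theorem upd_apply (m : Mem) (x i v y : ℕ) :
    upd m x i v y = if y = x then Function.update (m x) i v else m y := by
  rw [upd, Function.update_apply]

theorem upd_of_ne {m : Mem} {x i v y : ℕ} (h : y ≠ x) : upd m x i v y = m y := by
  rw [upd_apply, if_neg h]

theorem upd_self (m : Mem) (x i v : ℕ) : upd m x i v x = Function.update (m x) i v := by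
  rw [upd_apply, if_pos rfl]

/-- The scalar variable `x`, which is the first entry of the array `x`. -/
abbrev Expr.var (x : ℕ) : Expr := .get x (.lit 0)

abbrev Expr.not (e : Expr) : Expr := .eq e (.lit 0)

abbrev Expr.and (e f : Expr) : Expr := .lt (.not e) (.not (.not f))

abbrev Expr.or (e f : Expr) : Expr := .not (.and (.not e) (.not f))

/-- Commands: programs without output whose loops have a counter `x` that runs up to the value of a
variable `b`. -/
inductive Cmd : Type
  | skip
  | set (x : ℕ) (i e : Expr)
  | seq (c d : Cmd)
  | ite (e : Expr) (c d : Cmd)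
  | loop (x b : ℕ) (c : Cmd)

notation:60 c:61 ";;" d:60 => Cmd.seq c d

namespace Cmd

def compile : Cmd → Prog
  | skip => .skip
  | set x i e => .set x i e
  | seq c d => .seq c.compile d.compile
  | ite e c d => .ite e c.compile d.compile
  | .loop x b c => .seq (.set x (.lit 0) (.lit 0)) (.loop (.lt (.var x) (.var b))
      (.seq c.compile (.set x (.lit 0) (.succ (.var x)))))

/-- The effect of the first `j` rounds of a loop with counter `x`. -/
def rounds (f : Mem → Mem) (x : ℕ) (m : Mem) : ℕ → Mem
  | 0 => upd m x 0 0
  | j + 1 => upd (f (rounds f x m j)) x 0 (j + 1)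

/-- The effect of a command on the memory. -/
def sem : Cmd → Mem → Mem
  | skip, m => m
  | set x i e, m => upd m x (i.eval m) (e.eval m)
  | seq c d, m => d.sem (c.sem m)
  | ite e c d, m => if e.eval m ≠ 0 then c.sem m else d.sem m
  | .loop x b c, m => rounds c.sem x m (m b 0)

/-- The arrays to which a command writes. -/
def writes : Cmd → List ℕ
  | skip => []
  | set x _ _ => [x]
  | seq c d => c.writes ++ d.writes
  | ite _ c d => c.writes ++ d.writes
  | .loop x _ c => x :: c.writes

/-- The loops of the command are bounded by the variables `0` and `2`, which are not written to, and
the loop counters are not changed in the loops. -/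
def ok : Cmd → Bool
  | skip => true
  | set x _ _ => x != 0 && x != 2
  | seq c d => c.ok && d.ok
  | ite _ c d => c.ok && d.ok
  | .loop x b c => x != 0 && x != 2 && (b == 0 || b == 2) && !c.writes.contains x && c.ok

/-- The time used by a command when all loop bounds are at most `N`. -/
def time (N : ℕ) : Cmd → ℕ
  | skip => 1
  | set _ i e => i.cost + e.cost + 1
  | seq c d => c.time N + d.time N
  | ite e c d => e.cost + 1 + (c.time N + d.time N)
  -- Each round pays 6 for the guard and 5 for the increment; the initial assignment costs 3 and the
  -- last, failing guard 6.
  | .loop _ _ c => N * (c.time N + 11) + 9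

theorem rounds_frame {f : Mem → Mem} {x y : ℕ} (hy : y ≠ x) (hf : ∀ m, f m y = m y) (m : Mem)
    (j : ℕ) : rounds f x m j y = m y := by
  induction j with
  | zero => exact upd_of_ne hy
  | succ j ih => rw [rounds, upd_of_ne hy, hf, ih]

theorem rounds_counter (f : Mem → Mem) (x : ℕ) (m : Mem) (j : ℕ) : rounds f x m j x 0 = j := by
  cases j <;> simp [rounds, upd_self]

theorem sem_frame {c : Cmd} {x : ℕ} (h : x ∉ c.writes) (m : Mem) : c.sem m x = m x := by
  induction c generalizing m with
  | skip => rfl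
  | set y i e => exact upd_of_ne (by simpa [writes] using h)
  | seq c d ihc ihd =>
    simp only [writes, List.mem_append, not_or] at h
    rw [sem, ihd h.2, ihc h.1]
  | ite e c d ihc ihd =>
    simp only [writes, List.mem_append, not_or] at h
    rw [sem]
    split_ifs
    · exact ihc h.1 m
    · exact ihd h.2 m
  | loop y b c ih =>
    simp only [writes, List.mem_cons, not_or] at h
    exact rounds_frame h.1 (ih h.2) m _

/-- The invariant rule for loops. -/
theorem loop_induction {c : Cmd} {x b : ℕ} {m : Mem} (I : ℕ → Mem → Prop)
    (h0 : I 0 (upd m x 0 0))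
    (hs : ∀ j m', j < m b 0 → m' x 0 = j → (∀ y, y ∉ (Cmd.loop x b c).writes → m' y = m y) →
      I j m' → I (j + 1) (upd (c.sem m') x 0 (j + 1))) :
    I (m b 0) ((Cmd.loop x b c).sem m) := by
  have key : ∀ j, j ≤ m b 0 → I j (rounds c.sem x m j) := by
    intro j
    induction j with
    | zero => exact fun _ => h0
    | succ j ih =>
      intro hj
      refine hs j _ hj (rounds_counter _ _ _ _) (fun y hy => ?_) (ih (by omega))
      simp only [writes, List.mem_cons, not_or] at hy
      exact rounds_frame hy.1 (fun m => sem_frame hy.2 m) m j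
  exact key _ le_rfl

/-- By induction on the number `d` of rounds that remain. The body changes neither the counter nor
the bound, so the machine's loop follows `rounds` step by step. -/
theorem exec_loop {c : Cmd} {x b N T : ℕ} (hxb : b ≠ x) (hx : x ∉ c.writes) (hb : b ∉ c.writes)
    (hc : ∀ s : State, s.mem 0 0 ≤ N → s.mem 2 0 ≤ N →
      ∃ τ ≤ T, Exec c.compile s { s with mem := c.sem s.mem, time := s.time + τ })
    (m : Mem) (h0 : ∀ j, rounds c.sem x m j 0 0 ≤ N) (h2 : ∀ j, rounds c.sem x m j 2 0 ≤ N)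
    (cur : List ℕ) (out : List (List ℕ × ℕ)) (d j t : ℕ) (hd : j + d = m b 0) :
    ∃ τ ≤ d * (T + 11) + 6, Exec (.loop (.lt (.var x) (.var b))
        (.seq c.compile (.set x (.lit 0) (.succ (.var x)))))
      ⟨rounds c.sem x m j, cur, out, t⟩ ⟨rounds c.sem x m (m b 0), cur, out, t + τ⟩ := by
  have hbj : ∀ j, rounds c.sem x m j b 0 = m b 0 := fun j => by
    rw [rounds_frame hxb (fun m => sem_frame hb m)]
  induction d generalizing j t with
  | zero =>
    obtain rfl : j = m b 0 := hd
    refine ⟨6, by omega, ?_⟩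
    exact Exec.loop_false (s := ⟨rounds c.sem x m (m b 0), cur, out, t⟩)
      (by simp [Expr.eval, rounds_counter, hbj])
  | succ d ih =>
    obtain ⟨τ, hτ, hexec⟩ := hc ⟨rounds c.sem x m j, cur, out, t + 6⟩ (h0 j) (h2 j)
    obtain ⟨τ', hτ', hexec'⟩ := ih (j + 1) (t + 6 + τ + (1 + 3) + 1) (by omega)
    refine ⟨6 + τ + 5 + τ', by rw [Nat.add_mul]; omega, ?_⟩
    have hval : (c.sem (rounds c.sem x m j)) x 0 = j := by
      rw [sem_frame hx, rounds_counter]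
    refine Exec.loop_true ?_ (.seq hexec (.set _ x _ _)) ?_
    · simp [Expr.eval, rounds_counter, hbj]
      omega
    · have heq : upd (c.sem (rounds c.sem x m j)) x 0 (c.sem (rounds c.sem x m j) x 0 + 1) =
          rounds c.sem x m (j + 1) := by rw [hval]; rfl
      rw [← heq, show t + 6 + τ + (1 + 3) + 1 + τ' = t + (6 + τ + 5 + τ') by omega] at hexec'
      exact hexec'

/-- Commands halt, in the given time. -/
theorem exec {c : Cmd} (hc : c.ok) {N : ℕ} (s : State) (h0 : s.mem 0 0 ≤ N) (h2 : s.mem 2 0 ≤ N) :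
    ∃ τ ≤ c.time N, Exec c.compile s { s with mem := c.sem s.mem, time := s.time + τ } := by
  have hw : ∀ {c : Cmd}, c.ok → 0 ∉ c.writes ∧ 2 ∉ c.writes := by
    intro c
    induction c with
    | skip => simp [writes]
    | set x i e => simp only [ok, writes]; grind
    | seq c d ihc ihd => simp only [ok, writes]; grind
    | ite e c d ihc ihd => simp only [ok, writes]; grind
    | loop x b c ih => simp only [ok, writes]; grind
  induction c generalizing s with
  | skip => exact ⟨1, le_rfl, .skip s⟩
  | set x i e => exact ⟨_, le_rfl, .set s x i e⟩
  | seq c d ihc ihd =>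
    rw [ok, Bool.and_eq_true] at hc
    obtain ⟨τ, hτ, h⟩ := ihc hc.1 s h0 h2
    obtain ⟨τ', hτ', h'⟩ := ihd hc.2 ⟨c.sem s.mem, s.cur, s.out, s.time + τ⟩
      (by simpa only [sem_frame (hw hc.1).1] using h0)
      (by simpa only [sem_frame (hw hc.1).2] using h2)
    refine ⟨τ + τ', Nat.add_le_add hτ hτ', ?_⟩
    rw [← add_assoc]
    exact .seq h h'
  | ite e c d ihc ihd =>
    rw [ok, Bool.and_eq_true] at hc
    by_cases he : e.eval s.mem = 0
    · obtain ⟨τ, hτ, h⟩ := ihd hc.2 (s.tick (e.cost + 1)) h0 h2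
      refine ⟨e.cost + 1 + τ, by rw [time]; omega, ?_⟩
      rw [sem, if_neg (not_not.2 he), ← add_assoc]
      exact .ite_false he h
    · obtain ⟨τ, hτ, h⟩ := ihc hc.1 (s.tick (e.cost + 1)) h0 h2
      refine ⟨e.cost + 1 + τ, by rw [time]; omega, ?_⟩
      rw [sem, if_pos he, ← add_assoc]
      exact .ite_true he h
  | loop x b c ih =>
    simp only [ok, Bool.and_eq_true, bne_iff_ne, Bool.or_eq_true, beq_iff_eq, Bool.not_eq_true',
      List.contains_eq_mem, decide_eq_false_iff_not] at hc
    obtain ⟨⟨⟨⟨hx0, hx2⟩, hb⟩, hxw⟩, hc⟩ := hc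
    have hcw := hw hc
    have hr0 : ∀ j, rounds c.sem x s.mem j 0 0 ≤ N := fun j => by
      rwa [rounds_frame hx0.symm (fun m => sem_frame hcw.1 m)]
    have hr2 : ∀ j, rounds c.sem x s.mem j 2 0 ≤ N := fun j => by
      rwa [rounds_frame hx2.symm (fun m => sem_frame hcw.2 m)]
    have hbN : s.mem b 0 ≤ N := by rcases hb with rfl | rfl <;> assumption
    obtain ⟨τ, hτ, h⟩ := exec_loop (b := b) (by rintro rfl; omega) hxw
      (by rcases hb with rfl | rfl; exacts [hcw.1, hcw.2]) (fun s => ih hc s) s.mem hr0 hr2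
      s.cur s.out (s.mem b 0) 0 (s.time + 3) (by omega)
    refine ⟨3 + τ, ?_, ?_⟩
    · have := Nat.mul_le_mul_right (c.time N + 11) hbN
      rw [time]
      omega
    · rw [← add_assoc]
      exact .seq (.set s x _ _) h

theorem exists_polynomial_time (c : Cmd) : ∃ p : Polynomial ℕ, ∀ N, c.time N = p.eval N := by
  induction c with
  | skip => exact ⟨1, by simp [time]⟩
  | set x i e => exact ⟨.C (i.cost + e.cost + 1), by simp [time]⟩
  | seq c d ihc ihd =>
    obtain ⟨p, hp⟩ := ihc
    obtain ⟨q, hq⟩ := ihd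
    exact ⟨p + q, by simp [time, hp, hq]⟩
  | ite e c d ihc ihd =>
    obtain ⟨p, hp⟩ := ihc
    obtain ⟨q, hq⟩ := ihd
    exact ⟨.C (e.cost + 1) + (p + q), fun N => by
      simp only [time, hp, hq, Polynomial.eval_add, Polynomial.eval_C]⟩
  | loop x b c ih =>
    obtain ⟨p, hp⟩ := ih
    exact ⟨.X * (p + .C 11) + .C 9, fun N => by
      simp only [time, hp, Polynomial.eval_add, Polynomial.eval_mul, Polynomial.eval_X,
        Polynomial.eval_C]⟩

end Cmd

end RAM

/-! ## Minimum cuts -/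

/-- The capacity of the arcs of a network on `0, …, N - 1` that leave `U`. -/
def cut (N : ℕ) (c : ℕ → ℕ → ℕ) (U : Finset ℕ) : ℕ :=
  ∑ x ∈ Finset.range N, ∑ y ∈ Finset.range N, if x ∈ U ∧ y ∉ U then c x y else 0

theorem cut_congr {N : ℕ} {c d : ℕ → ℕ → ℕ} (h : ∀ x < N, ∀ y < N, c x y = d x y)
    (U : Finset ℕ) : cut N c U = cut N d U := by
  refine Finset.sum_congr rfl fun x hx => Finset.sum_congr rfl fun y hy => ?_
  rw [h x (Finset.mem_range.1 hx) y (Finset.mem_range.1 hy)]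

theorem cut_eq_zero {N : ℕ} {c : ℕ → ℕ → ℕ} {U : Finset ℕ} :
    cut N c U = 0 ↔ ∀ x < N, ∀ y < N, x ∈ U → y ∉ U → c x y = 0 := by
  simp only [cut, Finset.sum_eq_zero_iff, Finset.mem_range, ite_eq_right_iff, and_imp]

/-- Moving one unit of capacity from an arc to the reverse arc. -/
def shift (c : ℕ → ℕ → ℕ) (p v x y : ℕ) : ℕ :=
  if x = p ∧ y = v then c p v - 1 else if x = v ∧ y = p then c v p + 1 else c x y

/-- The cut loses a unit if only `p` is in `U` and gains one if only `v` is. In this additive form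
the identities for the arcs of a path telescope, and only its endpoints remain. -/
theorem cut_shift {N : ℕ} {c : ℕ → ℕ → ℕ} {p v : ℕ} (hp : p < N) (hv : v < N) (hpv : p ≠ v)
    (hc : 0 < c p v) (U : Finset ℕ) :
    cut N (shift c p v) U + (if p ∈ U then 1 else 0) = cut N c U + (if v ∈ U then 1 else 0) := by
  have ind : ∀ p v, p < N → v < N → ∑ x ∈ Finset.range N, ∑ y ∈ Finset.range N,
      (if x = p then if y = v then if x ∈ U ∧ y ∉ U then 1 else 0 else 0 else 0) =
        if p ∈ U ∧ v ∉ U then 1 else 0 := by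
    intro p v hp hv
    rw [Finset.sum_eq_single p, Finset.sum_eq_single v]
    · simp
    · intro y _ hy
      simp [hy]
    · simp [hv]
    · intro x _ hx
      simp [hx]
    · simp [hp]
  have key : cut N (shift c p v) U + (if p ∈ U ∧ v ∉ U then 1 else 0) =
      cut N c U + (if v ∈ U ∧ p ∉ U then 1 else 0) := by
    rw [← ind p v hp hv, ← ind v p hv hp, cut, cut, ← Finset.sum_add_distrib,
      ← Finset.sum_add_distrib]
    refine Finset.sum_congr rfl fun x _ => ?_
    rw [← Finset.sum_add_distrib, ← Finset.sum_add_distrib]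
    refine Finset.sum_congr rfl fun y _ => ?_
    unfold shift
    grind
  grind

/-! ### Vertex boundaries as cuts of the split network -/

namespace SimpleGraph

variable {n : ℕ}

/-- A network in which the cuts correspond to sets of vertices: the vertex `v` is split into an
entry `v` and an exit `n + v`, joined by an arc of capacity `1`. -/
structure IsNetwork (G : SimpleGraph (Fin n)) (D : ℕ → ℕ → ℕ) : Prop where
  entry_entry : ∀ u v : Fin n, D u v = 0
  exit_exit : ∀ u v : Fin n, D (n + u) (n + v) = 0
  entry_exit : ∀ u v : Fin n, D u (n + v) = if u = v then 1 else 0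
  exit_entry : ∀ u v : Fin n, D (n + u) v ≠ 0 ↔ G.Adj u v
  exit_entry_large : ∀ u v : Fin n, G.Adj u v → n < D (n + u) v

variable {G : SimpleGraph (Fin n)} {D : ℕ → ℕ → ℕ}

theorem IsNetwork.cut_eq (hD : G.IsNetwork D) (U : Finset ℕ) :
    cut (2 * n) D U = (Finset.univ.filter fun v : Fin n => (v : ℕ) ∈ U ∧ n + (v : ℕ) ∉ U).card +
      ∑ u : Fin n, ∑ v : Fin n, if n + (u : ℕ) ∈ U ∧ (v : ℕ) ∉ U then D (n + u) v else 0 := by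
  have h1 : ∀ f : ℕ → ℕ, ∑ x ∈ Finset.range (2 * n), f x =
      ∑ v : Fin n, f v + ∑ v : Fin n, f (n + v) := by
    intro f
    rw [two_mul, Finset.sum_range_add, Finset.sum_range, Finset.sum_range]
  simp only [cut, h1, hD.entry_entry, hD.exit_exit, hD.entry_exit, ite_self, Finset.sum_const_zero,
    zero_add, add_zero]
  congr 1
  rw [Finset.card_filter]
  refine Finset.sum_congr rfl fun v _ => ?_
  rw [Finset.sum_eq_single v]
  · simp
  · intro u _ hu
    simp [hu.symm]
  · simp

/-- The vertices whose exit lies in `U`. -/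
def exits (n : ℕ) (U : Finset ℕ) : Finset (Fin n) := Finset.univ.filter fun v => n + (v : ℕ) ∈ U

@[simp] theorem mem_exits {U : Finset ℕ} {v : Fin n} : v ∈ exits n U ↔ n + (v : ℕ) ∈ U := by
  simp [exits]

/-- A cut of value at most `n` is crossed by no arc from an exit to the entry of a neighbour, as
these have capacity above `n`. So each boundary vertex has its entry in `U` and its exit outside,
and its unit arc is cut. -/
theorem IsNetwork.card_bdry_exits_le (hD : G.IsNetwork D) {U : Finset ℕ}
    (h : cut (2 * n) D U ≤ n) : (G.bdry (exits n U)).card ≤ cut (2 * n) D U := by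
  rw [hD.cut_eq] at h ⊢
  refine le_add_right (Finset.card_le_card fun v hv => ?_)
  obtain ⟨hv1, u, hu, huv⟩ := mem_bdry.1 hv
  rw [mem_exits] at hv1 hu
  simp only [Finset.mem_filter, Finset.mem_univ, true_and]
  refine ⟨?_, hv1⟩
  by_contra hvU
  have h1 := Finset.single_le_sum (f := fun v : Fin n =>
    if n + (u : ℕ) ∈ U ∧ (v : ℕ) ∉ U then D (n + u) v else 0) (fun _ _ => Nat.zero_le _)
    (Finset.mem_univ v)
  have h2 := Finset.single_le_sum (f := fun u : Fin n => ∑ v : Fin n,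
    if n + (u : ℕ) ∈ U ∧ (v : ℕ) ∉ U then D (n + u) v else 0) (fun _ _ => Nat.zero_le _)
    (Finset.mem_univ u)
  have h3 := hD.exit_entry_large u v huv
  simp only [hu, hvU, not_false_eq_true, and_self, if_true] at h1 h2
  omega

open Classical in
variable (G) in
/-- The cut of the network that belongs to a set of vertices. -/
noncomputable def nodes (A : Finset (Fin n)) : Finset ℕ :=
  (Finset.range (2 * n)).filter fun x => (∃ v ∈ A ∪ G.bdry A, x = v) ∨ ∃ v ∈ A, x = n + v

theorem entry_mem_nodes {A : Finset (Fin n)} {v : Fin n} :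
    (v : ℕ) ∈ G.nodes A ↔ v ∈ A ∨ v ∈ G.bdry A := by
  have := v.2
  simp only [nodes, Finset.mem_filter, Finset.mem_range, Finset.mem_union]
  constructor
  · rintro ⟨-, ⟨w, hw, e⟩ | ⟨w, hw, e⟩⟩
    · rwa [Fin.ext e]
    · omega
  · exact fun h => ⟨by omega, .inl ⟨v, h, rfl⟩⟩

theorem exit_mem_nodes {A : Finset (Fin n)} {v : Fin n} :
    n + (v : ℕ) ∈ G.nodes A ↔ v ∈ A := by
  have := v.2
  simp only [nodes, Finset.mem_filter, Finset.mem_range]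
  constructor
  · rintro ⟨-, ⟨w, hw, e⟩ | ⟨w, hw, e⟩⟩
    · omega
    · rwa [Fin.ext (a := v) (b := w) (by omega)]
  · exact fun h => ⟨by omega, .inr ⟨v, h, rfl⟩⟩

/-- The entries of the boundary are included in the cut, so only the unit arcs of the boundary
vertices leave it. -/
theorem IsNetwork.cut_nodes (hD : G.IsNetwork D) (A : Finset (Fin n)) :
    cut (2 * n) D (G.nodes A) = (G.bdry A).card := by
  rw [hD.cut_eq, Finset.sum_eq_zero, add_zero]
  · congr 1
    ext v
    simp only [Finset.mem_filter, Finset.mem_univ, true_and, entry_mem_nodes, exit_mem_nodes]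
    have := fun h : v ∈ G.bdry A => (mem_bdry.1 h).1
    tauto
  · refine fun u _ => Finset.sum_eq_zero fun v _ => ?_
    by_contra h
    rw [ite_eq_right_iff] at h
    push Not at h
    obtain ⟨⟨h1, h2⟩, h3⟩ := h
    rw [exit_mem_nodes] at h1
    rw [entry_mem_nodes, not_or] at h2
    exact h2.2 (mem_bdry.2 ⟨h2.1, u, h1, (hD.exit_entry u v).1 h3⟩)

/-- The cut that belongs to `X` itself has value at most `n`. It is admissible because `X ⊆ Q`. -/
theorem IsNetwork.flow_le (hD : G.IsNetwork D) {c : ℕ → ℕ → ℕ} {j : ℕ} {X Q : Finset (Fin n)}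
    (hXQ : X ⊆ Q)
    (hc : ∀ U : Finset ℕ, (∀ x ∈ X, n + (x : ℕ) ∈ U) → (∀ q ∉ Q, n + (q : ℕ) ∉ U) →
      cut (2 * n) c U + j = cut (2 * n) D U) : j ≤ n := by
  have h1 := hc (G.nodes X) (fun x hx => exit_mem_nodes.2 hx)
    fun q hq h => hq (hXQ (exit_mem_nodes.1 h))
  have h2 : (G.bdry X).card ≤ n := by simpa using Finset.card_le_univ (G.bdry X)
  rw [hD.cut_nodes] at h1
  omega

/-- A residual network without augmenting paths yields the closest set. -/
theorem IsNetwork.isClosest (hD : G.IsNetwork D) {c : ℕ → ℕ → ℕ} {j : ℕ} {U₀ : Finset ℕ}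
    {X Q : Finset (Fin n)} (hXQ : X ⊆ Q)
    (hc : ∀ U : Finset ℕ, (∀ x ∈ X, n + (x : ℕ) ∈ U) → (∀ q ∉ Q, n + (q : ℕ) ∉ U) →
      cut (2 * n) c U + j = cut (2 * n) D U)
    (hX : ∀ x ∈ X, n + (x : ℕ) ∈ U₀) (hQ : ∀ q ∉ Q, n + (q : ℕ) ∉ U₀)
    (h0 : cut (2 * n) c U₀ = 0)
    (hleast : ∀ U : Finset ℕ, (∀ x ∈ X, n + (x : ℕ) ∈ U) → cut (2 * n) c U = 0 → U₀ ⊆ U) :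
    G.IsClosest X Q (exits n U₀) := by
  have hj := hc U₀ hX hQ
  rw [h0, zero_add] at hj
  -- The residual cut of a set between `X` and `Q` is the excess of its boundary over `j`. Hence the
  -- minimizers are the sets of residual cut zero, and the least zero cut gives the least minimizer.
  have hB : ∀ B, X ⊆ B → B ⊆ Q → cut (2 * n) c (G.nodes B) + j = (G.bdry B).card := by
    intro B h1 h2
    rw [← hD.cut_nodes]
    exact hc _ (fun x hx => exit_mem_nodes.2 (h1 hx)) fun q hq h => hq (h2 (exit_mem_nodes.1 h))
  have hjn : j ≤ n := hD.flow_le hXQ hc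
  have hle := hD.card_bdry_exits_le (U := U₀) (by omega)
  refine ⟨fun x hx => mem_exits.2 (hX x hx), fun v hv => ?_, fun B h1 h2 => ?_,
    fun B h1 h2 h3 v hv => ?_⟩
  · by_contra hvQ
    exact hQ v hvQ (mem_exits.1 hv)
  · have := hB B h1 h2
    omega
  · have := hB B h1 h2
    have hsub := hleast (G.nodes B) (fun x hx => exit_mem_nodes.2 (h1 hx)) (by omega)
    exact exit_mem_nodes.1 (hsub (mem_exits.1 hv))

end SimpleGraph

/-! ## The program: minimum cuts -/

namespace RAM

-- The arrays used by the program, besides the input in the arrays `0` and `1` and the number `2 * n`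
-- in the array `2`.
notation "vX" => (10 : ℕ)
notation "vQ" => (11 : ℕ)
notation "vZ" => (12 : ℕ)
notation "vA" => (19 : ℕ)
notation "vCap" => (30 : ℕ)
notation "vReach" => (31 : ℕ)
notation "vPar" => (32 : ℕ)
notation "vExit" => (33 : ℕ)
notation "vFlag" => (34 : ℕ)
notation "vCur" => (35 : ℕ)
notation "vPrev" => (36 : ℕ)
notation "vExitTo" => (37 : ℕ)
notation "vBit" => (38 : ℕ)
notation "vAddr" => (40 : ℕ)
notation "vI" => (41 : ℕ)
notation "vJ" => (42 : ℕ)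
notation "vU" => (43 : ℕ)
notation "vV" => (44 : ℕ)
notation "vRound" => (45 : ℕ)
notation "vStep" => (46 : ℕ)
notation "vFlow" => (47 : ℕ)

namespace Cmd

abbrev assign (x : ℕ) (e : Expr) : Cmd := .set x (.lit 0) e

abbrev incr (x : ℕ) : Cmd := .assign x (.succ (.var x))

/-- Computes the address of the entry `(x, y)` of a square matrix of size `b`. -/
def addr (b x y : ℕ) : Cmd :=
  .assign vAddr (.lit 0) ;;
  .loop vI b (.ite (.lt (.var vI) (.var x)) (.loop vJ b (.incr vAddr)) .skip) ;;
  .loop vI b (.ite (.lt (.var vI) (.var y)) (.incr vAddr) .skip)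

theorem loop_incr_sem (m : Mem) (b x d : ℕ) (hxd : x ≠ d) :
    (Cmd.loop x b (.incr d)).sem m d 0 = m d 0 + m b 0 := by
  refine loop_induction (fun j m' => m' d 0 = m d 0 + j) ?_ ?_
  · simp [upd_apply, hxd.symm]
  · intro j m' _ _ _ h
    simp [upd_apply, sem, Expr.eval, h, hxd.symm]
    omega

theorem addr_frame {b x y z : ℕ} (m : Mem) (h0 : z ≠ vAddr) (h1 : z ≠ vI) (h2 : z ≠ vJ) :
    (addr b x y).sem m z = m z :=
  sem_frame (by simp [addr, writes, h0, h1, h2]) m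

/-- Without multiplication the address is counted up in nested loops. The loops run up to `b` and
skip the rounds beyond the coordinates, whence the minima; they disappear for coordinates within the
matrix. -/
theorem addr_sem {b x y : ℕ} (m : Mem) (hb0 : b ≠ vAddr) (hb1 : b ≠ vI) (hb2 : b ≠ vJ)
    (hx0 : x ≠ vAddr) (hx1 : x ≠ vI) (hx2 : x ≠ vJ)
    (hy0 : y ≠ vAddr) (hy1 : y ≠ vI) (hy2 : y ≠ vJ) :
    (addr b x y).sem m vAddr 0 = min (m b 0) (m x 0) * m b 0 + min (m b 0) (m y 0) := by
  set m1 := (Cmd.assign vAddr (.lit 0)).sem m with hm1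
  set m2 := (Cmd.loop vI b
    (.ite (.lt (.var vI) (.var x)) (.loop vJ b (.incr vAddr)) .skip)).sem m1 with hm2
  have hf1 : ∀ z, z ≠ vAddr → m1 z = m z := fun z hz => sem_frame (by simp [writes, hz]) m
  have hf2 : ∀ z, z ≠ vAddr → z ≠ vI → z ≠ vJ → m2 z = m z := fun z h0 h1 h2 => by
    rw [hm2, sem_frame (by simp [writes, h0, h1, h2]), hf1 z h0]
  have h2 : m2 vAddr 0 = min (m b 0) (m x 0) * m b 0 := by
    have := loop_induction (m := m1) (x := vI) (b := b)
      (c := .ite (.lt (.var vI) (.var x)) (.loop vJ b (.incr vAddr)) .skip)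
      (fun j m' => m' vAddr 0 = min j (m x 0) * m b 0) ?_ ?_
    · rw [hf1 b hb0] at this
      exact this
    · simp [upd_apply, hm1, sem, Expr.eval]
    · intro j m' _ hj hfr h
      have hx : m' x 0 = m x 0 := by
        rw [hfr x (by simp [writes, hx0, hx1, hx2]), hf1 x hx0]
      have hb : m' b 0 = m b 0 := by
        rw [hfr b (by simp [writes, hb0, hb1, hb2]), hf1 b hb0]
      rw [upd_of_ne (by norm_num), sem]
      simp only [Expr.eval, hx, hj]
      by_cases h1 : j < m x 0
      · rw [if_pos h1, if_pos one_ne_zero, loop_incr_sem _ _ _ _ (by norm_num), h, hb,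
          min_eq_left h1.le, min_eq_left (by omega : j + 1 ≤ m x 0), Nat.succ_mul]
      · rw [if_neg h1, if_neg (not_not.2 rfl), sem, h, min_eq_right (by omega),
          min_eq_right (by omega)]
  have h3 := loop_induction (m := m2) (x := vI) (b := b)
      (c := .ite (.lt (.var vI) (.var y)) (.incr vAddr) .skip)
      (fun j m' => m' vAddr 0 = min (m b 0) (m x 0) * m b 0 + min j (m y 0)) ?_ ?_
  · rw [hf2 b hb0 hb1 hb2] at h3
    exact h3
  · simp [upd_apply, h2]
  · intro j m' _ hj hfr h
    have hy : m' y 0 = m y 0 := by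
      rw [hfr y (by simp [writes, hy0, hy1]), hf2 y hy0 hy1 hy2]
    rw [upd_of_ne (by norm_num), sem]
    simp only [Expr.eval, hy, hj]
    by_cases h1 : j < m y 0
    · rw [if_pos h1, if_pos one_ne_zero]
      simp [sem, upd_apply, Expr.eval, h]
      omega
    · rw [if_neg h1, if_neg (not_not.2 rfl), sem, h]
      omega

theorem update_matrix {f : ℕ → ℕ} {N x y x' y' w : ℕ} (hy : y < N) (hy' : y' < N) :
    Function.update f (x' * N + y') w (x * N + y) =
      if x = x' ∧ y = y' then w else f (x * N + y) := by
  rw [Function.update_apply]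
  congr 1
  rw [eq_iff_iff]
  constructor
  · intro h
    have h1 := congrArg (· / N) h
    have h2 := congrArg (· % N) h
    simp only [Nat.mul_comm _ N, Nat.mul_add_div (by omega : 0 < N),
      Nat.div_eq_of_lt hy, Nat.div_eq_of_lt hy', Nat.mul_add_mod, Nat.mod_eq_of_lt hy,
      Nat.mod_eq_of_lt hy'] at h1 h2
    exact ⟨by omega, h2⟩
  · rintro ⟨rfl, rfl⟩
    rfl

/-- Computes the exit `n + v` of a vertex. -/
def exit (v o : ℕ) : Cmd := .assign o (.var v) ;; .loop vI 0 (.incr o)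

theorem exit_sem {v o : ℕ} (m : Mem) (ho : vI ≠ o) (h0 : o ≠ 0) :
    (exit v o).sem m o 0 = m 0 0 + m v 0 := by
  rw [exit, sem, loop_incr_sem _ _ _ _ ho]
  simp [sem, upd_apply, Expr.eval, h0.symm, add_comm]

theorem exit_frame {v o z : ℕ} (m : Mem) (h0 : z ≠ o) (h1 : z ≠ vI) :
    (exit v o).sem m z = m z :=
  sem_frame (by simp [exit, writes, h0, h1]) m

/-- One step of the search: the arc from `u` to `v` is used to reach `v`. -/
def visit : Cmd :=
  .ite (.and (.not (.get vReach (.var vV))) (.and (.get vReach (.var vU))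
      (.lt (.get vReach (.var vU)) (.succ (.succ (.var vRound))))))
    (.addr 2 vU vV ;;
      .ite (.get vCap (.var vAddr))
        (.set vReach (.var vV) (.succ (.succ (.var vRound))) ;; .set vPar (.var vV) (.var vU)) .skip)
    .skip

/-- Breadth-first search in the residual network: reached nodes are labelled by their distance plus
one. -/
def search : Cmd :=
  .loop vV 0 (.set vReach (.var vV) (.lit 0) ;; .exit vV vExit ;;
    .set vReach (.var vExit) (.get vX (.var vV))) ;;
  .loop vRound 2 (.loop vU 2 (.loop vV 2 visit))

open Classical in
theorem visit_sem (m : Mem) {N u v r : ℕ} (hN : m 2 0 = N) (hu : m vU 0 = u) (hv : m vV 0 = v)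
    (hr : m vRound 0 = r) (huN : u < N) (hvN : v < N) :
    (visit.sem m vReach = if m vReach v = 0 ∧ m vReach u ≠ 0 ∧ m vReach u < r + 2 ∧
      m vCap (u * N + v) ≠ 0 then Function.update (m vReach) v (r + 2) else m vReach) ∧
    (visit.sem m vPar = if m vReach v = 0 ∧ m vReach u ≠ 0 ∧ m vReach u < r + 2 ∧
      m vCap (u * N + v) ≠ 0 then Function.update (m vPar) v u else m vPar) := by
  have haddr := addr_sem (b := 2) (x := vU) (y := vV) m (by norm_num) (by norm_num) (by norm_num)
    (by norm_num) (by norm_num) (by norm_num) (by norm_num) (by norm_num) (by norm_num)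
  rw [hN, hu, hv, min_eq_right huN.le, min_eq_right hvN.le] at haddr
  by_cases h1 : m vReach v = 0 <;> by_cases h2 : m vReach u = 0 <;>
    by_cases h3 : m vReach u < r + 2 <;> by_cases h4 : m vCap (u * N + v) = 0 <;>
    simp [visit, sem, Expr.eval, hu, hv, hr, h1, h2, h3, h4, haddr, addr_frame, upd_apply]

end Cmd

end RAM

/-! ### Correctness of the breadth-first search -/

namespace RAM

/-- The labels and predecessors after `r` rounds of the search. -/
structure Labels (N r : ℕ) (src : ℕ → Prop) (c : ℕ → ℕ → ℕ) (reach par : ℕ → ℕ) : Prop where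
  src_iff : ∀ x < N, src x ↔ reach x = 1
  par : ∀ x < N, 1 < reach x →
    par x < N ∧ 0 < reach (par x) ∧ reach (par x) < reach x ∧ 0 < c (par x) x
  le : ∀ x < N, reach x ≤ r + 1

/-- The set of reached nodes has no outgoing arcs. -/
def Closed (N : ℕ) (c : ℕ → ℕ → ℕ) (reach : ℕ → ℕ) : Prop :=
  ∀ x < N, ∀ y < N, reach x ≠ 0 → c x y ≠ 0 → reach y ≠ 0

/-- The state of the search in round `r`, after the arcs up to `(u, v)` have been tried. -/
structure Layer (N r : ℕ) (src : ℕ → Prop) (c : ℕ → ℕ → ℕ) (reach₀ : ℕ → ℕ) (u v : ℕ)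
    (reach par : ℕ → ℕ) : Prop where
  labels : Labels N (r + 1) src c reach par
  old : ∀ x < N, reach₀ x ≠ 0 → reach x = reach₀ x
  new : ∀ x < N, reach x = reach₀ x ∨ reach x = r + 2
  done : ∀ x < N, ∀ y < N, x < u ∨ x = u ∧ y < v → reach₀ x ≠ 0 → c x y ≠ 0 → reach y ≠ 0

section

variable {N r u v : ℕ} {src : ℕ → Prop} {c : ℕ → ℕ → ℕ} {reach₀ reach par : ℕ → ℕ}

open Classical in
theorem Layer.visit (hr : ∀ x < N, reach₀ x ≤ r + 1) (h : Layer N r src c reach₀ u v reach par)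
    (hu : u < N) (hv : v < N) :
    Layer N r src c reach₀ u (v + 1)
      (if reach v = 0 ∧ reach u ≠ 0 ∧ reach u < r + 2 ∧ c u v ≠ 0
        then Function.update reach v (r + 2) else reach)
      (if reach v = 0 ∧ reach u ≠ 0 ∧ reach u < r + 2 ∧ c u v ≠ 0
        then Function.update par v u else par) := by
  split_ifs with hc
  · obtain ⟨h1, h2, h3, h4⟩ := hc
    refine ⟨⟨fun x hx => ?_, fun x hx hx1 => ?_, fun x hx => ?_⟩, fun x hx hx0 => ?_,
      fun x hx => ?_, fun x hx y hy hxy hx0 hcxy => ?_⟩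
    · rw [h.labels.src_iff x hx, Function.update_apply]
      split_ifs with e
      · subst e; omega
      · rfl
    · by_cases e : x = v
      · subst e
        have hne : u ≠ x := by rintro rfl; exact h2 h1
        simp only [Function.update_self, Function.update_of_ne hne]
        exact ⟨hu, by omega, h3, by omega⟩
      · rw [Function.update_of_ne e] at hx1 ⊢
        rw [Function.update_of_ne e]
        obtain ⟨a1, a2, a3, a4⟩ := h.labels.par x hx hx1
        have hne : par x ≠ v := by rintro e'; rw [e'] at a2; omega
        rw [Function.update_of_ne hne]
        exact ⟨a1, a2, a3, a4⟩
    · rw [Function.update_apply]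
      split_ifs
      · omega
      · exact h.labels.le x hx
    · have hne : x ≠ v := by
        rintro rfl
        exact hx0 ((h.old x hx hx0).symm.trans h1)
      rw [Function.update_of_ne hne, h.old x hx hx0]
    · rw [Function.update_apply]
      split_ifs
      · exact .inr rfl
      · exact h.new x hx
    · rw [Function.update_apply]
      split_ifs with e
      · omega
      · exact h.done x hx y hy (by omega) hx0 hcxy
  · refine ⟨h.labels, h.old, h.new, fun x hx y hy hxy hx0 hcxy hy0 => ?_⟩
    by_cases e : x = u ∧ y = v
    · obtain ⟨rfl, rfl⟩ := e
      have h1 := h.old x hx hx0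
      have h2 := hr x hx
      exact hc ⟨hy0, by omega, by omega, hcxy⟩
    · exact h.done x hx y hy (by omega) hx0 hcxy hy0

theorem Layer.start (h : Labels N r src c reach par) : Layer N r src c reach 0 0 reach par :=
  ⟨⟨h.src_iff, h.par, fun x hx => (h.le x hx).trans (by omega)⟩, fun _ _ _ => rfl,
    fun _ _ => .inl rfl, fun x hx y hy hxy => by omega⟩

theorem Layer.next (h : Layer N r src c reach₀ u N reach par) :
    Layer N r src c reach₀ (u + 1) 0 reach par :=
  ⟨h.labels, h.old, h.new, fun x hx y hy hxy => h.done x hx y hy (by omega)⟩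

/-- A round that reaches no new node certifies that the reached set is closed; every other round
enlarges it. So `N` rounds suffice for `N` nodes. -/
theorem Layer.finish (h : Layer N r src c reach₀ N 0 reach par)
    (h0 : Closed N c reach₀ ∨ r ≤ ((Finset.range N).filter (reach₀ · ≠ 0)).card) :
    Closed N c reach ∨ r + 1 ≤ ((Finset.range N).filter (reach · ≠ 0)).card := by
  by_cases hnew : ∀ x < N, reach x ≠ 0 → reach₀ x ≠ 0
  · exact .inl fun x hx y hy hx0 hc => h.done x hx y hy (.inl hx) (hnew x hx hx0) hc
  · push Not at hnew
    obtain ⟨x, hx, hx1, hx0⟩ := hnew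
    -- If the old set was closed, nothing new can appear: the predecessor of a new node has a
    -- smaller label, so it was reached before this round.
    rcases h0 with h0 | h0
    · exfalso
      have e : reach x = r + 2 := by
        rcases h.new x hx with h1 | h1 <;> omega
      obtain ⟨a1, a2, a3, a4⟩ := h.labels.par x hx (by omega)
      have : reach (par x) = reach₀ (par x) := by
        rcases h.new _ a1 with h1 | h1 <;> omega
      exact h0 _ a1 x hx (by omega) (by omega) hx0
    · right
      have hss : (Finset.range N).filter (reach₀ · ≠ 0) ⊂ (Finset.range N).filter (reach · ≠ 0) := by
        rw [Finset.ssubset_iff_of_subset]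
        · exact ⟨x, by simp [hx, hx1], by simp [hx0]⟩
        · intro y hy
          rw [Finset.mem_filter, Finset.mem_range] at hy ⊢
          exact ⟨hy.1, by rw [h.old y hy.1 hy.2]; exact hy.2⟩
      have := Finset.card_lt_card hss
      omega

/-- Every closed set that contains the sources contains all reached nodes. -/
theorem Labels.mem_of_closed (h : Labels N r src c reach par) {U : Finset ℕ}
    (hsrc : ∀ x < N, src x → x ∈ U) (hU : ∀ x < N, ∀ y < N, x ∈ U → y ∉ U → c x y = 0)
    (x : ℕ) (hx : x < N) (hx0 : reach x ≠ 0) : x ∈ U := by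
  -- Labels strictly decrease along predecessors, which lead back to a source through arcs of
  -- positive capacity.
  induction hd : reach x using Nat.strong_induction_on generalizing x with
  | _ d ih =>
    by_cases h1 : reach x = 1
    · exact hsrc x hx ((h.src_iff x hx).2 h1)
    · obtain ⟨a1, a2, a3, a4⟩ := h.par x hx (by omega)
      have := ih _ (by omega) (par x) a1 (by omega) rfl
      by_contra hxU
      have := hU _ a1 x hx this hxU
      omega

end

/-- The entries of the array `f` are the indicator function of `S`. -/
def Bits {n : ℕ} (f : ℕ → ℕ) (S : Finset (Fin n)) : Prop :=
  ∀ v : Fin n, f v = if v ∈ S then 1 else 0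

theorem Bits.ne_zero {n : ℕ} {f : ℕ → ℕ} {S : Finset (Fin n)} (h : Bits f S) (v : Fin n) :
    f v ≠ 0 ↔ v ∈ S := by
  rw [h v]; simp

/-- The exits of the vertices in `X`. -/
def IsExit {n : ℕ} (X : Finset (Fin n)) (x : ℕ) : Prop := ∃ v ∈ X, x = n + v

namespace Cmd

/-- The residual network in the memory. -/
def residual (N : ℕ) (m : Mem) (x y : ℕ) : ℕ := m vCap (x * N + y)

theorem search_sem {n : ℕ} {m : Mem} {X : Finset (Fin n)} (hn : m 0 0 = n) (hN : m 2 0 = 2 * n)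
    (hX : Bits (m vX) X) :
    Labels (2 * n) (2 * n) (IsExit X) (residual (2 * n) m) (search.sem m vReach)
      (search.sem m vPar) ∧
    Closed (2 * n) (residual (2 * n) m) (search.sem m vReach) := by
  rw [search, sem]
  set c1 : Cmd := .loop vV 0 (.set vReach (.var vV) (.lit 0) ;; .exit vV vExit ;;
    .set vReach (.var vExit) (.get vX (.var vV))) with hc1
  set m1 := c1.sem m with hm1
  have hf1 : ∀ z, z ∉ c1.writes → m1 z = m z := fun z hz => sem_frame hz m
  have h1 : ∀ v < n, m1 vReach v = 0 ∧ m1 vReach (n + v) = m vX v := by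
    have := loop_induction (m := m) (x := vV) (b := 0)
      (c := .set vReach (.var vV) (.lit 0) ;; .exit vV vExit ;;
        .set vReach (.var vExit) (.get vX (.var vV)))
      (fun j m' => ∀ v < j, v < n → m' vReach v = 0 ∧ m' vReach (n + v) = m vX v) ?_ ?_
    · rw [hn] at this
      exact fun v hv => this v hv hv
    · intro v hv; omega
    · intro j m' hjn hj hfr h v hv hvn
      have hX : m' vX = m vX := hfr _ (by decide)
      have h0 : m' 0 = m 0 := hfr _ (by decide)
      rw [hn] at hjn
      simp [sem, upd_apply, Expr.eval, exit_frame, exit_sem, hj, h0, hn, hX,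
        Function.update_apply]
      by_cases e : v = j
      · subst e
        simp
        omega
      · have := h v (by omega) hvn
        simp [e, this]
        omega
  have hL1 : Labels (2 * n) 0 (IsExit X) (residual (2 * n) m) (m1 vReach) (m1 vPar) := by
    have hval : ∀ x < 2 * n, m1 vReach x = 1 ∧ IsExit X x ∨ m1 vReach x = 0 ∧ ¬ IsExit X x := by
      intro x hx
      by_cases hxn : x < n
      · refine .inr ⟨(h1 x hxn).1, ?_⟩
        rintro ⟨v, -, rfl⟩
        omega
      · have := (h1 (x - n) (by omega)).2
        rw [show n + (x - n) = x by omega, show x - n = ((⟨x - n, by omega⟩ : Fin n) : ℕ) from rfl,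
          hX] at this
        split_ifs at this with hmem
        · exact .inl ⟨this, _, hmem, by simp; omega⟩
        · refine .inr ⟨this, ?_⟩
          rintro ⟨v, hv, rfl⟩
          apply hmem
          convert hv
          simp
    refine ⟨fun x hx => ?_, fun x hx hx1 => ?_, fun x hx => ?_⟩
    · rcases hval x hx with ⟨a, b⟩ | ⟨a, b⟩ <;> simp [a, b]
    · rcases hval x hx with ⟨a, b⟩ | ⟨a, b⟩ <;> omega
    · rcases hval x hx with ⟨a, b⟩ | ⟨a, b⟩ <;> omega
  have hN1 : m1 2 0 = 2 * n := by rw [hf1 2 (by decide), hN]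
  have hcap1 : m1 vCap = m vCap := hf1 _ (by decide)
  have main := loop_induction (m := m1) (x := vRound) (b := 2) (c := .loop vU 2 (.loop vV 2 visit))
    (fun r m' => Labels (2 * n) r (IsExit X) (residual (2 * n) m) (m' vReach) (m' vPar) ∧
      (Closed (2 * n) (residual (2 * n) m) (m' vReach) ∨
        r ≤ ((Finset.range (2 * n)).filter (m' vReach · ≠ 0)).card)) ?_ ?_
  · rw [hN1] at main
    -- If no certificate of closedness was produced, then `2 * n` nodes have been reached, that is,
    -- all of them.
    refine ⟨main.1, main.2.elim id fun hcard => ?_⟩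
    have : (Finset.range (2 * n)).filter (sem (.loop vRound 2 (.loop vU 2 (.loop vV 2 visit))) m1
        vReach · ≠ 0) = Finset.range (2 * n) :=
      Finset.eq_of_subset_of_card_le (Finset.filter_subset _ _) (by simpa using hcard)
    intro x _ y hy _ _
    exact (Finset.mem_filter.1 (this ▸ Finset.mem_range.2 hy :
      y ∈ (Finset.range (2 * n)).filter _)).2
  · rw [upd_of_ne (by norm_num), upd_of_ne (by norm_num)]
    exact ⟨hL1, .inr (Nat.zero_le _)⟩
  · intro r m2 hr hr2 hfr2 hI
    have hlayer := loop_induction (m := m2) (x := vU) (b := 2) (c := .loop vV 2 visit)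
      (fun u m' => Layer (2 * n) r (IsExit X) (residual (2 * n) m) (m2 vReach) u 0 (m' vReach)
        (m' vPar)) ?_ ?_
    · rw [hfr2 2 (by decide), hN1] at hlayer
      rw [upd_of_ne (by norm_num), upd_of_ne (by norm_num)]
      exact ⟨hlayer.labels, hlayer.finish hI.2⟩
    · rw [upd_of_ne (by norm_num), upd_of_ne (by norm_num)]
      exact Layer.start hI.1
    · intro u m3 hu hu3 hfr3 hI3
      have hinner := loop_induction (m := m3) (x := vV) (b := 2) (c := visit)
        (fun v m' => Layer (2 * n) r (IsExit X) (residual (2 * n) m) (m2 vReach) u v (m' vReach)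
          (m' vPar)) ?_ ?_
      · rw [hfr3 2 (by decide), hfr2 2 (by decide), hN1] at hinner
        rw [upd_of_ne (by norm_num), upd_of_ne (by norm_num)]
        exact hinner.next
      · rw [upd_of_ne (by norm_num), upd_of_ne (by norm_num)]
        exact hI3
      · intro v m4 hv hv4 hfr4 hI4
        have h42 : m4 2 0 = 2 * n := by
          rw [hfr4 2 (by decide), hfr3 2 (by decide), hfr2 2 (by decide), hN1]
        rw [hfr2 2 (by decide), hN1] at hu
        rw [hfr3 2 (by decide), hfr2 2 (by decide), hN1] at hv
        have hcap4 : m4 vCap = m vCap := by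
          rw [hfr4 _ (by decide), hfr3 _ (by decide), hfr2 _ (by decide), hcap1]
        have hr4 : m4 vRound 0 = r := by
          rw [hfr4 _ (by decide), hfr3 _ (by decide), hr2]
        have hu4 : m4 vU 0 = u := by rw [hfr4 _ (by decide), hu3]
        obtain ⟨e1, e2⟩ := visit_sem m4 h42 hu4 hv4 hr4 hu hv
        rw [upd_of_ne (by norm_num), upd_of_ne (by norm_num), e1, e2, hcap4]
        exact hI4.visit hI.1.le hu hv

end Cmd

end RAM

/-! ### Augmenting paths and the program for closest sets -/

namespace RAM

namespace Cmd

/-- Looks for a reached exit outside `Q`. -/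
def findSink : Cmd :=
  .assign vFlag (.lit 0) ;;
  .loop vV 0 (.ite (.get vQ (.var vV)) .skip (.exit vV vExit ;;
    .ite (.get vReach (.var vExit)) (.assign vFlag (.lit 1) ;; .assign vCur (.var vExit)) .skip))

/-- One step back on the path to the current node: the arc is reversed. -/
def stepBack : Cmd :=
  .ite (.lt (.lit 1) (.get vReach (.var vCur)))
    (.assign vPrev (.get vPar (.var vCur)) ;;
      .addr 2 vPrev vCur ;; .set vCap (.var vAddr) (.pred (.get vCap (.var vAddr))) ;;
      .addr 2 vCur vPrev ;; .set vCap (.var vAddr) (.succ (.get vCap (.var vAddr))) ;;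
      .assign vCur (.var vPrev))
    .skip

/-- One round of the computation of a maximum flow. -/
def augment : Cmd :=
  .search ;; .findSink ;; .ite (.var vFlag) (.loop vStep 2 stepBack) .skip

/-- Stores a value in the residual network. -/
def store (x y : ℕ) (e : Expr) : Cmd := .addr 2 x y ;; .set vCap (.var vAddr) e

/-- Writes the four entries of the network for a pair of vertices. -/
def buildPair : Cmd :=
  .exit vV vExitTo ;; .addr 0 vU vV ;; .assign vBit (.get 1 (.var vAddr)) ;;
  store vU vV (.lit 0) ;; store vExit vExitTo (.lit 0) ;; store vU vExitTo (.eq (.var vU) (.var vV)) ;;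
  -- The capacity `n + 1` is out of reach for a cut of value at most `n`.
  .ite (.var vBit) (store vExit vV (.succ (.var 0))) (store vExit vV (.lit 0))

/-- Writes the network for the graph. -/
def buildNetwork : Cmd := .loop vU 0 (.exit vU vExit ;; .loop vV 0 buildPair)

/-- Computes the closest set `A` between `X` and `Q`. -/
def minCut : Cmd :=
  buildNetwork ;; .loop vFlow 2 augment ;; search ;;
  .loop vV 0 (.exit vV vExit ;; .set vA (.var vV) (.not (.not (.get vReach (.var vExit)))))

theorem findSink_sem {n : ℕ} {m : Mem} {Q : Finset (Fin n)} (hn : m 0 0 = n)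
    (hQ : Bits (m vQ) Q) :
    (findSink.sem m vFlag 0 = 0 → ∀ q ∉ Q, m vReach (n + (q : Fin n)) = 0) ∧
    (findSink.sem m vFlag 0 ≠ 0 →
      ∃ q ∉ Q, m vReach (n + (q : Fin n)) ≠ 0 ∧ findSink.sem m vCur 0 = n + (q : Fin n)) := by
  rw [findSink, sem]
  set m1 := (assign vFlag (.lit 0)).sem m with hm1
  have hf1 : ∀ z, z ≠ vFlag → m1 z = m z := fun z hz => sem_frame (by simp [writes, hz]) m
  have main := loop_induction (m := m1) (x := vV) (b := 0)
    (c := .ite (.get vQ (.var vV)) .skip (.exit vV vExit ;;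
      .ite (.get vReach (.var vExit)) (.assign vFlag (.lit 1) ;; .assign vCur (.var vExit)) .skip))
    (fun j m' => (m' vFlag 0 = 0 → ∀ q : Fin n, (q : ℕ) < j → q ∉ Q → m vReach (n + q) = 0) ∧
      (m' vFlag 0 ≠ 0 → ∃ q ∉ Q, m vReach (n + (q : Fin n)) ≠ 0 ∧ m' vCur 0 = n + (q : Fin n)))
    ?_ ?_
  · rw [hf1 0 (by norm_num), hn] at main
    exact ⟨fun h q hq => main.1 h q q.2 hq, main.2⟩
  · simp [hm1, sem, upd_apply, Expr.eval]
  · intro j m' hjn hj hfr ⟨h1, h2⟩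
    have hQ' : m' vQ = m vQ := by rw [hfr _ (by decide), hf1 _ (by norm_num)]
    have h0 : m' 0 = m 0 := by rw [hfr _ (by decide), hf1 _ (by norm_num)]
    have hR : m' vReach = m vReach := by rw [hfr _ (by decide), hf1 _ (by norm_num)]
    rw [hf1 0 (by norm_num), hn] at hjn
    have hbit := hQ.ne_zero ⟨j, hjn⟩
    simp only at hbit
    have hlt : ∀ q : Fin n, (q : ℕ) ≤ j → (q : ℕ) < j ∨ q = ⟨j, hjn⟩ := fun q hq => by
      rw [Fin.ext_iff]; simp only; omega
    rw [upd_of_ne (by norm_num), upd_of_ne (by norm_num), sem]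
    simp only [Expr.eval, hj, hQ']
    by_cases hq : (⟨j, hjn⟩ : Fin n) ∈ Q
    · rw [if_pos (hbit.2 hq), sem]
      refine ⟨fun h q hq' hqQ => ?_, h2⟩
      rcases hlt q (Nat.lt_succ_iff.1 hq') with h' | rfl
      · exact h1 h q h' hqQ
      · exact absurd hq hqQ
    · rw [if_neg (mt hbit.1 hq)]
      by_cases hr : m vReach (n + j) = 0
      · simp [sem, Expr.eval, exit_sem, exit_frame, hj, h0, hn, hR, hr]
        refine ⟨fun h q hq' hqQ => ?_, h2⟩
        rcases hlt q hq' with h' | rfl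
        · exact h1 h q h' hqQ
        · exact hr
      · simp [sem, Expr.eval, exit_sem, exit_frame, hj, h0, hn, hR, hr, upd_apply]
        exact ⟨_, hq, hr, rfl⟩

theorem stepBack_sem {m : Mem} {N v : ℕ} (hN : m 2 0 = N) (hv : m vCur 0 = v) (hvN : v < N) :
    (m vReach v ≤ 1 → stepBack.sem m = m) ∧
    (1 < m vReach v → m vPar v < N → m vPar v ≠ v →
      stepBack.sem m vCur 0 = m vPar v ∧
      ∀ x < N, ∀ y < N,
        residual N (stepBack.sem m) x y = shift (residual N m) (m vPar v) v x y) := by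
  constructor
  · intro h
    rw [stepBack, sem]
    simp only [Expr.eval, hv]
    rw [if_neg (by simpa using h), sem]
  · intro h hp hne
    have hval : ∀ x y, (∀ z ∈ [2, x, y], z ≠ vAddr ∧ z ≠ vI ∧ z ≠ vJ) → ∀ m' : Mem, m' 2 0 = N →
        m' x 0 < N → m' y 0 < N → (addr 2 x y).sem m' vAddr 0 = m' x 0 * N + m' y 0 := by
      intro x y hz m' h2 hx hy
      simp only [List.mem_cons, List.not_mem_nil, or_false, forall_eq_or_imp, forall_eq] at hz
      rw [addr_sem m' hz.1.1 hz.1.2.1 hz.1.2.2 hz.2.1.1 hz.2.1.2.1 hz.2.1.2.2 hz.2.2.1 hz.2.2.2.1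
        hz.2.2.2.2, h2, min_eq_right hx.le, min_eq_right hy.le]
    rw [stepBack, sem]
    simp only [Expr.eval, hv]
    rw [if_pos (by simpa using h)]
    set p := m vPar v with hpdef
    simp only [residual, sem, Expr.eval]
    set m1 := upd m vPrev 0 (m vPar (m vCur 0)) with hm1
    have e1 : ∀ z, z ≠ vPrev → m1 z = m z := fun z hz => upd_of_ne hz
    have p1 : m1 vPrev 0 = p := by rw [hm1, upd_self, Function.update_self, hv]
    set m2 := (addr 2 vPrev vCur).sem m1 with hm2
    have e2 : ∀ z, z ≠ vPrev → z ≠ vAddr → z ≠ vI → z ≠ vJ → m2 z = m z := fun z h h0 h1 h2 => by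
      rw [hm2, addr_frame _ h0 h1 h2, e1 z h]
    have p2 : m2 vPrev 0 = p := by
      rw [hm2, addr_frame _ (by norm_num) (by norm_num) (by norm_num), p1]
    have a2 : m2 vAddr 0 = p * N + v := by
      rw [hm2, hval _ _ (by decide) _ (by rw [e1 _ (by norm_num), hN]) (by rw [p1]; exact hp)
        (by rw [e1 _ (by norm_num), hv]; exact hvN), p1, e1 _ (by norm_num), hv]
    set m3 := upd m2 vCap (m2 vAddr 0) (m2 vCap (m2 vAddr 0) - 1) with hm3
    have e3 : ∀ z, z ≠ vCap → m3 z = m2 z := fun z hz => upd_of_ne hz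
    have c3 : m3 vCap = Function.update (m vCap) (p * N + v) (m vCap (p * N + v) - 1) := by
      rw [hm3, upd_self, a2, e2 vCap (by norm_num) (by norm_num) (by norm_num) (by norm_num)]
    set m4 := (addr 2 vCur vPrev).sem m3 with hm4
    have a4 : m4 vAddr 0 = v * N + p := by
      rw [hm4, hval _ _ (by decide) _
        (by rw [e3 _ (by norm_num), e2 _ (by norm_num) (by norm_num) (by norm_num) (by norm_num), hN])
        (by rw [e3 _ (by norm_num), e2 _ (by norm_num) (by norm_num) (by norm_num) (by norm_num), hv]
            exact hvN)
        (by rw [e3 _ (by norm_num), p2]; exact hp), e3 vPrev (by norm_num), p2,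
        e3 _ (by norm_num), e2 _ (by norm_num) (by norm_num) (by norm_num) (by norm_num), hv]
    have c4 : m4 vCap = m3 vCap := addr_frame _ (by norm_num) (by norm_num) (by norm_num)
    have p4 : m4 vPrev 0 = p := by
      rw [hm4, addr_frame _ (by norm_num) (by norm_num) (by norm_num), e3 _ (by norm_num), p2]
    refine ⟨by simp [upd_apply, p4], fun x hx y hy => ?_⟩
    rw [upd_of_ne (by norm_num), upd_self, a4, c4, c3, update_matrix hy hp, update_matrix hy hvN,
      update_matrix hp hvN]
    simp only [shift, residual, hne.symm, false_and, if_false]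
    split_ifs <;> first | rfl | omega

/-- The path is reversed from its end `t` back to a source. The changes of the cut value telescope,
so only the memberships of `s` and `t` in `U` matter. -/
theorem loop_stepBack_sem {m : Mem} {N t : ℕ} {src : ℕ → Prop} (hN : m 2 0 = N)
    (ht : m vCur 0 = t) (htN : t < N) (hreach : m vReach t ≠ 0)
    (h : Labels N N src (residual N m) (m vReach) (m vPar)) :
    ∃ s < N, src s ∧ ∀ U : Finset ℕ,
      cut N (residual N ((Cmd.loop vStep 2 stepBack).sem m)) U + (if s ∈ U then 1 else 0) =
        cut N (residual N m) U + (if t ∈ U then 1 else 0) := by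
  -- Labels start at no more than `N + 1` and drop with every step until label 1, so `N` rounds lead
  -- to a source. The fourth clause guarantees that the part of the path still ahead keeps positive
  -- capacity.
  have main := loop_induction (m := m) (x := vStep) (b := 2) (c := stepBack)
    (fun j m' => m' vCur 0 < N ∧ m vReach (m' vCur 0) ≠ 0 ∧
      (m vReach (m' vCur 0) ≤ 1 ∨ m vReach (m' vCur 0) + j ≤ N + 1) ∧
      (∀ x < N, 1 < m vReach x → m vReach x ≤ m vReach (m' vCur 0) →
        0 < residual N m' (m vPar x) x) ∧
      ∀ U : Finset ℕ, cut N (residual N m') U + (if m' vCur 0 ∈ U then 1 else 0) =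
        cut N (residual N m) U + (if t ∈ U then 1 else 0)) ?_ ?_
  · rw [hN] at main
    obtain ⟨h1, h2, h3, -, h5⟩ := main
    exact ⟨_, h1, (h.src_iff _ h1).2 (by omega), h5⟩
  · have hres : residual N (upd m vStep 0 0) = residual N m := by
      funext x y
      rw [residual, residual, upd_of_ne (by norm_num)]
    rw [upd_of_ne (by norm_num), hres, ht]
    exact ⟨htN, hreach, .inr (h.le t htN), fun x hx h1 _ => (h.par x hx h1).2.2.2, fun U => rfl⟩
  · intro j m' hj _ hfr ⟨h1, h2, h3, h4, h5⟩
    have hN' : m' 2 0 = N := by rw [hfr 2 (by decide), hN]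
    have hR : m' vReach = m vReach := hfr _ (by decide)
    have hP : m' vPar = m vPar := hfr _ (by decide)
    obtain ⟨s1, s2⟩ := stepBack_sem hN' rfl h1
    have hres : ∀ m'' : Mem, residual N (upd m'' vStep 0 (j + 1)) = residual N m'' := by
      intro m''
      funext x y
      rw [residual, residual, upd_of_ne (by norm_num)]
    rw [hres, upd_of_ne (by norm_num)]
    rw [hR, hP] at s2
    rw [hR] at s1
    by_cases hle : m vReach (m' vCur 0) ≤ 1
    · rw [s1 hle]
      exact ⟨h1, h2, .inl hle, h4, h5⟩
    · set v := m' vCur 0 with hv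
      obtain ⟨a1, a2, a3, a4⟩ := h.par v h1 (by omega)
      have hne : m vPar v ≠ v := by intro e; rw [e] at a3; omega
      obtain ⟨b1, b2⟩ := s2 (by omega) a1 hne
      rw [b1]
      have hpos : 0 < residual N m' (m vPar v) v := h4 v h1 (by omega) le_rfl
      refine ⟨a1, by omega, .inr (by omega), fun x hx hx1 hx2 => ?_, fun U => ?_⟩
      -- The arc that lost a unit ends at `v`, whose label exceeds that of the new current node. The
      -- arcs still needed end at nodes with smaller labels.
      · have hxv : x ≠ v := by rintro rfl; omega
        have hold := h4 x hx hx1 (by omega)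
        rw [b2 _ (h.par x hx hx1).1 x hx, shift, if_neg (fun e => hxv e.2)]
        split_ifs
        · omega
        · exact hold
      · rw [cut_congr b2, cut_shift a1 h1 hne hpos, h5]

end Cmd

end RAM

/-! ### Writing the network into the memory -/

namespace RAM

/-- The input in the memory, and the size of the network. -/
structure HasInput {n : ℕ} (G : SimpleGraph (Fin n)) (a b : Fin n) (k : ℕ) (m : Mem) : Prop where
  n_eq : m 0 0 = n
  a_eq : m 0 1 = a
  b_eq : m 0 2 = b
  k_eq : m 0 3 = k
  adj : ∀ u v : Fin n, m 1 (u * n + v) ≠ 0 ↔ G.Adj u v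
  size : m 2 0 = 2 * n

theorem HasInput.congr {n : ℕ} {G : SimpleGraph (Fin n)} {a b : Fin n} {k : ℕ} {m m' : Mem}
    (h : HasInput G a b k m) (h0 : m' 0 = m 0) (h1 : m' 1 = m 1) (h2 : m' 2 = m 2) :
    HasInput G a b k m' := by
  obtain ⟨e1, e2, e3, e4, e5, e6⟩ := h
  exact ⟨by rw [h0, e1], by rw [h0, e2], by rw [h0, e3], by rw [h0, e4], by rwa [h1],
    by rw [h2, e6]⟩

theorem HasInput.sem {n : ℕ} {G : SimpleGraph (Fin n)} {a b : Fin n} {k : ℕ} {m : Mem}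
    (h : HasInput G a b k m) (c : Cmd) (h0 : 0 ∉ c.writes) (h1 : 1 ∉ c.writes)
    (h2 : 2 ∉ c.writes) : HasInput G a b k (c.sem m) :=
  h.congr (Cmd.sem_frame h0 m) (Cmd.sem_frame h1 m) (Cmd.sem_frame h2 m)

namespace Cmd

theorem sem_ite {e : Expr} {c d : Cmd} {m : Mem} {w : ℕ} (he : e.eval m = w) :
    (ite e c d).sem m = if w ≠ 0 then c.sem m else d.sem m := by
  subst he
  rfl

theorem store_frame {x y z : ℕ} {e : Expr} (m : Mem) (h : z ≠ vCap) (h0 : z ≠ vAddr)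
    (h1 : z ≠ vI) (h2 : z ≠ vJ) : (store x y e).sem m z = m z := by
  rw [store, sem, sem, upd_of_ne h, addr_frame m h0 h1 h2]

theorem store_sem {x y : ℕ} {e : Expr} {m : Mem} {N p q w : ℕ} (hN : m 2 0 = N)
    (hx : ∀ z ∈ [vAddr, vI, vJ], x ≠ z) (hy : ∀ z ∈ [vAddr, vI, vJ], y ≠ z)
    (hp : m x 0 = p) (hq : m y 0 = q) (hpN : p < N) (hqN : q < N)
    (he : e.eval ((addr 2 x y).sem m) = w) (i j : ℕ) (hj : j < N) :
    residual N ((store x y e).sem m) i j = if i = p ∧ j = q then w else residual N m i j := by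
  simp only [List.mem_cons, List.not_mem_nil, or_false, forall_eq_or_imp, forall_eq] at hx hy
  rw [residual, store, sem, sem, he, upd_self, Expr.eval, Expr.eval,
    addr_sem m (by norm_num) (by norm_num) (by norm_num) hx.1 hx.2.1 hx.2.2 hy.1 hy.2.1 hy.2.2,
    hN, hp, hq, min_eq_right hpN.le, min_eq_right hqN.le, update_matrix hj hqN,
    addr_frame m (by norm_num) (by norm_num) (by norm_num), residual]

/-- The entries of the network that belong to a pair of vertices. -/
def PairOK {n : ℕ} (G : SimpleGraph (Fin n)) (m : Mem) (u v : Fin n) : Prop :=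
  residual (2 * n) m u v = 0 ∧ residual (2 * n) m (n + u) (n + v) = 0 ∧
  residual (2 * n) m u (n + v) = (if u = v then 1 else 0) ∧
  (residual (2 * n) m (n + u) v ≠ 0 ↔ G.Adj u v) ∧
  (G.Adj u v → n < residual (2 * n) m (n + u) v)

theorem buildPair_sem {n : ℕ} {G : SimpleGraph (Fin n)} {a b : Fin n} {k : ℕ} {m : Mem}
    (h : HasInput G a b k m) (u v : Fin n) (hu : m vU 0 = u) (hv : m vV 0 = v)
    (hou : m vExit 0 = n + u) :
    PairOK G (buildPair.sem m) u v ∧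
    ∀ u' v' : Fin n, (u', v') ≠ (u, v) → PairOK G m u' v' → PairOK G (buildPair.sem m) u' v' := by
  have hun := u.2
  have hvn := v.2
  rw [buildPair, sem, sem]
  set m1 := (addr 0 vU vV).sem ((exit vV vExitTo).sem m) with hm1
  have e1 : ∀ z, z ≠ vExitTo → z ≠ vI → z ≠ vAddr → z ≠ vJ → m1 z = m z := fun z h0 h1 h2 h3 => by
    rw [hm1, addr_frame _ h2 h1 h3, exit_frame _ h0 h1]
  have a1 : m1 vAddr 0 = u * n + v := by
    rw [hm1, addr_sem _ (by norm_num) (by norm_num) (by norm_num) (by norm_num) (by norm_num)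
      (by norm_num) (by norm_num) (by norm_num) (by norm_num), exit_frame _ (by norm_num) (by norm_num),
      exit_frame _ (by norm_num) (by norm_num), exit_frame _ (by norm_num) (by norm_num), h.n_eq, hu, hv,
      min_eq_right hun.le, min_eq_right hvn.le]
  have o1 : m1 vExitTo 0 = n + v := by
    rw [hm1, addr_frame _ (by norm_num) (by norm_num) (by norm_num),
      exit_sem _ (by norm_num) (by norm_num), h.n_eq, hv]
  rw [sem]
  set m2 := (assign vBit (.get 1 (.var vAddr))).sem m1 with hm2
  have e2 : ∀ z, z ≠ vBit → m2 z = m1 z := fun z h0 => sem_frame (by simp [writes, h0]) m1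
  have b2 : m2 vBit 0 ≠ 0 ↔ G.Adj u v := by
    rw [← h.adj, hm2]
    simp [sem, upd_self, Expr.eval, a1, e1]
  have hbase : ∀ z, z ≠ vExitTo → z ≠ vI → z ≠ vAddr → z ≠ vJ → z ≠ vBit → m2 z = m z :=
    fun z h0 h1 h2 h3 h4 => by rw [e2 z h4, e1 z h0 h1 h2 h3]
  have N2 : m2 2 0 = 2 * n := by
    rw [hbase _ (by norm_num) (by norm_num) (by norm_num) (by norm_num) (by norm_num), h.size]
  have n2 : m2 0 0 = n := by
    rw [hbase _ (by norm_num) (by norm_num) (by norm_num) (by norm_num) (by norm_num), h.n_eq]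
  have u2 : m2 vU 0 = u := by
    rw [hbase _ (by norm_num) (by norm_num) (by norm_num) (by norm_num) (by norm_num), hu]
  have v2 : m2 vV 0 = v := by
    rw [hbase _ (by norm_num) (by norm_num) (by norm_num) (by norm_num) (by norm_num), hv]
  have x2 : m2 vExit 0 = n + u := by
    rw [hbase _ (by norm_num) (by norm_num) (by norm_num) (by norm_num) (by norm_num), hou]
  have y2 : m2 vExitTo 0 = n + v := by rw [e2 _ (by norm_num), o1]
  have r2 : ∀ i j, residual (2 * n) m2 i j = residual (2 * n) m i j := fun i j => by
    rw [residual, hbase _ (by norm_num) (by norm_num) (by norm_num) (by norm_num) (by norm_num),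
      residual]
  rw [sem, sem, sem]
  set m3 := (store vU vV (.lit 0)).sem m2 with hm3
  have e3 : ∀ z, z ≠ vCap → z ≠ vAddr → z ≠ vI → z ≠ vJ → m3 z = m2 z := fun z => store_frame m2
  have r3 : ∀ i j, j < 2 * n → residual (2 * n) m3 i j = if i = u ∧ j = v then 0 else
      residual (2 * n) m2 i j :=
    store_sem N2 (by decide) (by decide) u2 v2 (by omega) (by omega) rfl
  set m4 := (store vExit vExitTo (.lit 0)).sem m3 with hm4
  have e4 : ∀ z, z ≠ vCap → z ≠ vAddr → z ≠ vI → z ≠ vJ → m4 z = m2 z := fun z h0 h1 h2 h3 => by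
    rw [hm4, store_frame _ h0 h1 h2 h3, e3 z h0 h1 h2 h3]
  have r4 : ∀ i j, j < 2 * n → residual (2 * n) m4 i j = if i = n + u ∧ j = n + v then 0 else
      residual (2 * n) m3 i j :=
    store_sem (by rw [e3 _ (by norm_num) (by norm_num) (by norm_num) (by norm_num), N2])
      (by decide) (by decide)
      (by rw [e3 _ (by norm_num) (by norm_num) (by norm_num) (by norm_num), x2])
      (by rw [e3 _ (by norm_num) (by norm_num) (by norm_num) (by norm_num), y2])
      (by omega) (by omega) rfl
  set m5 := (store vU vExitTo (.eq (.var vU) (.var vV))).sem m4 with hm5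
  have e5 : ∀ z, z ≠ vCap → z ≠ vAddr → z ≠ vI → z ≠ vJ → m5 z = m2 z := fun z h0 h1 h2 h3 => by
    rw [hm5, store_frame _ h0 h1 h2 h3, e4 z h0 h1 h2 h3]
  have r5 : ∀ i j, j < 2 * n → residual (2 * n) m5 i j = if i = u ∧ j = n + v then
      (if (u : ℕ) = v then 1 else 0) else residual (2 * n) m4 i j :=
    store_sem (by rw [e4 _ (by norm_num) (by norm_num) (by norm_num) (by norm_num), N2])
      (by decide) (by decide)
      (by rw [e4 _ (by norm_num) (by norm_num) (by norm_num) (by norm_num), u2])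
      (by rw [e4 _ (by norm_num) (by norm_num) (by norm_num) (by norm_num), y2])
      (by omega) (by omega) (by simp [Expr.eval, addr_frame, e4, u2, v2])
  rw [sem_ite (e := .var vBit) (w := m2 vBit 0)
    (by rw [← e5 vBit (by norm_num) (by norm_num) (by norm_num) (by norm_num)]; rfl)]
  set m6 := if m2 vBit 0 ≠ 0 then (store vExit vV (.succ (.var 0))).sem m5
    else (store vExit vV (.lit 0)).sem m5 with hm6
  have r6 : ∀ i j, j < 2 * n → residual (2 * n) m6 i j = if i = n + u ∧ j = v then
      (if m2 vBit 0 ≠ 0 then n + 1 else 0) else residual (2 * n) m5 i j := by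
    have hst := fun e w => store_sem (x := vExit) (y := vV) (e := e) (w := w) (m := m5) (N := 2 * n)
      (p := n + u) (q := v)
      (by rw [e5 _ (by norm_num) (by norm_num) (by norm_num) (by norm_num), N2])
      (by decide) (by decide)
      (by rw [e5 _ (by norm_num) (by norm_num) (by norm_num) (by norm_num), x2])
      (by rw [e5 _ (by norm_num) (by norm_num) (by norm_num) (by norm_num), v2])
      (by omega) (by omega)
    by_cases hbit : m2 vBit 0 ≠ 0
    · rw [hm6, if_pos hbit, if_pos hbit]
      refine hst _ _ ?_
      simp only [Expr.eval]
      rw [addr_frame _ (by norm_num) (by norm_num) (by norm_num),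
          e5 _ (by norm_num) (by norm_num) (by norm_num) (by norm_num), n2]
    · rw [hm6, if_neg hbit, if_neg hbit]
      exact hst _ _ rfl
  -- The four positions lie in different quadrants of the matrix, so the assignments do not
  -- interfere with each other or with the entries of other pairs.
  have hall : ∀ i j, j < 2 * n → residual (2 * n) m6 i j =
      if i = n + u ∧ j = v then (if m2 vBit 0 ≠ 0 then n + 1 else 0) else
      if i = u ∧ j = n + v then (if (u : ℕ) = v then 1 else 0) else
      if i = n + u ∧ j = n + v then 0 else
      if i = u ∧ j = v then 0 else residual (2 * n) m i j := fun i j hj => by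
    rw [r6 i j hj, r5 i j hj, r4 i j hj, r3 i j hj, r2]
  constructor
  · refine ⟨?_, ?_, ?_, ?_, ?_⟩
    · rw [hall _ _ (by omega), if_neg (by omega), if_neg (by omega), if_neg (by omega),
        if_pos ⟨rfl, rfl⟩]
    · rw [hall _ _ (by omega), if_neg (by omega), if_neg (by omega), if_pos ⟨rfl, rfl⟩]
    · rw [hall _ _ (by omega), if_neg (by omega), if_pos ⟨rfl, rfl⟩]
      simp only [Fin.ext_iff]
    · rw [hall _ _ (by omega), if_pos ⟨rfl, rfl⟩, ← b2]
      split_ifs <;> simp_all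
    · intro hadj
      rw [hall _ _ (by omega), if_pos ⟨rfl, rfl⟩, if_pos (b2.2 hadj)]
      omega
  · intro u' v' hne ⟨p1, p2, p3, p4, p5⟩
    have hu' := u'.2
    have hv' := v'.2
    have hne : ¬ ((u' : ℕ) = u ∧ (v' : ℕ) = v) := by
      rintro ⟨h1, h2⟩
      exact hne (by rw [Fin.ext h1, Fin.ext h2])
    refine ⟨?_, ?_, ?_, ?_, ?_⟩
    · rw [hall _ _ (by omega), if_neg (by omega), if_neg (by omega), if_neg (by omega),
        if_neg (by omega), p1]
    · rw [hall _ _ (by omega), if_neg (by omega), if_neg (by omega), if_neg (by omega),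
        if_neg (by omega), p2]
    · rw [hall _ _ (by omega), if_neg (by omega), if_neg (by omega), if_neg (by omega),
        if_neg (by omega), p3]
    · rw [hall _ _ (by omega), if_neg (by omega), if_neg (by omega), if_neg (by omega),
        if_neg (by omega), p4]
    · rw [hall _ _ (by omega), if_neg (by omega), if_neg (by omega), if_neg (by omega),
        if_neg (by omega)]
      exact p5

theorem PairOK.congr {n : ℕ} {G : SimpleGraph (Fin n)} {m m' : Mem} (h : m' vCap = m vCap)
    {u v : Fin n} (hp : PairOK G m u v) : PairOK G m' u v := by
  simpa only [PairOK, residual, h] using hp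

theorem buildNetwork_sem {n : ℕ} {G : SimpleGraph (Fin n)} {a b : Fin n} {k : ℕ} {m : Mem}
    (h : HasInput G a b k m) : G.IsNetwork (residual (2 * n) (buildNetwork.sem m)) := by
  have main := loop_induction (m := m) (x := vU) (b := 0) (c := .exit vU vExit ;; .loop vV 0 buildPair)
    (fun i m' => ∀ u v : Fin n, (u : ℕ) < i → PairOK G m' u v) ?_ ?_
  · rw [h.n_eq] at main
    have main := fun u v : Fin n => main u v u.2
    exact ⟨fun u v => (main u v).1, fun u v => (main u v).2.1, fun u v => (main u v).2.2.1,
      fun u v => (main u v).2.2.2.1, fun u v => (main u v).2.2.2.2⟩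
  · intro u v hu
    omega
  · intro i m1 hi hi1 hfr1 h1
    rw [h.n_eq] at hi
    rw [sem]
    set m2 := (exit vU vExit).sem m1 with hm2
    have hin1 : HasInput G a b k m1 := h.congr (hfr1 0 (by decide)) (hfr1 1 (by decide))
      (hfr1 2 (by decide))
    have hin2 : HasInput G a b k m2 := hin1.sem _ (by decide) (by decide) (by decide)
    have x2 : m2 vExit 0 = n + i := by
      rw [hm2, exit_sem _ (by norm_num) (by norm_num), hin1.n_eq, hi1]
    have i2 : m2 vU 0 = i := by rw [hm2, exit_frame _ (by norm_num) (by norm_num), hi1]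
    have c2 : m2 vCap = m1 vCap := exit_frame _ (by norm_num) (by norm_num)
    have inner := loop_induction (m := m2) (x := vV) (b := 0) (c := buildPair)
      (fun j m' => ∀ u v : Fin n, ((u : ℕ) < i ∨ (u : ℕ) = i ∧ (v : ℕ) < j) → PairOK G m' u v) ?_ ?_
    · rw [hin2.n_eq] at inner
      intro u v hu
      exact (inner u v (by omega)).congr (upd_of_ne (by norm_num))
    · intro u v huv
      exact (h1 u v (by omega)).congr (by rw [upd_of_ne (by norm_num), c2])
    · intro j m3 hj hj3 hfr3 h3
      rw [hin2.n_eq] at hj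
      have hin3 : HasInput G a b k m3 := hin2.congr (hfr3 0 (by decide)) (hfr3 1 (by decide))
        (hfr3 2 (by decide))
      obtain ⟨b1, b2⟩ := buildPair_sem hin3 ⟨i, hi⟩ ⟨j, hj⟩ (by rw [hfr3 _ (by decide), i2]) hj3
        (by rw [hfr3 _ (by decide), x2])
      intro u v huv
      refine PairOK.congr (upd_of_ne (by norm_num)) ?_
      by_cases e : (u, v) = (⟨i, hi⟩, ⟨j, hj⟩)
      · rw [Prod.mk.injEq] at e
        rw [e.1, e.2]
        exact b1
      · refine b2 u v e (h3 u v ?_)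
        simp only [Prod.mk.injEq, Fin.ext_iff] at e
        omega

end Cmd

end RAM

/-! ### Maximum flow and closest sets -/

namespace RAM

namespace Cmd

/-- No exit outside `Q` can be reached from `X` in the residual network. -/
def NoPath {n : ℕ} (X Q : Finset (Fin n)) (c : ℕ → ℕ → ℕ) : Prop :=
  ∃ U : Finset ℕ, (∀ x ∈ X, n + (x : ℕ) ∈ U) ∧ (∀ q ∉ Q, n + (q : ℕ) ∉ U) ∧ cut (2 * n) c U = 0

/-- The set of reached nodes. -/
def reached (N : ℕ) (reach : ℕ → ℕ) : Finset ℕ := (Finset.range N).filter (reach · ≠ 0)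

theorem mem_reached {N x : ℕ} {reach : ℕ → ℕ} : x ∈ reached N reach ↔ x < N ∧ reach x ≠ 0 := by
  simp [reached]

theorem cut_reached {N : ℕ} {c : ℕ → ℕ → ℕ} {reach : ℕ → ℕ} (h : Closed N c reach) :
    cut N c (reached N reach) = 0 := by
  rw [cut_eq_zero]
  intro x hx y hy hxU hyU
  rw [mem_reached] at hxU hyU
  by_contra hc
  exact hyU ⟨hy, h x hx y hy hxU.2 hc⟩

theorem exit_mem_reached {n r : ℕ} {X : Finset (Fin n)} {c : ℕ → ℕ → ℕ} {reach par : ℕ → ℕ}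
    (h : Labels (2 * n) r (IsExit X) c reach par) {x : Fin n} (hx : x ∈ X) :
    n + (x : ℕ) ∈ reached (2 * n) reach := by
  have hxn := x.2
  rw [mem_reached]
  refine ⟨by omega, ?_⟩
  rw [(h.src_iff _ (by omega)).1 ⟨x, hx, rfl⟩]
  exact one_ne_zero

theorem reached_subset {n r : ℕ} {X : Finset (Fin n)} {c : ℕ → ℕ → ℕ} {reach par : ℕ → ℕ}
    (h : Labels (2 * n) r (IsExit X) c reach par) {U : Finset ℕ}
    (hX : ∀ x ∈ X, n + (x : ℕ) ∈ U) (hU : cut (2 * n) c U = 0) : reached (2 * n) reach ⊆ U := by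
  intro x hx
  rw [mem_reached] at hx
  refine h.mem_of_closed ?_ (fun x hx y hy => cut_eq_zero.1 hU x hx y hy) x hx.1 hx.2
  rintro _ _ ⟨v, hv, rfl⟩
  exact hX v hv

/-- If an exit outside `Q` is reached, the reversed path starts inside every admissible cut and ends
outside it, so every admissible cut drops by one. Otherwise the reached set is itself an admissible
cut of value zero. -/
theorem augment_sem {n : ℕ} {m : Mem} {X Q : Finset (Fin n)} (hn : m 0 0 = n)
    (hN : m 2 0 = 2 * n) (hX : Bits (m vX) X) (hQ : Bits (m vQ) Q) :
    (∀ U : Finset ℕ, (∀ x ∈ X, n + (x : ℕ) ∈ U) → (∀ q ∉ Q, n + (q : ℕ) ∉ U) →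
      cut (2 * n) (residual (2 * n) (augment.sem m)) U + 1 = cut (2 * n) (residual (2 * n) m) U) ∨
    residual (2 * n) (augment.sem m) = residual (2 * n) m ∧ NoPath X Q (residual (2 * n) m) := by
  obtain ⟨hlab, hclosed⟩ := search_sem hn hN hX
  rw [augment, sem, sem]
  set m1 := search.sem m with hm1
  have e1 : ∀ z, z ∉ search.writes → m1 z = m z := fun z hz => sem_frame hz m
  obtain ⟨s1, s2⟩ := findSink_sem (m := m1) (Q := Q) (by rw [e1 0 (by decide), hn])
    (by rw [e1 vQ (by decide)]; exact hQ)
  set m2 := findSink.sem m1 with hm2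
  have e2 : ∀ z, z ∉ findSink.writes → m2 z = m1 z := fun z hz => sem_frame hz m1
  have res2 : residual (2 * n) m2 = residual (2 * n) m := by
    funext x y
    rw [residual, e2 vCap (by decide), e1 vCap (by decide), residual]
  rw [sem_ite (e := .var vFlag) (m := m2) (w := m2 vFlag 0) rfl]
  by_cases hf : m2 vFlag 0 = 0
  · right
    rw [if_neg (not_not.2 hf), sem]
    refine ⟨res2, reached (2 * n) (m1 vReach), fun x hx => exit_mem_reached hlab hx,
      fun q hq hmem => (mem_reached.1 hmem).2 (s1 hf q hq), cut_reached hclosed⟩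
  · left
    rw [if_pos hf]
    obtain ⟨q, hqQ, hreach, hcur⟩ := s2 hf
    have hq := q.2
    obtain ⟨s, hs, ⟨v, hv, rfl⟩, hcut⟩ := loop_stepBack_sem (m := m2) (N := 2 * n) (src := IsExit X)
      (by rw [e2 2 (by decide), e1 2 (by decide), hN]) hcur (by omega)
      (by rw [e2 vReach (by decide)]; exact hreach)
      (by rw [res2, e2 vReach (by decide), e2 vPar (by decide)]; exact hlab)
    intro U hXU hQU
    have := hcut U
    rwa [if_pos (hXU v hv), if_neg (hQU q hqQ), res2, add_zero] at this

/-- Instead of a flow, the invariant records the common amount `j` by which all admissible cuts have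
dropped. The nodes reached at the end form the least zero cut, and `IsNetwork.isClosest` applies. -/
theorem minCut_sem {n : ℕ} {G : SimpleGraph (Fin n)} {a b : Fin n} {k : ℕ} {m : Mem}
    {X Q : Finset (Fin n)} (h : HasInput G a b k m) (hX : Bits (m vX) X) (hQ : Bits (m vQ) Q)
    (hXQ : X ⊆ Q) : Bits (minCut.sem m vA) (G.closest X Q) := by
  have hnpos : 0 < n := a.pos
  have hD := buildNetwork_sem h
  rw [minCut, sem, sem, sem]
  set m1 := buildNetwork.sem m with hm1
  set D := residual (2 * n) m1 with hDdef
  have e1 : ∀ z, z ∉ buildNetwork.writes → m1 z = m z := fun z hz => sem_frame hz m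
  have h1 : HasInput G a b k m1 := h.sem _ (by decide) (by decide) (by decide)
  have flow := loop_induction (m := m1) (x := vFlow) (b := 2) (c := augment)
    (fun i m' => ∃ j, (∀ U : Finset ℕ, (∀ x ∈ X, n + (x : ℕ) ∈ U) → (∀ q ∉ Q, n + (q : ℕ) ∉ U) →
      cut (2 * n) (residual (2 * n) m') U + j = cut (2 * n) D U) ∧
      (j = i ∨ NoPath X Q (residual (2 * n) m'))) ?_ ?_
  rotate_left
  · refine ⟨0, fun U _ _ => ?_, .inl rfl⟩
    have : residual (2 * n) (upd m1 vFlow 0 0) = D := by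
      funext x y
      rw [residual, upd_of_ne (by norm_num), hDdef, residual]
    rw [this, add_zero]
  · intro i m' _ _ hfr ⟨j, hj, hj'⟩
    have hres : residual (2 * n) (upd (augment.sem m') vFlow 0 (i + 1)) =
        residual (2 * n) (augment.sem m') := by
      funext x y
      rw [residual, upd_of_ne (by norm_num), residual]
    rw [hres]
    rcases augment_sem (m := m') (X := X) (Q := Q) (by rw [hfr 0 (by decide), h1.n_eq])
      (by rw [hfr 2 (by decide), h1.size])
      (by rw [hfr vX (by decide), e1 vX (by decide)]; exact hX)
      (by rw [hfr vQ (by decide), e1 vQ (by decide)]; exact hQ) with haug | ⟨haug, hno⟩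
    · refine ⟨j + 1, fun U hU1 hU2 => ?_, ?_⟩
      · rw [← hj U hU1 hU2, ← haug U hU1 hU2]
        omega
      -- Once there is an admissible cut of value zero, no further augmentation is possible, since
      -- it would lower that cut.
      · rcases hj' with rfl | ⟨U, hU1, hU2, hU3⟩
        · exact .inl rfl
        · have := haug U hU1 hU2
          omega
    · rw [haug]
      exact ⟨j, hj, .inr hno⟩
  · set m2 := (Cmd.loop vFlow 2 augment).sem m1 with hm2
    have e2 : ∀ z, z ∉ (Cmd.loop vFlow 2 augment).writes → m2 z = m1 z := fun z hz => sem_frame hz m1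
    have h2 : HasInput G a b k m2 := h1.sem _ (by decide) (by decide) (by decide)
    rw [h1.size] at flow
    obtain ⟨j, hj, hj'⟩ := flow
    have hjn := hD.flow_le hXQ hj
    -- Not all `2 * n` rounds can have augmented, as `j ≤ n < 2 * n`.
    obtain ⟨U, hU1, hU2, hU3⟩ := hj'.resolve_left (by omega)
    obtain ⟨hlab, hclosed⟩ := search_sem (m := m2) (X := X) h2.n_eq h2.size
      (by rw [e2 vX (by decide), e1 vX (by decide)]; exact hX)
    set m3 := search.sem m2 with hm3
    have h3 : HasInput G a b k m3 := h2.sem _ (by decide) (by decide) (by decide)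
    have hcl := hD.isClosest hXQ hj (U₀ := reached (2 * n) (m3 vReach))
      (fun x hx => exit_mem_reached hlab hx)
      (fun q hq hmem => hU2 q hq (reached_subset hlab hU1 hU3 hmem))
      (cut_reached hclosed) (fun U hU hU' => reached_subset hlab hU hU')
    rw [(SimpleGraph.isClosest_closest hXQ).unique hcl]
    have final := loop_induction (m := m3) (x := vV) (b := 0)
      (c := .exit vV vExit ;; .set vA (.var vV) (.not (.not (.get vReach (.var vExit)))))
      (fun i m' => ∀ v : Fin n, (v : ℕ) < i →
        m' vA v = if v ∈ SimpleGraph.exits n (reached (2 * n) (m3 vReach)) then 1 else 0) ?_ ?_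
    · rw [h3.n_eq] at final
      exact fun v => final v v.2
    · intro v hv
      omega
    · intro i m' hi hi' hfr hI v hv
      have hv2 := v.2
      rw [h3.n_eq] at hi
      have hn' : m' 0 0 = n := by rw [hfr 0 (by decide), h3.n_eq]
      have hR : m' vReach = m3 vReach := hfr _ (by decide)
      have hval : upd (sem (.exit vV vExit ;; .set vA (.var vV)
          (.not (.not (.get vReach (.var vExit))))) m') vV 0 (i + 1) vA v =
          if (v : ℕ) = i then (if m3 vReach (n + i) = 0 then 0 else 1) else m' vA v := by
        by_cases hr : m3 vReach (n + i) = 0 <;>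
          simp [sem, Expr.eval, upd_apply, exit_sem, exit_frame, hn', hi', hR, Function.update_apply,
            hr]
      rw [hval]
      split_ifs with h4 h5 h6 h7
      · rw [SimpleGraph.mem_exits, mem_reached, h4] at h6
        exact absurd h5 h6.2
      · rfl
      · rfl
      · rw [SimpleGraph.mem_exits, mem_reached, h4] at h7
        exact absurd ⟨by omega, h5⟩ h7
      · rw [hI v (by omega), if_pos (by assumption)]
      · rw [hI v (by omega), if_neg (by assumption)]

end Cmd

end RAM

/-! ## The program: the queue of tasks -/

namespace RAM

notation "vQueueX" => (13 : ℕ)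
notation "vQueueQ" => (14 : ℕ)
notation "vQueueZ" => (15 : ℕ)
notation "vHead" => (16 : ℕ)
notation "vTail" => (17 : ℕ)
notation "vFar" => (18 : ℕ)
notation "vBdry" => (20 : ℕ)
notation "vCard" => (21 : ℕ)
notation "vGood" => (22 : ℕ)
notation "vNew" => (23 : ℕ)
notation "vForced" => (24 : ℕ)
notation "vPushX" => (25 : ℕ)
notation "vPushQ" => (26 : ℕ)
notation "vPushZ" => (27 : ℕ)
notation "vT" => (49 : ℕ)

variable {n : ℕ}

open SimpleGraph (Task)

/-- The task stored at a position of the queue. -/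
structure TaskAt (m : Mem) (p : ℕ) (τ : Task n) : Prop where
  X : Bits (fun v => m vQueueX (p + v)) τ.X
  Q : Bits (fun v => m vQueueQ (p + v)) τ.Q
  Z : Bits (fun v => m vQueueZ (p + v)) τ.Z

/-- The part of the queue that starts at a given position. -/
def Queue (m : Mem) : ℕ → List (Task n) → Prop
  | p, [] => m vTail 0 = p
  | p, τ :: l => TaskAt m p τ ∧ Queue m (p + n) l

theorem TaskAt.congr {m m' : Mem} {p : ℕ} {τ : Task n} (h : TaskAt m p τ)
    (hX : ∀ i < p + n, m' vQueueX i = m vQueueX i) (hQ : ∀ i < p + n, m' vQueueQ i = m vQueueQ i)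
    (hZ : ∀ i < p + n, m' vQueueZ i = m vQueueZ i) : TaskAt m' p τ := by
  refine ⟨fun v => ?_, fun v => ?_, fun v => ?_⟩
  · simpa only [hX (p + v) (by omega)] using h.X v
  · simpa only [hQ (p + v) (by omega)] using h.Q v
  · simpa only [hZ (p + v) (by omega)] using h.Z v

theorem Queue.tail_eq {m : Mem} {p : ℕ} {l : List (Task n)} (h : Queue m p l) :
    m vTail 0 = p + n * l.length := by
  induction l generalizing p with
  | nil => simpa [Queue] using h
  | cons τ l ih =>
    rw [ih h.2, List.length_cons, Nat.mul_add]
    omega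

theorem Queue.push {m m' : Mem} {p : ℕ} {l : List (Task n)} {τ : Task n} (h : Queue m p l)
    (hτ : TaskAt m' (m vTail 0) τ) (hX : ∀ i < m vTail 0, m' vQueueX i = m vQueueX i)
    (hQ : ∀ i < m vTail 0, m' vQueueQ i = m vQueueQ i)
    (hZ : ∀ i < m vTail 0, m' vQueueZ i = m vQueueZ i) (ht : m' vTail 0 = m vTail 0 + n) :
    Queue m' p (l ++ [τ]) := by
  induction l generalizing p with
  | nil =>
    have : m vTail 0 = p := h
    subst this
    exact ⟨hτ, ht⟩
  | cons σ l ih =>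
    have := h.tail_eq
    rw [List.length_cons, Nat.mul_add] at this
    exact ⟨h.1.congr (fun i hi => hX i (by omega)) (fun i hi => hQ i (by omega))
      (fun i hi => hZ i (by omega)), ih h.2⟩

theorem Queue.congr {m m' : Mem} {p : ℕ} {l : List (Task n)} (h : Queue m p l)
    (hX : m' vQueueX = m vQueueX) (hQ : m' vQueueQ = m vQueueQ) (hZ : m' vQueueZ = m vQueueZ)
    (ht : m' vTail = m vTail) : Queue m' p l := by
  induction l generalizing p with
  | nil =>
    rw [Queue, ht]
    exact h
  | cons σ l ih =>
    exact ⟨h.1.congr (fun i _ => by rw [hX]) (fun i _ => by rw [hQ]) (fun i _ => by rw [hZ]), ih h.2⟩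

theorem Queue.sem {m : Mem} {p : ℕ} {l : List (Task n)} (h : Queue m p l) (c : Cmd)
    (hX : vQueueX ∉ c.writes) (hQ : vQueueQ ∉ c.writes) (hZ : vQueueZ ∉ c.writes)
    (ht : vTail ∉ c.writes) : Queue (c.sem m) p l :=
  h.congr (Cmd.sem_frame hX m) (Cmd.sem_frame hQ m) (Cmd.sem_frame hZ m) (Cmd.sem_frame ht m)

/-- The elements of `S` below `j`, in increasing order. -/
def vertsBelow (S : Finset (Fin n)) (j : ℕ) : List (Fin n) :=
  ((List.finRange n).take j).filter (· ∈ S)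

theorem vertsBelow_succ (S : Finset (Fin n)) {j : ℕ} (hj : j < n) :
    vertsBelow S (j + 1) = vertsBelow S j ++ if (⟨j, hj⟩ : Fin n) ∈ S then [⟨j, hj⟩] else [] := by
  rw [vertsBelow, List.take_succ_eq_append_getElem (by simpa using hj), List.filter_append,
    vertsBelow]
  congr 1
  simp only [List.getElem_finRange]
  by_cases h : (⟨j, hj⟩ : Fin n) ∈ S <;> simp [h]

theorem vertsBelow_self (S : Finset (Fin n)) : vertsBelow S n = SimpleGraph.verts S := by
  rw [vertsBelow, List.take_of_length_le (by simp), SimpleGraph.verts]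

namespace Cmd

/-- Takes a task from the queue. -/
def pop : Cmd :=
  .loop vV 0 (.set vX (.var vV) (.get vQueueX (.var vHead)) ;;
    .set vQ (.var vV) (.get vQueueQ (.var vHead)) ;;
    .set vZ (.var vV) (.get vQueueZ (.var vHead)) ;; .incr vHead)

/-- Appends a task to the queue. -/
def push : Cmd :=
  .loop vV 0 (.set vQueueX (.var vTail) (.get vPushX (.var vV)) ;;
    .set vQueueQ (.var vTail) (.get vPushQ (.var vV)) ;;
    .set vQueueZ (.var vTail) (.get vPushZ (.var vV)) ;; .incr vTail)

theorem pop_sem {m : Mem} {τ : Task n} (hn : m 0 0 = n) (h : TaskAt m (m vHead 0) τ) :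
    Bits (pop.sem m vX) τ.X ∧ Bits (pop.sem m vQ) τ.Q ∧ Bits (pop.sem m vZ) τ.Z ∧
      pop.sem m vHead 0 = m vHead 0 + n := by
  have main := loop_induction (m := m) (x := vV) (b := 0)
    (c := .set vX (.var vV) (.get vQueueX (.var vHead)) ;;
      .set vQ (.var vV) (.get vQueueQ (.var vHead)) ;;
      .set vZ (.var vV) (.get vQueueZ (.var vHead)) ;; .incr vHead)
    (fun j m' => m' vHead 0 = m vHead 0 + j ∧ ∀ v < j, m' vX v = m vQueueX (m vHead 0 + v) ∧
      m' vQ v = m vQueueQ (m vHead 0 + v) ∧ m' vZ v = m vQueueZ (m vHead 0 + v)) ?_ ?_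
  · rw [hn] at main
    obtain ⟨h1, h2⟩ := main
    exact ⟨fun v => (h2 v v.2).1.trans (h.X v), fun v => (h2 v v.2).2.1.trans (h.Q v),
      fun v => (h2 v v.2).2.2.trans (h.Z v), h1⟩
  · simp [upd_apply]
  · intro j m' _ hj hfr ⟨h1, h2⟩
    have hqX : m' vQueueX = m vQueueX := hfr _ (by decide)
    have hqQ : m' vQueueQ = m vQueueQ := hfr _ (by decide)
    have hqZ : m' vQueueZ = m vQueueZ := hfr _ (by decide)
    simp only [sem, Expr.eval, upd_apply]
    simp [hj, h1, hqX, hqQ, hqZ]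
    refine ⟨by omega, fun v hv => ?_⟩
    by_cases e : v = j
    · subst e; simp
    · simpa [e] using h2 v (by omega)

theorem push_sem {m : Mem} {τ : Task n} {p : ℕ} {l : List (Task n)} (hn : m 0 0 = n)
    (h : Queue m p l) (hX : Bits (m vPushX) τ.X) (hQ : Bits (m vPushQ) τ.Q)
    (hZ : Bits (m vPushZ) τ.Z) : Queue (push.sem m) p (l ++ [τ]) := by
  have main := loop_induction (m := m) (x := vV) (b := 0)
    (c := .set vQueueX (.var vTail) (.get vPushX (.var vV)) ;;
      .set vQueueQ (.var vTail) (.get vPushQ (.var vV)) ;;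
      .set vQueueZ (.var vTail) (.get vPushZ (.var vV)) ;; .incr vTail)
    (fun j m' => m' vTail 0 = m vTail 0 + j ∧
      (∀ v < j, m' vQueueX (m vTail 0 + v) = m vPushX v ∧ m' vQueueQ (m vTail 0 + v) = m vPushQ v ∧
        m' vQueueZ (m vTail 0 + v) = m vPushZ v) ∧
      ∀ i < m vTail 0, m' vQueueX i = m vQueueX i ∧ m' vQueueQ i = m vQueueQ i ∧
        m' vQueueZ i = m vQueueZ i) ?_ ?_
  · rw [hn] at main
    obtain ⟨h1, h2, h3⟩ := main
    exact h.push ⟨fun v => (h2 v v.2).1.trans (hX v), fun v => (h2 v v.2).2.1.trans (hQ v),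
      fun v => (h2 v v.2).2.2.trans (hZ v)⟩ (fun i hi => (h3 i hi).1) (fun i hi => (h3 i hi).2.1)
      (fun i hi => (h3 i hi).2.2) h1
  · simp [upd_apply]
  · intro j m' _ hj hfr ⟨h1, h2, h3⟩
    have hqX : m' vPushX = m vPushX := hfr _ (by decide)
    have hqQ : m' vPushQ = m vPushQ := hfr _ (by decide)
    have hqZ : m' vPushZ = m vPushZ := hfr _ (by decide)
    simp only [sem, Expr.eval, upd_apply]
    simp [hj, h1, hqX, hqQ, hqZ]
    refine ⟨by omega, fun v hv => ?_, fun i hi => ?_⟩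
    · by_cases e : v = j
      · subst e; simp
      · simpa [e] using h2 v (by omega)
    · have e : i ≠ m vTail 0 + j := by omega
      simpa [e] using h3 i hi

/-! ### Boundary and tests of a task -/

/-- Computes the boundary of `A`. -/
def bdry : Cmd :=
  .loop vV 0 (.set vBdry (.var vV) (.lit 0) ;; .ite (.get vA (.var vV)) .skip
    (.loop vU 0 (.ite (.get vA (.var vU))
      (.addr 0 vU vV ;; .ite (.get 1 (.var vAddr)) (.set vBdry (.var vV) (.lit 1)) .skip) .skip)))

/-- Tests whether `X` is contained in `Q`. -/
def testTask : Cmd :=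
  .assign vGood (.lit 1) ;;
  .loop vV 0 (.ite (.get vX (.var vV)) (.ite (.get vQ (.var vV)) .skip (.assign vGood (.lit 0))) .skip)

/-- Tests whether the boundary contains `Z` and has at most `k` elements. -/
def testBdry : Cmd :=
  .assign vCard (.lit 0) ;;
  .loop vV 0 (.ite (.get vBdry (.var vV)) (.incr vCard)
    (.ite (.get vZ (.var vV)) (.assign vGood (.lit 0)) .skip)) ;;
  .ite (.lt (.get 0 (.lit 3)) (.var vCard)) (.assign vGood (.lit 0)) .skip

/-- Tests whether the current task is good, and computes its closest set and the boundary. -/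
def solve : Cmd := testTask ;; .ite (.var vGood) (minCut ;; bdry ;; testBdry) .skip

variable {G : SimpleGraph (Fin n)} {a b : Fin n} {k : ℕ}

theorem bdry_sem {m : Mem} {A : Finset (Fin n)} (h : HasInput G a b k m) (hA : Bits (m vA) A) :
    Bits (bdry.sem m vBdry) (G.bdry A) := by
  set inner : Cmd := .loop vU 0 (.ite (.get vA (.var vU))
      (.addr 0 vU vV ;; .ite (.get 1 (.var vAddr)) (.set vBdry (.var vV) (.lit 1)) .skip) .skip)
    with hinner
  have main := loop_induction (m := m) (x := vV) (b := 0)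
    (c := .set vBdry (.var vV) (.lit 0) ;; .ite (.get vA (.var vV)) .skip inner)
    (fun j m' => ∀ v : Fin n, (v : ℕ) < j → m' vBdry v = if v ∈ G.bdry A then 1 else 0) ?_ ?_
  · rw [h.n_eq] at main
    exact fun v => main v v.2
  · intro v hv
    omega
  · intro j m1 hj hj1 hfr1 hI
    rw [h.n_eq] at hj
    set m2 := upd m1 vBdry j 0 with hm2
    have e2 : ∀ z, z ≠ vBdry → m2 z = m1 z := fun z hz => upd_of_ne hz
    have b2 : m2 vBdry = Function.update (m1 vBdry) j 0 := by rw [hm2, upd_self]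
    have A2 : m2 vA = m vA := by rw [e2 _ (by decide), hfr1 _ (by decide)]
    have hsem : sem (.set vBdry (.var vV) (.lit 0) ;; .ite (.get vA (.var vV)) .skip inner) m1 =
        sem (.ite (.get vA (.var vV)) .skip inner) m2 := by
      rw [sem, sem]
      simp only [Expr.eval, hj1]
      rfl
    have hAj := hA.ne_zero ⟨j, hj⟩
    simp only at hAj
    rw [hsem, sem_ite (m := m2) (w := m vA j) (by simp only [Expr.eval, A2, e2 vV (by decide), hj1])]
    -- Every branch of the body changes `vBdry` at the index `j` only, so it suffices to determine
    -- this entry.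
    have hlast : ∀ m3 : Mem, (∀ i, i ≠ j → m3 vBdry i = m1 vBdry i) →
        (m3 vBdry j = if (⟨j, hj⟩ : Fin n) ∈ G.bdry A then 1 else 0) →
        ∀ v : Fin n, (v : ℕ) < j + 1 →
          upd m3 vV 0 (j + 1) vBdry v = if v ∈ G.bdry A then 1 else 0 := by
      intro m3 h3 h3' v hv
      rw [upd_of_ne (by decide)]
      by_cases e : (v : ℕ) = j
      · have : v = ⟨j, hj⟩ := Fin.ext e
        subst this
        exact h3'
      · rw [h3 _ e]
        exact hI v (by omega)
    by_cases hj' : (⟨j, hj⟩ : Fin n) ∈ A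
    · rw [if_pos (hAj.2 hj'), sem]
      refine hlast m2 (fun i hi => by rw [b2, Function.update_of_ne hi]) ?_
      rw [b2, Function.update_self, if_neg]
      exact fun hmem => (SimpleGraph.mem_bdry.1 hmem).1 hj'
    · rw [if_neg (mt hAj.1 hj')]
      have hin := loop_induction (m := m2) (x := vU) (b := 0)
        (c := .ite (.get vA (.var vU)) (.addr 0 vU vV ;;
          .ite (.get 1 (.var vAddr)) (.set vBdry (.var vV) (.lit 1)) .skip) .skip)
        (fun i m' => (∀ i, i ≠ j → m' vBdry i = m1 vBdry i) ∧
          ((∃ u : Fin n, (u : ℕ) < i ∧ u ∈ A ∧ G.Adj u ⟨j, hj⟩) ∧ m' vBdry j = 1 ∨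
          (¬ ∃ u : Fin n, (u : ℕ) < i ∧ u ∈ A ∧ G.Adj u ⟨j, hj⟩) ∧ m' vBdry j = 0)) ?_ ?_
      · rw [e2 0 (by decide), hfr1 0 (by decide), h.n_eq] at hin
        refine hlast _ hin.1 ?_
        rcases hin.2 with ⟨⟨u, -, hu, huj⟩, hval⟩ | ⟨hno, hval⟩
        · rw [if_pos (SimpleGraph.mem_bdry.2 ⟨hj', u, hu, huj⟩)]
          exact hval
        · rw [if_neg]
          · exact hval
          · intro hmem
            obtain ⟨-, u, hu, huj⟩ := SimpleGraph.mem_bdry.1 hmem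
            exact hno ⟨u, u.2, hu, huj⟩
      · rw [upd_of_ne (by decide), b2]
        exact ⟨fun i hi => Function.update_of_ne hi _ _, .inr ⟨by rintro ⟨u, hu, -⟩; omega,
          Function.update_self _ _ _⟩⟩
      · intro i m4 hi hi4 hfr4 ⟨h1, h2⟩
        rw [e2 0 (by decide), hfr1 0 (by decide), h.n_eq] at hi
        have hin4 : HasInput G a b k m4 := h.congr
          (by rw [hfr4 0 (by decide), e2 0 (by decide), hfr1 0 (by decide)])
          (by rw [hfr4 1 (by decide), e2 1 (by decide), hfr1 1 (by decide)])
          (by rw [hfr4 2 (by decide), e2 2 (by decide), hfr1 2 (by decide)])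
        have A4 : m4 vA = m vA := by rw [hfr4 _ (by decide), A2]
        have j4 : m4 vV 0 = j := by rw [hfr4 _ (by decide), e2 _ (by decide), hj1]
        have hAi := hA.ne_zero ⟨i, hi⟩
        have hadj := hin4.adj ⟨i, hi⟩ ⟨j, hj⟩
        simp only at hAi hadj
        have haddr : (addr 0 vU vV).sem m4 vAddr 0 = i * n + j := by
          rw [addr_sem m4 (by decide) (by decide) (by decide) (by decide) (by decide) (by decide)
            (by decide) (by decide) (by decide), hin4.n_eq, hi4, j4, min_eq_right hi.le,
            min_eq_right hj.le]
        have hsucc : (∃ u : Fin n, (u : ℕ) < i + 1 ∧ u ∈ A ∧ G.Adj u ⟨j, hj⟩) ↔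
            (∃ u : Fin n, (u : ℕ) < i ∧ u ∈ A ∧ G.Adj u ⟨j, hj⟩) ∨
              (⟨i, hi⟩ : Fin n) ∈ A ∧ G.Adj ⟨i, hi⟩ ⟨j, hj⟩ := by
          constructor
          · rintro ⟨u, hu, hu'⟩
            by_cases e : (u : ℕ) = i
            · have : u = ⟨i, hi⟩ := Fin.ext e
              exact .inr (this ▸ hu')
            · exact .inl ⟨u, by omega, hu'⟩
          · rintro (⟨u, hu, hu'⟩ | hu')
            · exact ⟨u, by omega, hu'⟩
            · exact ⟨_, Nat.lt_succ_self i, hu'⟩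
        rw [hsucc, upd_of_ne (by decide), sem_ite (m := m4) (w := m vA i)
          (by simp only [Expr.eval, A4, hi4])]
        by_cases hiA : (⟨i, hi⟩ : Fin n) ∈ A
        · rw [if_pos (hAi.2 hiA), sem, sem_ite (w := m4 1 (i * n + j))
            (by simp only [Expr.eval, haddr, addr_frame m4 (z := 1) (by decide) (by decide) (by decide)])]
          by_cases hij : G.Adj ⟨i, hi⟩ ⟨j, hj⟩
          · rw [if_pos (hadj.2 hij), sem, upd_self]
            simp only [Expr.eval, addr_frame m4 (z := vBdry) (by decide) (by decide) (by decide),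
              addr_frame m4 (z := vV) (by decide) (by decide) (by decide), j4]
            exact ⟨fun i' hi' => by rw [Function.update_of_ne hi', h1 i' hi'],
              .inl ⟨.inr ⟨hiA, hij⟩, Function.update_self _ _ _⟩⟩
          · rw [if_neg (mt hadj.1 hij), sem, addr_frame m4 (by decide) (by decide) (by decide)]
            simp only [hij, and_false, or_false]
            exact ⟨h1, h2⟩
        · rw [if_neg (mt hAi.1 hiA), sem]
          simp only [hiA, false_and, or_false]
          exact ⟨h1, h2⟩

theorem testTask_sem {m : Mem} {X Q : Finset (Fin n)} (hn : m 0 0 = n) (hX : Bits (m vX) X)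
    (hQ : Bits (m vQ) Q) :
    X ⊆ Q ∧ testTask.sem m vGood 0 = 1 ∨ ¬ X ⊆ Q ∧ testTask.sem m vGood 0 = 0 := by
  rw [testTask, sem]
  set m1 := (assign vGood (.lit 1)).sem m with hm1
  have e1 : ∀ z, z ≠ vGood → m1 z = m z := fun z hz => sem_frame (by simp [writes, hz]) m
  have main := loop_induction (m := m1) (x := vV) (b := 0)
    (c := .ite (.get vX (.var vV)) (.ite (.get vQ (.var vV)) .skip (.assign vGood (.lit 0))) .skip)
    (fun j m' => (∀ v : Fin n, (v : ℕ) < j → v ∈ X → v ∈ Q) ∧ m' vGood 0 = 1 ∨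
      (¬ ∀ v : Fin n, (v : ℕ) < j → v ∈ X → v ∈ Q) ∧ m' vGood 0 = 0) ?_ ?_
  · rw [e1 0 (by decide), hn] at main
    have hiff : (∀ v : Fin n, (v : ℕ) < n → v ∈ X → v ∈ Q) ↔ X ⊆ Q :=
      ⟨fun h v => h v v.2, fun h v _ hv => h hv⟩
    rwa [hiff] at main
  · left
    rw [upd_of_ne (by decide), hm1, sem, upd_self]
    exact ⟨fun v hv => by omega, rfl⟩
  · intro j m' hj hj' hfr hI
    rw [e1 0 (by decide), hn] at hj
    have X' : m' vX = m vX := by rw [hfr _ (by decide), e1 _ (by decide)]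
    have Q' : m' vQ = m vQ := by rw [hfr _ (by decide), e1 _ (by decide)]
    have hXj := hX.ne_zero ⟨j, hj⟩
    have hQj := hQ.ne_zero ⟨j, hj⟩
    simp only at hXj hQj
    have hsucc : (∀ v : Fin n, (v : ℕ) < j + 1 → v ∈ X → v ∈ Q) ↔
        (∀ v : Fin n, (v : ℕ) < j → v ∈ X → v ∈ Q) ∧ ((⟨j, hj⟩ : Fin n) ∈ X → (⟨j, hj⟩ : Fin n) ∈ Q) := by
      constructor
      · exact fun h => ⟨fun v hv => h v (by omega), h _ (Nat.lt_succ_self j)⟩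
      · rintro ⟨h1, h2⟩ v hv
        by_cases e : (v : ℕ) = j
        · have : v = ⟨j, hj⟩ := Fin.ext e
          exact this ▸ h2
        · exact h1 v (by omega)
    rw [hsucc, upd_of_ne (by decide), sem_ite (m := m') (w := m vX j)
      (by simp only [Expr.eval, X', hj'])]
    by_cases hjX : (⟨j, hj⟩ : Fin n) ∈ X
    · rw [if_pos (hXj.2 hjX), sem_ite (m := m') (w := m vQ j) (by simp only [Expr.eval, Q', hj'])]
      by_cases hjQ : (⟨j, hj⟩ : Fin n) ∈ Q
      · rw [if_pos (hQj.2 hjQ), sem]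
        simpa [hjX, hjQ] using hI
      · rw [if_neg (mt hQj.1 hjQ), sem, upd_self]
        right
        exact ⟨fun h => hjQ (h.2 hjX), rfl⟩
    · rw [if_neg (mt hXj.1 hjX), sem]
      simpa [hjX] using hI

end Cmd

end RAM

namespace RAM

theorem length_vertsBelow_self {n : ℕ} (S : Finset (Fin n)) :
    (vertsBelow S n).length = S.card := by
  rw [vertsBelow_self, SimpleGraph.verts_eq_sort, Finset.length_sort]

namespace Cmd

variable {n : ℕ} {G : SimpleGraph (Fin n)} {a b : Fin n} {k : ℕ}

theorem testBdry_sem {m : Mem} {T Z : Finset (Fin n)} (hn : m 0 0 = n) (hk : m 0 3 = k)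
    (hT : Bits (m vBdry) T) (hZ : Bits (m vZ) Z) (hg : m vGood 0 = 1) :
    (Z ⊆ T ∧ T.card ≤ k) ∧ testBdry.sem m vGood 0 = 1 ∨
      ¬ (Z ⊆ T ∧ T.card ≤ k) ∧ testBdry.sem m vGood 0 = 0 := by
  rw [testBdry, sem]
  set m1 := (assign vCard (.lit 0)).sem m with hm1
  have e1 : ∀ z, z ≠ vCard → m1 z = m z := fun z hz => sem_frame (by simp [writes, hz]) m
  rw [sem]
  set body : Cmd := .ite (.get vBdry (.var vV)) (.incr vCard)
    (.ite (.get vZ (.var vV)) (.assign vGood (.lit 0)) .skip) with hbody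
  have main := loop_induction (m := m1) (x := vV) (b := 0) (c := body)
    (fun j m' => m' vCard 0 = (vertsBelow T j).length ∧
      ((∀ v : Fin n, (v : ℕ) < j → v ∈ Z → v ∈ T) ∧ m' vGood 0 = 1 ∨
        (¬ ∀ v : Fin n, (v : ℕ) < j → v ∈ Z → v ∈ T) ∧ m' vGood 0 = 0)) ?_ ?_
  · rw [e1 0 (by decide), hn] at main
    have hiff : (∀ v : Fin n, (v : ℕ) < n → v ∈ Z → v ∈ T) ↔ Z ⊆ T :=
      ⟨fun h v => h v v.2, fun h v _ hv => h hv⟩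
    rw [hiff, length_vertsBelow_self] at main
    set m2 := (Cmd.loop vV 0 body).sem m1 with hm2
    have hk2 : m2 0 3 = k := by
      rw [hm2, sem_frame (by decide), e1 0 (by decide), hk]
    rw [sem_ite (m := m2) (w := if k < T.card then 1 else 0)
      (by simp only [Expr.eval, hk2, main.1])]
    by_cases hc : k < T.card
    · rw [if_pos (by simp [hc]), sem, upd_self]
      right
      exact ⟨fun h => by omega, rfl⟩
    · rw [if_neg (by simp [hc]), sem]
      simpa only [not_lt.1 hc, and_true] using main.2
  · rw [upd_of_ne (by decide), upd_of_ne (by decide), hm1, sem, upd_self, upd_of_ne (by decide)]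
    exact ⟨rfl, .inl ⟨fun v hv => by omega, hg⟩⟩
  · intro j m' hj hj' hfr ⟨h1, h2⟩
    rw [e1 0 (by decide), hn] at hj
    have T' : m' vBdry = m vBdry := by rw [hfr _ (by decide), e1 _ (by decide)]
    have Z' : m' vZ = m vZ := by rw [hfr _ (by decide), e1 _ (by decide)]
    have hTj := hT.ne_zero ⟨j, hj⟩
    have hZj := hZ.ne_zero ⟨j, hj⟩
    simp only at hTj hZj
    have hsucc : (∀ v : Fin n, (v : ℕ) < j + 1 → v ∈ Z → v ∈ T) ↔
        (∀ v : Fin n, (v : ℕ) < j → v ∈ Z → v ∈ T) ∧ ((⟨j, hj⟩ : Fin n) ∈ Z → (⟨j, hj⟩ : Fin n) ∈ T) := by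
      constructor
      · exact fun h => ⟨fun v hv => h v (by omega), h _ (Nat.lt_succ_self j)⟩
      · rintro ⟨h1, h2⟩ v hv
        by_cases e : (v : ℕ) = j
        · have : v = ⟨j, hj⟩ := Fin.ext e
          exact this ▸ h2
        · exact h1 v (by omega)
    rw [hsucc, upd_of_ne (by decide), upd_of_ne (by decide), vertsBelow_succ T hj,
      List.length_append, hbody, sem_ite (m := m') (w := m vBdry j)
      (by simp only [Expr.eval, T', hj'])]
    by_cases hjT : (⟨j, hj⟩ : Fin n) ∈ T
    · rw [if_pos (hTj.2 hjT), if_pos hjT, sem, upd_self, upd_of_ne (by decide)]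
      refine ⟨?_, by simpa only [hjT, implies_true, and_true] using h2⟩
      simp [Expr.eval, h1]
    · rw [if_neg (mt hTj.1 hjT), if_neg hjT, sem_ite (m := m') (w := m vZ j)
        (by simp only [Expr.eval, Z', hj'])]
      by_cases hjZ : (⟨j, hj⟩ : Fin n) ∈ Z
      · rw [if_pos (hZj.2 hjZ), sem, upd_self, upd_of_ne (by decide)]
        exact ⟨by simpa using h1, .inr ⟨fun h => hjT (h.2 hjZ), rfl⟩⟩
      · rw [if_neg (mt hZj.1 hjZ), sem]
        exact ⟨by simpa using h1, by simpa only [hjZ, IsEmpty.forall_iff, and_true] using h2⟩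

theorem solve_sem {m : Mem} {τ : SimpleGraph.Task n} (h : HasInput G a b k m) (hX : Bits (m vX) τ.X)
    (hQ : Bits (m vQ) τ.Q) (hZ : Bits (m vZ) τ.Z) :
    (G.Good k τ ∧ solve.sem m vGood 0 = 1 ∧ Bits (solve.sem m vA) (G.closest τ.X τ.Q) ∧
      Bits (solve.sem m vBdry) (G.bdry (G.closest τ.X τ.Q))) ∨
    (¬ G.Good k τ ∧ solve.sem m vGood 0 = 0) := by
  rw [solve, sem]
  set m1 := testTask.sem m with hm1
  have h1 : HasInput G a b k m1 := h.sem testTask (by decide) (by decide) (by decide)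
  have X1 : Bits (m1 vX) τ.X := by rwa [hm1, sem_frame (by decide)]
  have Q1 : Bits (m1 vQ) τ.Q := by rwa [hm1, sem_frame (by decide)]
  have Z1 : Bits (m1 vZ) τ.Z := by rwa [hm1, sem_frame (by decide)]
  rcases testTask_sem h.n_eq hX hQ with ⟨hXQ, hg⟩ | ⟨hXQ, hg⟩
  · rw [sem_ite (m := m1) (e := .var vGood) hg, if_pos one_ne_zero, sem, sem]
    set m2 := minCut.sem m1 with hm2
    have h2 : HasInput G a b k m2 := h1.sem minCut (by decide) (by decide) (by decide)
    have A2 : Bits (m2 vA) (G.closest τ.X τ.Q) := minCut_sem h1 X1 Q1 hXQ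
    set m3 := bdry.sem m2 with hm3
    have h3 : HasInput G a b k m3 := h2.sem bdry (by decide) (by decide) (by decide)
    have T3 : Bits (m3 vBdry) (G.bdry (G.closest τ.X τ.Q)) := bdry_sem h2 A2
    have Z3 : Bits (m3 vZ) τ.Z := by
      rwa [hm3, sem_frame (by decide), hm2, sem_frame (by decide)]
    have g3 : m3 vGood 0 = 1 := by
      rw [hm3, sem_frame (by decide), hm2, sem_frame (by decide)]
      exact hg
    rcases testBdry_sem h3.n_eq h3.k_eq T3 Z3 g3 with ⟨⟨hZT, hc⟩, hv⟩ | ⟨hno, hv⟩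
    · refine .inl ⟨⟨hXQ, hZT, hc⟩, hv, ?_, ?_⟩
      · rwa [sem_frame (by decide), hm3, sem_frame (by decide)]
      · rwa [sem_frame (by decide)]
    · exact .inr ⟨fun hgood => hno ⟨hgood.forced, hgood.card_le⟩, hv⟩
  · rw [sem_ite (m := m1) (e := .var vGood) hg, if_neg (by simp), sem]
    exact .inr ⟨fun hgood => hXQ hgood.sub, hg⟩

end Cmd

end RAM

/-! ## The program: the trie of the sets that have been found -/

namespace RAM

notation "vZero" => (50 : ℕ)
notation "vOne" => (51 : ℕ)
notation "vCount" => (52 : ℕ)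
notation "vNode" => (53 : ℕ)

/-- The array with the children for a bit. -/
def slot : Bool → ℕ
  | true => vOne
  | false => vZero

/-- The memory holds a trie with the (reversed) words in `P`; `node` gives their nodes. -/
structure TrieAt (m : Mem) (P : Set (List Bool)) (node : List Bool → ℕ) : Prop where
  root : [] ∈ P
  node_nil : node [] = 0
  tail : ∀ β σ, β :: σ ∈ P → σ ∈ P
  le : ∀ σ ∈ P, node σ ≤ m vCount 0
  inj : Set.InjOn node P
  child : ∀ β, ∀ σ ∈ P, β :: σ ∈ P → m (slot β) (node σ) = node (β :: σ)
  no_child : ∀ β, ∀ σ ∈ P, β :: σ ∉ P → m (slot β) (node σ) = 0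
  fresh : ∀ β i, m vCount 0 < i → m (slot β) i = 0

theorem TrieAt.congr {m m' : Mem} {P : Set (List Bool)} {node : List Bool → ℕ}
    (h : TrieAt m P node) (h0 : m' vZero = m vZero) (h1 : m' vOne = m vOne)
    (h2 : m' vCount = m vCount) : TrieAt m' P node := by
  have hs : ∀ β, m' (slot β) = m (slot β) := by
    intro β
    cases β
    · exact h0
    · exact h1
  exact ⟨h.root, h.node_nil, h.tail, by rw [h2]; exact h.le, h.inj,
    fun β => by rw [hs]; exact h.child β, fun β => by rw [hs]; exact h.no_child β,
    fun β => by rw [hs, h2]; exact h.fresh β⟩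

/-- The reversed word of the first `j` bits of a set. -/
def pre {n : ℕ} (A : Finset (Fin n)) : ℕ → List Bool
  | 0 => []
  | j + 1 => decide (j ∈ A.image Fin.val) :: pre A j

theorem length_pre {n : ℕ} (A : Finset (Fin n)) (j : ℕ) : (pre A j).length = j := by
  induction j with
  | zero => rfl
  | succ j ih => rw [pre, List.length_cons, ih]

theorem pre_succ {n : ℕ} (A : Finset (Fin n)) {j : ℕ} (hj : j < n) :
    pre A (j + 1) = decide ((⟨j, hj⟩ : Fin n) ∈ A) :: pre A j := by
  rw [pre]
  congr 2
  simp only [Finset.mem_image, eq_iff_iff]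
  exact ⟨fun ⟨v, hv, e⟩ => by rwa [show (⟨j, hj⟩ : Fin n) = v from Fin.ext e.symm],
    fun h => ⟨_, h, rfl⟩⟩

theorem eq_of_pre_eq {n : ℕ} {A B : Finset (Fin n)} (h : pre A n = pre B n) : A = B := by
  have key : ∀ j ≤ n, pre A j = pre B j → ∀ v : Fin n, (v : ℕ) < j → (v ∈ A ↔ v ∈ B) := by
    intro j
    induction j with
    | zero => exact fun _ _ v hv => by omega
    | succ j ih =>
      intro hj hpre v hv
      rw [pre_succ A hj, pre_succ B hj, List.cons.injEq, decide_eq_decide] at hpre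
      by_cases e : (v : ℕ) = j
      · rw [show v = ⟨j, hj⟩ from Fin.ext e]
        exact hpre.1
      · exact ih (by omega) hpre.2 v (by omega)
  ext v
  exact key n le_rfl h v v.2

/-- The words of a trie that holds the sets in a list. -/
def prefixes {n : ℕ} (L : List (Finset (Fin n))) : Set (List Bool) :=
  {σ | σ = [] ∨ ∃ A ∈ L, ∃ j ≤ n, σ = pre A j}

theorem prefixes_append_singleton {n : ℕ} (L : List (Finset (Fin n))) (A : Finset (Fin n)) :
    prefixes (L ++ [A]) = prefixes L ∪ {σ | ∃ j ≤ n, σ = pre A j} := by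
  ext σ
  simp only [prefixes, List.mem_append, List.mem_singleton, Set.mem_ofPred_eq, Set.mem_union]
  constructor
  · rintro (h | ⟨B, hB | rfl, h⟩)
    · exact .inl (.inl h)
    · exact .inl (.inr ⟨B, hB, h⟩)
    · exact .inr h
  · rintro ((h | ⟨B, hB, h⟩) | h)
    · exact .inl h
    · exact .inr ⟨B, .inl hB, h⟩
    · exact .inr ⟨A, .inr rfl, h⟩

/-- A word of full length can only be the full word of another set, so membership in the trie is
membership in the list. For `n = 0` the only word is empty and always present. -/
theorem pre_mem_prefixes_iff {n : ℕ} (hn : n ≠ 0) {L : List (Finset (Fin n))}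
    {A : Finset (Fin n)} : pre A n ∈ prefixes L ↔ A ∈ L := by
  constructor
  · rintro (h | ⟨B, hB, j, hj, h⟩)
    · exact absurd (congrArg List.length h) (by simpa [length_pre] using hn)
    · have := congrArg List.length h
      rw [length_pre, length_pre] at this
      subst this
      rwa [eq_of_pre_eq h]
  · exact fun h => .inr ⟨A, h, n, le_rfl, rfl⟩

/-- The memory holds a trie with the sets in a list. -/
def Trie {n : ℕ} (m : Mem) (L : List (Finset (Fin n))) : Prop := ∃ node, TrieAt m (prefixes L) node

theorem Trie.congr {n : ℕ} {m m' : Mem} {L : List (Finset (Fin n))} (h : Trie m L)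
    (h0 : m' vZero = m vZero) (h1 : m' vOne = m vOne) (h2 : m' vCount = m vCount) : Trie m' L :=
  let ⟨node, h⟩ := h
  ⟨node, h.congr h0 h1 h2⟩

theorem Trie.sem {n : ℕ} {m : Mem} {L : List (Finset (Fin n))} (h : Trie m L) (c : Cmd)
    (h0 : vZero ∉ c.writes) (h1 : vOne ∉ c.writes) (h2 : vCount ∉ c.writes) : Trie (c.sem m) L :=
  h.congr (Cmd.sem_frame h0 m) (Cmd.sem_frame h1 m) (Cmd.sem_frame h2 m)

theorem trie_nil {n : ℕ} {m : Mem} (h0 : ∀ i, m vZero i = 0) (h1 : ∀ i, m vOne i = 0) :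
    Trie m ([] : List (Finset (Fin n))) := by
  have hs : ∀ β i, m (slot β) i = 0 := by
    intro β
    cases β
    · exact h0
    · exact h1
  have hP : ∀ σ, σ ∈ prefixes ([] : List (Finset (Fin n))) ↔ σ = [] := by simp [prefixes]
  refine ⟨fun _ => 0, (hP _).2 rfl, rfl, ?_, ?_, ?_, ?_, ?_, ?_⟩
  · intro β σ h
    exact absurd ((hP _).1 h) (List.cons_ne_nil _ _)
  · exact fun _ _ => Nat.zero_le _
  · intro σ hσ ρ hρ _
    rw [(hP _).1 hσ, (hP _).1 hρ]
  · exact fun β σ _ _ => hs _ _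
  · exact fun β σ _ _ => hs _ _
  · exact fun β i _ => hs _ _

namespace Cmd

/-- Moves from a node of the trie to a child, which is created if necessary. -/
def descend (x : ℕ) : Cmd :=
  .ite (.get x (.var vNode)) .skip
    (.incr vCount ;; .set x (.var vNode) (.var vCount) ;; .assign vNew (.lit 1)) ;;
  .assign vNode (.get x (.var vNode))

/-- Inserts `A` into the trie. -/
def insertSet : Cmd :=
  .assign vNode (.lit 0) ;; .assign vNew (.lit 0) ;;
  .loop vV 0 (.ite (.get vA (.var vV)) (descend vOne) (descend vZero))

theorem descend_sem {m : Mem} {P : Set (List Bool)} {node : List Bool → ℕ} (h : TrieAt m P node)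
    {β : Bool} {σ : List Bool} (hσ : σ ∈ P) (hm : m vNode 0 = node σ) :
    ∃ node', TrieAt ((descend (slot β)).sem m) (insert (β :: σ) P) node' ∧
      (descend (slot β)).sem m vNode 0 = node' (β :: σ) ∧
      ((descend (slot β)).sem m vNew 0 ≠ 0 ↔ m vNew 0 ≠ 0 ∨ β :: σ ∉ P) := by
  have hslot : ∀ γ, slot γ ≠ vNode ∧ slot γ ≠ vCount ∧ slot γ ≠ vNew := by
    intro γ
    cases γ <;> decide
  obtain ⟨s1, s2, s3⟩ := hslot β
  have hslots : ∀ γ, slot γ = slot β ↔ γ = β := by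
    intro γ
    cases γ <;> cases β <;> decide
  rw [descend, sem, sem_ite (m := m) (w := m (slot β) (node σ)) (by simp only [Expr.eval, hm])]
  by_cases hβ : β :: σ ∈ P
  · have hne : m (slot β) (node σ) ≠ 0 := by
      rw [h.child β σ hσ hβ, ← h.node_nil]
      exact fun e => List.cons_ne_nil _ _ (h.inj hβ h.root e)
    rw [if_pos hne, sem, sem]
    refine ⟨node, ?_, ?_, ?_⟩
    · rw [Set.insert_eq_of_mem hβ]
      exact h.congr (upd_of_ne (by decide)) (upd_of_ne (by decide)) (upd_of_ne (by decide))
    · rw [upd_self]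
      simp only [Expr.eval, Function.update_self, hm]
      exact h.child β σ hσ hβ
    · rw [upd_of_ne (by decide)]
      simp [hβ]
  · rw [if_neg (not_not.2 (h.no_child β σ hσ hβ))]
    set m' := sem (.incr vCount ;; .set (slot β) (.var vNode) (.var vCount) ;;
      .assign vNew (.lit 1)) m with hm'
    set c := m vCount 0 with hc
    have c' : m' vCount 0 = c + 1 := by
      simp only [hm', sem]
      rw [upd_of_ne (by decide), upd_of_ne s2.symm, upd_self]
      simp [Expr.eval, hc]
    have n' : m' vNode = m vNode := by
      simp only [hm', sem]
      rw [upd_of_ne (by decide), upd_of_ne s1.symm, upd_of_ne (by decide)]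
    have f' : m' vNew 0 = 1 := by
      simp only [hm', sem]
      rw [upd_self]
      simp [Expr.eval]
    have b' : m' (slot β) = Function.update (m (slot β)) (node σ) (c + 1) := by
      simp only [hm', sem]
      rw [upd_of_ne s3, upd_self, upd_of_ne s2]
      simp only [Expr.eval]
      rw [upd_of_ne (by decide), upd_self, hm]
      simp [hc]
    have o' : ∀ γ, γ ≠ β → m' (slot γ) = m (slot γ) := by
      intro γ hγ
      simp only [hm', sem]
      rw [upd_of_ne (hslot γ).2.2, upd_of_ne (mt (hslots γ).1 hγ), upd_of_ne (hslot γ).2.1]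
    -- The new node takes the next unused number, and by `fresh` its two child pointers are still
    -- zero.
    set node' := Function.update node (β :: σ) (c + 1) with hnode'
    have hnew : node' (β :: σ) = c + 1 := Function.update_self _ _ _
    have hold : ∀ ρ ∈ P, node' ρ = node ρ := fun ρ hρ =>
      Function.update_of_ne (fun e => hβ (by rwa [← e])) _ _
    -- The new node is a leaf, because `P` is closed under removing the last bit read.
    have hno : ∀ γ, γ :: β :: σ ∉ insert (β :: σ) P := by
      rintro γ (e | e)
      · simpa using congrArg List.length e
      · exact hβ (h.tail γ _ e)
    have hfr : ∀ γ i, c + 1 ≤ i → m' (slot γ) i = 0 := by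
      intro γ i hi
      by_cases e : γ = β
      · rw [e, b', Function.update_of_ne, h.fresh β i (by omega)]
        have := h.le σ hσ
        omega
      · rw [o' γ e, h.fresh γ i (by omega)]
    have hsame : ∀ γ, ∀ ρ ∈ P, γ :: ρ ≠ β :: σ → m' (slot γ) (node ρ) = m (slot γ) (node ρ) := by
      intro γ ρ hρ hne
      by_cases e : γ = β
      · subst e
        rw [b', Function.update_of_ne]
        exact fun e => hne (by rw [h.inj hρ hσ e])
      · rw [o' γ e]
    have htrie : TrieAt m' (insert (β :: σ) P) node' := by
      refine ⟨.inr h.root, ?_, ?_, ?_, ?_, ?_, ?_, ?_⟩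
      · rw [hold _ h.root, h.node_nil]
      · rintro γ ρ (e | e)
        · rw [List.cons.injEq] at e
          exact .inr (e.2 ▸ hσ)
        · exact .inr (h.tail γ ρ e)
      · rintro ρ (rfl | hρ)
        · rw [hnew, c']
        · rw [hold ρ hρ, c']
          have := h.le ρ hρ
          omega
      · rintro ρ (rfl | hρ) τ (rfl | hτ) e
        · rfl
        · rw [hnew, hold τ hτ] at e
          have := h.le τ hτ
          omega
        · rw [hnew, hold ρ hρ] at e
          have := h.le ρ hρ
          omega
        · rw [hold ρ hρ, hold τ hτ] at e
          exact h.inj hρ hτ e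
      · rintro γ ρ (rfl | hρ) hγ
        · exact absurd hγ (hno γ)
        · rw [hold ρ hρ]
          by_cases e : γ :: ρ = β :: σ
          · rw [e, hnew]
            rw [List.cons.injEq] at e
            rw [e.1, e.2, b', Function.update_self]
          · rw [hsame γ ρ hρ e, hold _ (hγ.resolve_left e)]
            exact h.child γ ρ hρ (hγ.resolve_left e)
      · rintro γ ρ (rfl | hρ) hγ
        · rw [hnew]
          exact hfr γ _ le_rfl
        · rw [hold ρ hρ, hsame γ ρ hρ (fun e => hγ (.inl e))]
          exact h.no_child γ ρ hρ (fun e => hγ (.inr e))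
      · intro γ i hi
        rw [c'] at hi
        exact hfr γ i (by omega)
    refine ⟨node', ?_, ?_, ?_⟩
    · rw [sem]
      exact htrie.congr (upd_of_ne (by decide)) (upd_of_ne (by decide)) (upd_of_ne (by decide))
    · rw [sem, upd_self]
      simp only [Expr.eval, Function.update_self, n', hm, b', hnew]
    · rw [sem, upd_of_ne (by decide), f']
      simp [hβ]

/-- The flag `vNew` records whether a node had to be created on the way down. A new set needs one,
since its full word is missing; a known set needs none. -/
theorem insertSet_sem {n : ℕ} {m : Mem} {A : Finset (Fin n)} {L : List (Finset (Fin n))}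
    (hn : m 0 0 = n) (hn0 : n ≠ 0) (hA : Bits (m vA) A) (h : Trie m L) :
    (A ∉ L ∧ insertSet.sem m vNew 0 ≠ 0 ∨ A ∈ L ∧ insertSet.sem m vNew 0 = 0) ∧
      Trie (insertSet.sem m) (if A ∈ L then L else L ++ [A]) := by
  obtain ⟨node, h⟩ := h
  rw [insertSet, sem, sem]
  set m1 := sem (.assign vNew (.lit 0)) (sem (.assign vNode (.lit 0)) m) with hm1
  have e1 : ∀ z, z ≠ vNew → z ≠ vNode → m1 z = m z := fun z h0 h1 => by
    rw [hm1, sem_frame (by simp [writes, h0]), sem_frame (by simp [writes, h1])]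
  have main := loop_induction (m := m1) (x := vV) (b := 0)
    (c := .ite (.get vA (.var vV)) (descend vOne) (descend vZero))
    (fun j m' => ∃ node, TrieAt m' (prefixes L ∪ {σ | ∃ i ≤ j, σ = pre A i}) node ∧
      m' vNode 0 = node (pre A j) ∧ (m' vNew 0 ≠ 0 ↔ ∃ i ≤ j, pre A i ∉ prefixes L)) ?_ ?_
  · rw [e1 0 (by decide) (by decide), hn, ← prefixes_append_singleton] at main
    obtain ⟨node', htrie, -, hnew⟩ := main
    by_cases hAL : A ∈ L
    · have hsub : prefixes (L ++ [A]) = prefixes L := by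
        rw [prefixes_append_singleton, Set.union_eq_left]
        exact fun σ ⟨i, hi, e⟩ => .inr ⟨A, hAL, i, hi, e⟩
      rw [hsub] at htrie
      rw [if_pos hAL]
      refine ⟨.inr ⟨hAL, not_not.1 fun hne => ?_⟩, node', htrie⟩
      obtain ⟨i, hi, hno⟩ := hnew.1 hne
      exact hno (.inr ⟨A, hAL, i, hi, rfl⟩)
    · rw [if_neg hAL]
      exact ⟨.inl ⟨hAL, hnew.2 ⟨n, le_rfl, fun hmem => hAL ((pre_mem_prefixes_iff hn0).1 hmem)⟩⟩,
        node', htrie⟩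
  · refine ⟨node, ?_, ?_, ?_⟩
    · have : prefixes L ∪ {σ | ∃ i ≤ 0, σ = pre A i} = prefixes L := by
        rw [Set.union_eq_left]
        rintro σ ⟨i, hi, rfl⟩
        obtain rfl : i = 0 := by omega
        exact h.root
      rw [this]
      exact h.congr (by rw [upd_of_ne (by decide), e1 _ (by decide) (by decide)])
        (by rw [upd_of_ne (by decide), e1 _ (by decide) (by decide)])
        (by rw [upd_of_ne (by decide), e1 _ (by decide) (by decide)])
    · rw [upd_of_ne (by decide), hm1, sem_frame (by decide), sem, upd_self, pre, h.node_nil]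
      rfl
    · rw [upd_of_ne (by decide), hm1, sem, upd_self]
      simp only [Expr.eval, Function.update_self]
      refine ⟨fun h => absurd rfl h, ?_⟩
      rintro ⟨i, hi, hno⟩
      obtain rfl : i = 0 := by omega
      exact absurd h.root hno
  · intro j m' hj hj' hfr ⟨node', htrie, hnode, hnew⟩
    rw [e1 0 (by decide) (by decide), hn] at hj
    have A' : m' vA = m vA := by rw [hfr _ (by decide), e1 _ (by decide) (by decide)]
    have hAj := hA.ne_zero ⟨j, hj⟩
    simp only at hAj
    have hsem : sem (.ite (.get vA (.var vV)) (descend vOne) (descend vZero)) m' =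
        (descend (slot (decide ((⟨j, hj⟩ : Fin n) ∈ A)))).sem m' := by
      rw [sem_ite (m := m') (w := m vA j) (by simp only [Expr.eval, A', hj'])]
      by_cases hjA : (⟨j, hj⟩ : Fin n) ∈ A
      · rw [if_pos (hAj.2 hjA), decide_eq_true hjA]
        rfl
      · rw [if_neg (mt hAj.1 hjA), decide_eq_false hjA]
        rfl
    obtain ⟨node'', h1, h2, h3⟩ := descend_sem htrie (β := decide ((⟨j, hj⟩ : Fin n) ∈ A))
      (.inr ⟨j, le_rfl, rfl⟩) hnode
    rw [← hsem, ← pre_succ A hj] at h1 h2 h3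
    have hP : insert (pre A (j + 1)) (prefixes L ∪ {σ | ∃ i ≤ j, σ = pre A i}) =
        prefixes L ∪ {σ | ∃ i ≤ j + 1, σ = pre A i} := by
      ext σ
      simp only [Set.mem_insert_iff, Set.mem_union, Set.mem_ofPred_eq, Nat.le_succ_iff]
      grind
    rw [hP] at h1
    refine ⟨node'', h1.congr (upd_of_ne (by decide)) (upd_of_ne (by decide))
      (upd_of_ne (by decide)), by rw [upd_of_ne (by decide), h2], ?_⟩
    rw [upd_of_ne (by decide), h3, hnew]
    have hnot : (∃ i ≤ j, pre A (j + 1) = pre A i) ↔ False := by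
      refine ⟨fun ⟨i, hi, e⟩ => ?_, False.elim⟩
      have := congrArg List.length e
      rw [length_pre, length_pre] at this
      omega
    simp only [Set.mem_union, Set.mem_ofPred_eq, hnot, or_false, Nat.le_succ_iff]
    grind

end Cmd

end RAM

/-! ## The program: the creation of tasks -/

namespace RAM

theorem Expr.eval_not {e : Expr} {m : Mem} {P : Prop} (he : e.eval m ≠ 0 ↔ P) :
    (Expr.not e).eval m ≠ 0 ↔ ¬ P := by
  rw [← he]
  by_cases h : e.eval m = 0 <;> simp [Expr.eval, h]

theorem Expr.eval_and {e f : Expr} {m : Mem} {P Q R : Prop} [Decidable R] (hR : R ↔ P ∧ Q)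
    (he : e.eval m ≠ 0 ↔ P) (hf : f.eval m ≠ 0 ↔ Q) :
    (Expr.and e f).eval m = if R then 1 else 0 := by
  simp only [hR, ← he, ← hf, Expr.eval]
  by_cases h : e.eval m = 0 <;> by_cases h' : f.eval m = 0 <;> simp [h, h']

theorem Expr.eval_or {e f : Expr} {m : Mem} {P Q R : Prop} [Decidable R] (hR : R ↔ P ∨ Q)
    (he : e.eval m ≠ 0 ↔ P) (hf : f.eval m ≠ 0 ↔ Q) :
    (Expr.or e f).eval m = if R then 1 else 0 := by
  simp only [hR, ← he, ← hf, Expr.eval]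
  by_cases h : e.eval m = 0 <;> by_cases h' : f.eval m = 0 <;> simp [h, h']

theorem Bits.loop_step {n : ℕ} {f g : ℕ → ℕ} {S : Finset (Fin n)} {j : ℕ} {w : ℕ}
    (hf : ∀ v : Fin n, (v : ℕ) < j → f v = if v ∈ S then 1 else 0)
    (hg : g = Function.update f j w) (hw : ∀ hj : j < n, w = if (⟨j, hj⟩ : Fin n) ∈ S then 1 else 0)
    (v : Fin n) (hv : (v : ℕ) < j + 1) : g v = if v ∈ S then 1 else 0 := by
  rw [hg]
  by_cases e : (v : ℕ) = j
  · subst e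
    rw [Function.update_self]
    exact hw v.2
  · rw [Function.update_of_ne e]
    exact hf v (by omega)

namespace Cmd

/-- Prepares a task that is to be added to the queue. -/
def prepare (eX eQ eZ : Expr) : Cmd :=
  .loop vV 0 (.addr 0 vT vV ;; .set vPushX (.var vV) eX ;; .set vPushQ (.var vV) eQ ;;
    .set vPushZ (.var vV) eZ)

/-- Adds the tasks that look for the sets containing `A` and a vertex of its boundary. -/
def pushRoots : Cmd :=
  .loop vT 0 (.ite (.get vBdry (.var vT))
    (prepare (.or (.get vA (.var vV)) (.eq (.var vV) (.var vT))) (.get vFar (.var vV)) (.lit 0) ;;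
      push)
    .skip)

/-- Adds the subtasks of the current task. -/
def pushChildren : Cmd :=
  .loop vV 0 (.set vForced (.var vV) (.get vZ (.var vV))) ;;
  .loop vT 0 (.ite (.get vBdry (.var vT))
    (.ite (.get vZ (.var vT)) .skip
      (prepare (.get vX (.var vV)) (.and (.get vA (.var vV)) (.not (.get 1 (.var vAddr))))
        (.get vForced (.var vV)) ;; push) ;;
      .set vForced (.var vT) (.lit 1))
    .skip)

/-- Computes the vertices that are far from `b`, and adds the first task to the queue. -/
def setup : Cmd :=
  .assign vT (.get 0 (.lit 2)) ;;
  .loop vV 0 (.addr 0 vT vV ;; .set vFar (.var vV)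
    (.and (.not (.eq (.var vV) (.var vT))) (.not (.get 1 (.var vAddr))))) ;;
  prepare (.eq (.var vV) (.get 0 (.lit 1))) (.get vFar (.var vV)) (.lit 0) ;; push

variable {n : ℕ} {G : SimpleGraph (Fin n)} {a b : Fin n} {k : ℕ}

/-- The three expressions are evaluated in the middle of the loop. Hence `he` speaks about every
memory that agrees with `m` outside the scratch arrays and has the counter and the matrix address in
place. -/
theorem prepare_sem {m : Mem} {X Q Z : Finset (Fin n)} {eX eQ eZ : Expr} {t : Fin n}
    (hn : m 0 0 = n) (ht : m vT 0 = t)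
    (he : ∀ (v : Fin n) (m' : Mem), m' vV 0 = v → m' vAddr 0 = t * n + v →
      (∀ z, z ∉ [vV, vAddr, vI, vJ, vPushX, vPushQ, vPushZ] → m' z = m z) →
      (eX.eval m' = if v ∈ X then 1 else 0) ∧ (eQ.eval m' = if v ∈ Q then 1 else 0) ∧
        (eZ.eval m' = if v ∈ Z then 1 else 0)) :
    Bits ((prepare eX eQ eZ).sem m vPushX) X ∧ Bits ((prepare eX eQ eZ).sem m vPushQ) Q ∧
      Bits ((prepare eX eQ eZ).sem m vPushZ) Z := by
  have main := loop_induction (m := m) (x := vV) (b := 0)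
    (c := .addr 0 vT vV ;; .set vPushX (.var vV) eX ;; .set vPushQ (.var vV) eQ ;;
      .set vPushZ (.var vV) eZ)
    (fun j m' => (∀ v : Fin n, (v : ℕ) < j → m' vPushX v = if v ∈ X then 1 else 0) ∧
      (∀ v : Fin n, (v : ℕ) < j → m' vPushQ v = if v ∈ Q then 1 else 0) ∧
      (∀ v : Fin n, (v : ℕ) < j → m' vPushZ v = if v ∈ Z then 1 else 0)) ?_ ?_
  · rw [hn] at main
    exact ⟨fun v => main.1 v v.2, fun v => main.2.1 v v.2, fun v => main.2.2 v v.2⟩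
  · refine ⟨?_, ?_, ?_⟩ <;> intro v hv <;> omega
  · intro j m1 hj hj1 hfr1 ⟨hI1, hI2, hI3⟩
    rw [hn] at hj
    have hw : ∀ z, z ∉ [vV, vAddr, vI, vJ, vPushX, vPushQ, vPushZ] → m1 z = m z := fun z hz =>
      hfr1 z (by
        simp only [List.mem_cons, List.not_mem_nil, or_false, not_or] at hz
        simp [writes, addr, hz])
    have ht1 : m1 vT 0 = t := by rw [hw vT (by decide), ht]
    have hn1 : m1 0 0 = n := by rw [hw 0 (by decide), hn]
    rw [sem]
    set m2 := (addr 0 vT vV).sem m1 with hm2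
    have e2 : ∀ z, z ≠ vAddr → z ≠ vI → z ≠ vJ → m2 z = m1 z := fun z h0 h1 h2 =>
      addr_frame m1 h0 h1 h2
    have V2 : m2 vV 0 = j := by rw [e2 _ (by decide) (by decide) (by decide), hj1]
    have a2 : m2 vAddr 0 = t * n + j := by
      rw [hm2, addr_sem m1 (by decide) (by decide) (by decide) (by decide) (by decide) (by decide)
        (by decide) (by decide) (by decide), hn1, ht1, hj1, min_eq_right t.2.le, min_eq_right hj.le]
    have w2 : ∀ z, z ∉ [vV, vAddr, vI, vJ, vPushX, vPushQ, vPushZ] → m2 z = m z := fun z hz => by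
      simp only [List.mem_cons, List.not_mem_nil, or_false, not_or] at hz
      rw [e2 z hz.2.1 hz.2.2.1 hz.2.2.2.1, hw z (by simp [hz])]
    rw [sem, sem]
    set m3 := upd m2 vPushX ((Expr.var vV).eval m2) (eX.eval m2) with hm3
    have e3 : ∀ z, z ≠ vPushX → m3 z = m2 z := fun z hz => upd_of_ne hz
    have w3 : ∀ z, z ∉ [vV, vAddr, vI, vJ, vPushX, vPushQ, vPushZ] → m3 z = m z := fun z hz => by
      rw [← w2 z hz]
      simp only [List.mem_cons, List.not_mem_nil, or_false, not_or] at hz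
      exact e3 z hz.2.2.2.2.1
    rw [sem, sem, sem]
    set m4 := upd m3 vPushQ ((Expr.var vV).eval m3) (eQ.eval m3) with hm4
    have e4 : ∀ z, z ≠ vPushQ → m4 z = m3 z := fun z hz => upd_of_ne hz
    have w4 : ∀ z, z ∉ [vV, vAddr, vI, vJ, vPushX, vPushQ, vPushZ] → m4 z = m z := fun z hz => by
      rw [← w3 z hz]
      simp only [List.mem_cons, List.not_mem_nil, or_false, not_or] at hz
      exact e4 z hz.2.2.2.2.2.1
    have V3 : m3 vV 0 = j := by rw [e3 _ (by decide), V2]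
    have V4 : m4 vV 0 = j := by rw [e4 _ (by decide), V3]
    have a3 : m3 vAddr 0 = t * n + j := by rw [e3 _ (by decide), a2]
    have a4 : m4 vAddr 0 = t * n + j := by rw [e4 _ (by decide), a3]
    refine ⟨Bits.loop_step hI1 (w := eX.eval m2) ?_ fun hj => (he ⟨j, hj⟩ m2 V2 a2 w2).1,
      Bits.loop_step hI2 (w := eQ.eval m3) ?_ fun hj => (he ⟨j, hj⟩ m3 V3 a3 w3).2.1,
      Bits.loop_step hI3 (w := eZ.eval m4) ?_ fun hj => (he ⟨j, hj⟩ m4 V4 a4 w4).2.2⟩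
    · rw [upd_of_ne (by decide), upd_of_ne (by decide), e4 _ (by decide), hm3, upd_self,
        e2 _ (by decide) (by decide) (by decide)]
      simp only [Expr.eval, V2]
    · rw [upd_of_ne (by decide), upd_of_ne (by decide), hm4, upd_self, e3 _ (by decide),
        e2 _ (by decide) (by decide) (by decide)]
      simp only [Expr.eval, V3]
    · rw [upd_of_ne (by decide), upd_self, e4 _ (by decide), e3 _ (by decide),
        e2 _ (by decide) (by decide) (by decide)]
      simp only [Expr.eval, V4]

theorem pushRoots_sem {m : Mem} {A : Finset (Fin n)} {p : ℕ} {l : List (SimpleGraph.Task n)}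
    (hn : m 0 0 = n) (hA : Bits (m vA) A) (hT : Bits (m vBdry) (G.bdry A))
    (hF : Bits (m vFar) (G.far b)) (h : Queue m p l) :
    Queue (pushRoots.sem m) p (l ++ G.newTasks b A) := by
  set c := prepare (.or (.get vA (.var vV)) (.eq (.var vV) (.var vT))) (.get vFar (.var vV)) (.lit 0)
    with hc
  have main := loop_induction (m := m) (x := vT) (b := 0)
    (c := .ite (.get vBdry (.var vT)) (c ;; push) .skip)
    (fun j m' => Queue m' p (l ++ (vertsBelow (G.bdry A) j).map fun v =>
      ⟨some (A, v), insert v A, G.far b, ∅⟩)) ?_ ?_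
  · rw [hn, vertsBelow_self] at main
    exact main
  · rw [vertsBelow, List.take_zero, List.filter_nil, List.map_nil, List.append_nil]
    exact h.congr (upd_of_ne (by decide)) (upd_of_ne (by decide)) (upd_of_ne (by decide))
      (upd_of_ne (by decide))
  · intro j m1 hj hj1 hfr hI
    rw [hn] at hj
    have A1 : m1 vA = m vA := hfr _ (by decide)
    have T1 : m1 vBdry = m vBdry := hfr _ (by decide)
    have F1 : m1 vFar = m vFar := hfr _ (by decide)
    have n1 : m1 0 = m 0 := hfr _ (by decide)
    have hTj := hT.ne_zero ⟨j, hj⟩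
    simp only at hTj
    rw [vertsBelow_succ _ hj, sem_ite (m := m1) (w := m vBdry j) (by simp only [Expr.eval, T1, hj1])]
    refine Queue.congr (m := if m vBdry j ≠ 0 then (c ;; push).sem m1 else skip.sem m1) ?_
      (upd_of_ne (by decide)) (upd_of_ne (by decide)) (upd_of_ne (by decide)) (upd_of_ne (by decide))
    by_cases hjT : (⟨j, hj⟩ : Fin n) ∈ G.bdry A
    · rw [if_pos (hTj.2 hjT), if_pos hjT, List.map_append, ← List.append_assoc, sem]
      obtain ⟨pX, pQ, pZ⟩ := prepare_sem (m := m1) (X := insert ⟨j, hj⟩ A) (Q := G.far b) (Z := ∅)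
        (eX := .or (.get vA (.var vV)) (.eq (.var vV) (.var vT))) (eQ := .get vFar (.var vV))
        (eZ := .lit 0) (t := ⟨j, hj⟩) (by rw [n1, hn]) hj1 (by
          intro v m' hv _ hfr'
          have A' : m' vA = m vA := by rw [hfr' _ (by decide), A1]
          have F' : m' vFar = m vFar := by rw [hfr' _ (by decide), F1]
          have T' : m' vT 0 = j := by rw [hfr' _ (by decide), hj1]
          refine ⟨?_, ?_, ?_⟩
          · refine Expr.eval_or (Finset.mem_insert.trans or_comm) ?_ ?_
            · simp only [Expr.eval, A', hv, hA.ne_zero v]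
            · simp [Expr.eval, hv, T', Fin.ext_iff]
          · simp only [Expr.eval, F', hv, hF v]
          · simp [Expr.eval])
      exact push_sem (by rw [sem_frame (by decide), n1, hn])
        (hI.sem c (by decide) (by decide) (by decide) (by decide)) pX pQ pZ
    · rw [if_neg (mt hTj.1 hjT), if_neg hjT, List.append_nil]
      exact hI

theorem pushChildren_sem {m : Mem} {A : Finset (Fin n)} {p : ℕ} {l : List (SimpleGraph.Task n)}
    {τ : SimpleGraph.Task n}
    (hin : HasInput G a b k m) (hA : Bits (m vA) A) (hT : Bits (m vBdry) (G.bdry A))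
    (hX : Bits (m vX) τ.X) (hZ : Bits (m vZ) τ.Z) (h : Queue m p l) :
    Queue (pushChildren.sem m) p (l ++ G.children τ A) := by
  rw [pushChildren, sem]
  set m0 := sem (.loop vV 0 (.set vForced (.var vV) (.get vZ (.var vV)))) m with hm0
  have f0 : Bits (m0 vForced) τ.Z := by
    have main := loop_induction (m := m) (x := vV) (b := 0)
      (c := .set vForced (.var vV) (.get vZ (.var vV)))
      (fun j m' => ∀ v : Fin n, (v : ℕ) < j → m' vForced v = if v ∈ τ.Z then 1 else 0) ?_ ?_
    · rw [hin.n_eq] at main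
      exact fun v => main v v.2
    · intro v hv
      omega
    · intro j m' hj hj' hfr hI
      have Z' : m' vZ = m vZ := hfr _ (by decide)
      refine Bits.loop_step hI (w := m vZ j) ?_ fun hj => hZ ⟨j, hj⟩
      rw [upd_of_ne (by decide), sem, upd_self]
      simp only [Expr.eval, hj', Z']
  have e0 : ∀ z, z ≠ vForced → z ≠ vV → m0 z = m z := fun z h0 h1 =>
    sem_frame (by simp [writes, h0, h1]) m
  replace h : Queue m0 p l := h.sem _ (by decide) (by decide) (by decide) (by decide)
  set c := prepare (.get vX (.var vV)) (.and (.get vA (.var vV)) (.not (.get 1 (.var vAddr))))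
    (.get vForced (.var vV)) with hc
  have main := loop_induction (m := m0) (x := vT) (b := 0)
    (c := .ite (.get vBdry (.var vT))
      (.ite (.get vZ (.var vT)) .skip (c ;; push) ;; .set vForced (.var vT) (.lit 1)) .skip)
    -- When the vertex `j` is reached, `vForced` holds `τ.Z` and the boundary vertices below `j`,
    -- which is the forced set of the subtask for `j`.
    (fun j m' => Bits (m' vForced) (τ.Z ∪ (G.bdry A).filter fun v => (v : ℕ) < j) ∧
      Queue m' p (l ++ (vertsBelow (G.bdry A \ τ.Z) j).map (G.child τ A))) ?_ ?_
  · rw [e0 0 (by decide) (by decide), hin.n_eq, vertsBelow_self] at main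
    exact main.2
  · rw [vertsBelow, List.take_zero, List.filter_nil, List.map_nil, List.append_nil]
    refine ⟨?_, h.congr (upd_of_ne (by decide)) (upd_of_ne (by decide)) (upd_of_ne (by decide))
      (upd_of_ne (by decide))⟩
    rw [upd_of_ne (by decide)]
    simpa using f0
  · intro j m1 hj hj1 hfr ⟨hF, hI⟩
    rw [e0 0 (by decide) (by decide), hin.n_eq] at hj
    have A1 : m1 vA = m vA := by rw [hfr _ (by decide), e0 _ (by decide) (by decide)]
    have T1 : m1 vBdry = m vBdry := by rw [hfr _ (by decide), e0 _ (by decide) (by decide)]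
    have X1 : m1 vX = m vX := by rw [hfr _ (by decide), e0 _ (by decide) (by decide)]
    have Z1 : m1 vZ = m vZ := by rw [hfr _ (by decide), e0 _ (by decide) (by decide)]
    have n1 : m1 0 = m 0 := by rw [hfr _ (by decide), e0 _ (by decide) (by decide)]
    have g1 : m1 1 = m 1 := by rw [hfr _ (by decide), e0 _ (by decide) (by decide)]
    have hTj := hT.ne_zero ⟨j, hj⟩
    have hZj := hZ.ne_zero ⟨j, hj⟩
    simp only at hTj hZj
    rw [vertsBelow_succ _ hj, sem_ite (m := m1) (w := m vBdry j) (by simp only [Expr.eval, T1, hj1])]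
    by_cases hjT : (⟨j, hj⟩ : Fin n) ∈ G.bdry A
    · rw [if_pos (hTj.2 hjT), sem]
      set m2 := sem (.ite (.get vZ (.var vT)) .skip (c ;; push)) m1 with hm2
      have F2 : m2 vForced = m1 vForced := sem_frame (by decide) m1
      have T2 : m2 vT = m1 vT := sem_frame (by decide) m1
      have hQ2 : Queue m2 p (l ++ (vertsBelow (G.bdry A \ τ.Z) j ++
          if (⟨j, hj⟩ : Fin n) ∈ G.bdry A \ τ.Z then [(⟨j, hj⟩ : Fin n)] else []).map (G.child τ A)) := by
        rw [hm2, sem_ite (m := m1) (w := m vZ j) (by simp only [Expr.eval, Z1, hj1])]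
        by_cases hjZ : (⟨j, hj⟩ : Fin n) ∈ τ.Z
        · rw [if_pos (hZj.2 hjZ), if_neg (by simp [hjZ]), List.append_nil]
          exact hI
        · rw [if_neg (mt hZj.1 hjZ), if_pos (by simp [hjZ, hjT]), List.map_append,
            ← List.append_assoc, sem]
          obtain ⟨pX, pQ, pZ⟩ := prepare_sem (m := m1) (X := (G.child τ A ⟨j, hj⟩).X)
            (Q := (G.child τ A ⟨j, hj⟩).Q) (Z := (G.child τ A ⟨j, hj⟩).Z)
            (eX := .get vX (.var vV))
            (eQ := .and (.get vA (.var vV)) (.not (.get 1 (.var vAddr))))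
            (eZ := .get vForced (.var vV)) (t := ⟨j, hj⟩) (by rw [n1, hin.n_eq]) hj1 (by
              intro v m' hv ha hfr'
              have A' : m' vA = m vA := by rw [hfr' _ (by decide), A1]
              have X' : m' vX = m vX := by rw [hfr' _ (by decide), X1]
              have F' : m' vForced = m1 vForced := hfr' _ (by decide)
              have g' : m' 1 = m 1 := by rw [hfr' _ (by decide), g1]
              refine ⟨?_, ?_, ?_⟩
              · simp only [Expr.eval, X', hv]
                exact hX v
              · refine Expr.eval_and SimpleGraph.mem_child_Q ?_ (Expr.eval_not ?_)
                · simp only [Expr.eval, A', hv, hA.ne_zero v]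
                · simpa only [Expr.eval, g', ha] using hin.adj ⟨j, hj⟩ v
              · simp only [Expr.eval, F', hv]
                rw [hF v]
                simp only [SimpleGraph.child, Finset.mem_union, Finset.mem_filter, Fin.lt_def])
          exact push_sem (by rw [sem_frame (by decide), n1, hin.n_eq])
            (hI.sem c (by decide) (by decide) (by decide) (by decide)) pX pQ pZ
      refine ⟨?_, hQ2.congr ?_ ?_ ?_ ?_⟩
      · rw [upd_of_ne (by decide), sem, upd_self, F2]
        intro v
        simp only [Expr.eval, T2, hj1]
        by_cases e : (v : ℕ) = j
        · have : v ∈ G.bdry A := by rwa [show v = ⟨j, hj⟩ from Fin.ext e]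
          rw [e, Function.update_self, if_pos (by simp [this, e])]
        · rw [Function.update_of_ne e, hF v]
          have : (v : ℕ) < j + 1 ↔ (v : ℕ) < j := by omega
          simp only [Finset.mem_union, Finset.mem_filter, this]
      all_goals
        rw [upd_of_ne (by decide), sem, upd_of_ne (by decide)]
    · rw [if_neg (mt hTj.1 hjT), if_neg (by simp [hjT]), List.append_nil]
      refine ⟨?_, hI.congr (upd_of_ne (by decide)) (upd_of_ne (by decide)) (upd_of_ne (by decide))
        (upd_of_ne (by decide))⟩
      rw [upd_of_ne (by decide), sem]
      intro v
      rw [hF v]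
      by_cases e : (v : ℕ) = j
      · have : v ∉ G.bdry A := by rwa [show v = ⟨j, hj⟩ from Fin.ext e]
        simp [this]
      · have : (v : ℕ) < j + 1 ↔ (v : ℕ) < j := by omega
        simp only [Finset.mem_union, Finset.mem_filter, this]

theorem setup_sem {m : Mem} (h : HasInput G a b k m) (ht : m vTail 0 = 0) :
    Bits (setup.sem m vFar) (G.far b) ∧ Queue (setup.sem m) 0 [G.firstTask a b] := by
  rw [setup, sem]
  set m0 := sem (.assign vT (.get 0 (.lit 2))) m with hm0
  have h0 : HasInput G a b k m0 := h.sem _ (by decide) (by decide) (by decide)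
  rw [sem]
  have t0 : m0 vT 0 = b := by
    rw [hm0, sem, upd_self]
    simpa [Expr.eval] using h.b_eq
  set m1 := sem (.loop vV 0 (.addr 0 vT vV ;; .set vFar (.var vV)
    (.and (.not (.eq (.var vV) (.var vT))) (.not (.get 1 (.var vAddr)))))) m0 with hm1
  have h1 : HasInput G a b k m1 := h0.sem _ (by decide) (by decide) (by decide)
  have t1 : m1 vT 0 = b := by rw [hm1, sem_frame (by decide), t0]
  have f1 : Bits (m1 vFar) (G.far b) := by
    have main := loop_induction (m := m0) (x := vV) (b := 0)
      (c := .addr 0 vT vV ;; .set vFar (.var vV)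
        (.and (.not (.eq (.var vV) (.var vT))) (.not (.get 1 (.var vAddr)))))
      (fun j m' => ∀ v : Fin n, (v : ℕ) < j → m' vFar v = if v ∈ G.far b then 1 else 0) ?_ ?_
    · rw [h0.n_eq] at main
      exact fun v => main v v.2
    · intro v hv
      omega
    · intro j m' hj hj' hfr hI
      rw [h0.n_eq] at hj
      have h' : HasInput G a b k m' := h0.congr (hfr _ (by decide)) (hfr _ (by decide))
        (hfr _ (by decide))
      have t' : m' vT 0 = b := by rw [hfr _ (by decide), t0]
      have a' : (addr 0 vT vV).sem m' vAddr 0 = b * n + j := by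
        rw [addr_sem m' (by decide) (by decide) (by decide) (by decide) (by decide) (by decide)
          (by decide) (by decide) (by decide), h'.n_eq, t', hj', min_eq_right b.2.le,
          min_eq_right hj.le]
      refine Bits.loop_step hI (w := if (⟨j, hj⟩ : Fin n) ∈ G.far b then 1 else 0) ?_ fun _ => rfl
      rw [upd_of_ne (by decide), sem]
      set m2 := (addr 0 vT vV).sem m' with hm2
      have e2 : ∀ z, z ≠ vAddr → z ≠ vI → z ≠ vJ → m2 z = m' z := fun z h0 h1 h2 =>
        addr_frame m' h0 h1 h2
      have hadj := h'.adj b ⟨j, hj⟩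
      simp only at hadj
      rw [sem, upd_self, e2 vFar (by decide) (by decide) (by decide)]
      have V2 : m2 vV 0 = j := by rw [e2 _ (by decide) (by decide) (by decide), hj']
      have hval : Expr.eval m2 (.and (.not (.eq (.var vV) (.var vT))) (.not (.get 1 (.var vAddr)))) =
          if (⟨j, hj⟩ : Fin n) ∈ G.far b then 1 else 0 := by
        refine Expr.eval_and (P := ¬ (⟨j, hj⟩ : Fin n) = b) (Q := ¬ G.Adj b ⟨j, hj⟩)
          (by simp [SimpleGraph.far]) (Expr.eval_not ?_) (Expr.eval_not ?_)
        · simp [Expr.eval, V2, e2 vT, t', Fin.ext_iff]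
        · simpa only [Expr.eval, a', e2 1 (by decide) (by decide) (by decide)] using hadj
      rw [hval]
      simp only [Expr.eval, V2]
  have q1 : Queue m1 0 ([] : List (SimpleGraph.Task n)) := by
    rw [Queue, hm1, sem_frame (by decide), hm0, sem_frame (by decide), ht]
  rw [sem]
  obtain ⟨pX, pQ, pZ⟩ := prepare_sem (m := m1) (X := {a}) (Q := G.far b) (Z := ∅)
    (eX := .eq (.var vV) (.get 0 (.lit 1))) (eQ := .get vFar (.var vV))
    (eZ := .lit 0) (t := b) h1.n_eq t1 (by
      intro v m' hv _ hfr'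
      have F' : m' vFar = m1 vFar := hfr' _ (by decide)
      have n' : m' 0 1 = a := by rw [hfr' _ (by decide), h1.a_eq]
      refine ⟨?_, ?_, ?_⟩
      · simp only [Expr.eval, hv, n', Finset.mem_singleton, Fin.ext_iff]
      · simp only [Expr.eval, F', hv, f1 v]
      · simp [Expr.eval])
  refine ⟨?_, push_sem (τ := G.firstTask a b) (l := []) ?_ ?_ pX pQ pZ⟩
  · rwa [sem_frame (by decide), sem_frame (by decide)]
  · rw [sem_frame (by decide), h1.n_eq]
  · exact q1.sem _ (by decide) (by decide) (by decide) (by decide)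

end Cmd

end RAM

/-! ## The program: output and main loop -/

namespace RAM

notation "vSize" => (3 : ℕ)

variable {n : ℕ} {G : SimpleGraph (Fin n)} {a b : Fin n} {k : ℕ}

/-- Outputs the set `vBdry`. -/
def output : Prog :=
  .seq (.set vV (.lit 0) (.lit 0)) (.seq
    (.loop (.lt (.var vV) (.var 0)) (.seq (.ite (.get vBdry (.var vV)) (.write (.var vV)) .skip)
      (.set vV (.lit 0) (.succ (.var vV)))))
    .emit)

/-- Takes a task from the queue, solves it and looks up the result. -/
def Cmd.examine : Cmd :=
  pop ;; solve ;; .ite (.var vGood) insertSet (.assign vNew (.lit 0))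

/-- Adds the tasks that a solved task gives rise to. -/
def Cmd.spawn : Cmd :=
  .ite (.var vNew) pushRoots .skip ;; .ite (.var vGood) pushChildren .skip

/-- Computes `2 * n`. -/
def Cmd.double : Cmd := .loop vV 0 (.incr vSize) ;; .loop vV 0 (.incr vSize)

/-- A round of the main loop. -/
def round : Prog :=
  .seq Cmd.examine.compile (.seq (.ite (.var vNew) output .skip) Cmd.spawn.compile)

def mainLoop : Prog := .loop (.lt (.var vHead) (.var vTail)) round

/-- The enumeration of the minimal separators. -/
def enumerate : Prog :=
  .seq Cmd.double.compile (.seq (.set 2 (.lit 0) (.var vSize)) (.seq Cmd.setup.compile mainLoop))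

/-- A round costs 6 for the guard, at most 7 for the test and the writing, and 5 for the counter;
the failing guard at the end costs 6. -/
theorem exec_output_loop {S : Finset (Fin n)} (out : List (List ℕ × ℕ)) (d j t : ℕ) (m : Mem)
    (hd : j + d = n) (hn : m 0 0 = n) (hS : Bits (m vBdry) S) (hj : m vV 0 = j) :
    ∃ (m' : Mem) (τ : ℕ), τ ≤ 18 * d + 6 ∧ (∀ z, z ≠ vV → m' z = m z) ∧
      Exec (.loop (.lt (.var vV) (.var 0)) (.seq (.ite (.get vBdry (.var vV)) (.write (.var vV)) .skip)
        (.set vV (.lit 0) (.succ (.var vV)))))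
        ⟨m, (vertsBelow S j).map Fin.val, out, t⟩ ⟨m', vertexRecord S, out, t + τ⟩ := by
  induction d generalizing j t m with
  | zero =>
    obtain rfl : j = n := hd
    refine ⟨m, 6, by omega, fun _ _ => rfl, ?_⟩
    have hrec : (vertsBelow S j).map Fin.val = vertexRecord S := by
      rw [vertsBelow_self, SimpleGraph.verts_eq_sort, vertexRecord]
    rw [hrec]
    exact Exec.loop_false (s := ⟨m, vertexRecord S, out, t⟩) (by simp [Expr.eval, hj, hn])
  | succ d ih =>
    have hjn : j < n := by omega
    have hSj := hS.ne_zero ⟨j, hjn⟩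
    simp only at hSj
    have key : ∃ τ ≤ 7, Exec (.ite (.get vBdry (.var vV)) (.write (.var vV)) .skip)
        ⟨m, (vertsBelow S j).map Fin.val, out, t + 6⟩
        ⟨m, (vertsBelow S (j + 1)).map Fin.val, out, t + 6 + τ⟩ := by
      rw [vertsBelow_succ S hjn]
      by_cases h : (⟨j, hjn⟩ : Fin n) ∈ S
      · rw [if_pos h, List.map_append]
        refine ⟨4 + 3, le_rfl, Exec.ite_true ?_ ?_⟩
        · simpa only [Expr.eval, hj] using hSj.2 h
        · have := Exec.write ⟨m, (vertsBelow S j).map Fin.val, out, t + 6 + 4⟩ (.var vV)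
          simp only [Expr.eval, hj] at this
          exact this
      · rw [if_neg h, List.append_nil]
        refine ⟨4 + 1, by omega, Exec.ite_false ?_ ?_⟩
        · simpa only [Expr.eval, hj] using not_not.1 (mt hSj.1 h)
        · exact Exec.skip ⟨m, (vertsBelow S j).map Fin.val, out, t + 6 + 4⟩
    obtain ⟨τ, hτ, hexec⟩ := key
    obtain ⟨m', τ', hτ', hfr, hexec'⟩ := ih (j + 1) (t + 6 + τ + 5) (upd m vV 0 (j + 1)) (by omega)
      (by rw [upd_of_ne (by decide), hn]) (by rwa [upd_of_ne (by decide)])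
      (by rw [upd_self, Function.update_self])
    refine ⟨m', 6 + τ + 5 + τ', by omega, fun z hz => by rw [hfr z hz, upd_of_ne hz], ?_⟩
    refine Exec.loop_true (by simp [Expr.eval, hj, hn, hjn]) (.seq hexec (.set _ _ _ _)) ?_
    simp only [Expr.eval, hj]
    rw [show t + (6 + τ + 5 + τ') = t + 6 + τ + 5 + τ' by omega]
    exact hexec'

theorem exec_output {S : Finset (Fin n)} (s : State) (hn : s.mem 0 0 = n)
    (hS : Bits (s.mem vBdry) S) (hcur : s.cur = []) :
    ∃ (m' : Mem) (τ : ℕ), τ ≤ 18 * n + 10 ∧ (∀ z, z ≠ vV → m' z = s.mem z) ∧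
      Exec output s ⟨m', [], s.out ++ [(vertexRecord S, s.time + τ)], s.time + τ⟩ := by
  obtain ⟨m', τ, hτ, hfr, hexec⟩ := exec_output_loop (S := S) s.out n 0 (s.time + 3)
    (upd s.mem vV 0 0) (Nat.zero_add n) (by rw [upd_of_ne (by decide), hn]) (by rwa [upd_of_ne (by decide)])
    (by rw [upd_self, Function.update_self])
  refine ⟨m', 3 + τ + 1, by omega, fun z hz => by rw [hfr z hz, upd_of_ne hz], ?_⟩
  obtain ⟨m, cur, out, t⟩ := s
  subst hcur
  have := Exec.emit ⟨m', vertexRecord S, out, t + 3 + τ⟩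
  rw [show t + 3 + τ + 1 = t + (3 + τ + 1) by omega] at this
  exact .seq (.set _ _ _ _) (.seq hexec this)

/-- The memory at the beginning of a round. -/
structure Ready (G : SimpleGraph (Fin n)) (a b : Fin n) (k : ℕ) (pend : List (SimpleGraph.Task n))
    (L : List (Finset (Fin n))) (m : Mem) : Prop where
  input : HasInput G a b k m
  far : Bits (m vFar) (G.far b)
  queue : Queue m (m vHead 0) pend
  trie : Trie m L

/-- The time for a round of the main loop. -/
def roundTime (n : ℕ) : ℕ :=
  -- Of the constant 19, 10 belong to the output, 3 to the test whether there is one, and 6 to the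
  -- guard of the main loop.
  Cmd.examine.time (2 * n) + Cmd.spawn.time (2 * n) + (18 * n + 19)

/-- The memory after the first part of a round. -/
theorem examine_sem {m : Mem} {τ : SimpleGraph.Task n} {pend : List (SimpleGraph.Task n)}
    {L : List (Finset (Fin n))} (h : Ready G a b k (τ :: pend) L m) :
    HasInput G a b k (Cmd.examine.sem m) ∧ Bits (Cmd.examine.sem m vFar) (G.far b) ∧
    Queue (Cmd.examine.sem m) (Cmd.examine.sem m vHead 0) pend ∧
    (¬ G.Good k τ ∧ Cmd.examine.sem m vGood 0 = 0 ∧ Cmd.examine.sem m vNew 0 = 0 ∧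
        Trie (Cmd.examine.sem m) L ∨
      G.Good k τ ∧ Cmd.examine.sem m vGood 0 = 1 ∧
        Bits (Cmd.examine.sem m vX) τ.X ∧ Bits (Cmd.examine.sem m vZ) τ.Z ∧
        Bits (Cmd.examine.sem m vA) (G.closest τ.X τ.Q) ∧
        Bits (Cmd.examine.sem m vBdry) (G.bdry (G.closest τ.X τ.Q)) ∧
        (G.closest τ.X τ.Q ∉ L ∧ Cmd.examine.sem m vNew 0 ≠ 0 ∧
            Trie (Cmd.examine.sem m) (L ++ [G.closest τ.X τ.Q]) ∨
          G.closest τ.X τ.Q ∈ L ∧ Cmd.examine.sem m vNew 0 = 0 ∧ Trie (Cmd.examine.sem m) L)) := by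
  refine ⟨h.input.sem _ (by decide) (by decide) (by decide), ?_, ?_, ?_⟩
  · rw [Cmd.sem_frame (by decide)]
    exact h.far
  · have hhead : Cmd.examine.sem m vHead = Cmd.pop.sem m vHead := by
      rw [Cmd.examine, Cmd.sem, Cmd.sem_frame (by decide)]
    rw [hhead, (Cmd.pop_sem h.input.n_eq h.queue.1).2.2.2]
    exact Queue.sem h.queue.2 _ (by decide) (by decide) (by decide) (by decide)
  obtain ⟨pX, pQ, pZ, -⟩ := Cmd.pop_sem h.input.n_eq h.queue.1
  rw [Cmd.examine, Cmd.sem, Cmd.sem]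
  set m1 := Cmd.pop.sem m with hm1
  have h1 : HasInput G a b k m1 := h.input.sem Cmd.pop (by decide) (by decide) (by decide)
  have T1 : Trie m1 L := h.trie.sem Cmd.pop (by decide) (by decide) (by decide)
  have hsolve := Cmd.solve_sem h1 pX pQ pZ
  set m2 := Cmd.solve.sem m1 with hm2
  have h2 : HasInput G a b k m2 := h1.sem Cmd.solve (by decide) (by decide) (by decide)
  have T2 : Trie m2 L := T1.sem Cmd.solve (by decide) (by decide) (by decide)
  have X2 : Bits (m2 vX) τ.X := by rwa [hm2, Cmd.sem_frame (by decide)]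
  have Z2 : Bits (m2 vZ) τ.Z := by rwa [hm2, Cmd.sem_frame (by decide)]
  rcases hsolve with ⟨hg, hv, hA, hT⟩ | ⟨hg, hv⟩
  · right
    rw [Cmd.sem_ite (m := m2) (e := .var vGood) hv, if_pos one_ne_zero]
    obtain ⟨hnew, htrie⟩ := Cmd.insertSet_sem h2.n_eq (by have := a.2; omega) hA T2
    refine ⟨hg, ?_, ?_, ?_, ?_, ?_, ?_⟩
    · rwa [Cmd.sem_frame (by decide)]
    · rwa [Cmd.sem_frame (by decide)]
    · rwa [Cmd.sem_frame (by decide)]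
    · rwa [Cmd.sem_frame (by decide)]
    · rwa [Cmd.sem_frame (by decide)]
    · rcases hnew with ⟨hL, hv'⟩ | ⟨hL, hv'⟩
      · rw [if_neg hL] at htrie
        exact .inl ⟨hL, hv', htrie⟩
      · rw [if_pos hL] at htrie
        exact .inr ⟨hL, hv', htrie⟩
  · left
    rw [Cmd.sem_ite (m := m2) (e := .var vGood) hv, if_neg (not_not.2 rfl)]
    refine ⟨hg, ?_, ?_, T2.sem _ (by decide) (by decide) (by decide)⟩
    · rwa [Cmd.sem_frame (by decide)]
    · rw [Cmd.sem, upd_self]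
      rfl

/-- A failing task is `Inv.drop`, a task that finds a known set is `Inv.expand`, and a task that
finds a new set is `Inv.add` followed by `Inv.expand`. The summand 6 reserves time for the guard of
the main loop. -/
theorem exec_round {s : State} {i : ℕ} {τ : SimpleGraph.Task n} {pend : List (SimpleGraph.Task n)}
    {L : List (Finset (Fin n))} {found : List (Option (Finset (Fin n) × Fin n) × Finset (Fin n))}
    (h : Ready G a b k (τ :: pend) L s.mem) (hI : G.Inv a b k i (τ :: pend) L found)
    (hcur : s.cur = []) :
    ∃ (s' : State) (pend' : List (SimpleGraph.Task n)) (L' : List (Finset (Fin n)))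
      (found' : List (Option (Finset (Fin n) × Fin n) × Finset (Fin n))),
      Exec round s s' ∧ Ready G a b k pend' L' s'.mem ∧ G.Inv a b k (i + 1) pend' L' found' ∧
      s'.cur = [] ∧ s'.time + 6 ≤ s.time + roundTime n ∧
      (L' = L ∧ s'.out = s.out ∨ ∃ A, ∃ t ≤ s'.time, L' = L ++ [A] ∧
        s'.out = s.out ++ [(vertexRecord (G.bdry A), t)]) := by
  obtain ⟨τ1, hτ1, hexec1⟩ := Cmd.exec (c := Cmd.examine) (by decide) (N := 2 * n) s
    (by rw [h.input.n_eq]; omega) h.input.size.le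
  obtain ⟨h1, F1, Q1, hcase⟩ := examine_sem h
  set m1 := Cmd.examine.sem s.mem with hm1
  obtain ⟨m2, out2, τ2, hτ2, hfr2, hexec2, hout2⟩ : ∃ (m2 : Mem) (out2 : List (List ℕ × ℕ)) (τ2 : ℕ),
      τ2 ≤ 18 * n + 13 ∧ (∀ z, z ≠ vV → m2 z = m1 z) ∧
      Exec (.ite (.var vNew) output .skip) { s with mem := m1, time := s.time + τ1 }
        ⟨m2, [], out2, s.time + τ1 + τ2⟩ ∧
      (m1 vNew 0 = 0 ∧ out2 = s.out ∨ m1 vNew 0 ≠ 0 ∧ (Bits (m1 vBdry) (G.bdry (G.closest τ.X τ.Q)) →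
        out2 = s.out ++ [(vertexRecord (G.bdry (G.closest τ.X τ.Q)), s.time + τ1 + τ2)])) := by
    obtain ⟨m, cur, out, t⟩ := s
    subst hcur
    by_cases hnew : m1 vNew 0 = 0
    · exact ⟨m1, out, 3 + 1, by omega, fun _ _ => rfl, .ite_false hnew (.skip _), .inl ⟨hnew, rfl⟩⟩
    · have hT : Bits (m1 vBdry) (G.bdry (G.closest τ.X τ.Q)) := by
        rcases hcase with ⟨-, -, h, -⟩ | ⟨-, -, -, -, -, h, -⟩
        · exact absurd h hnew
        · exact h
      obtain ⟨m', τ', hτ', hfr, hexec⟩ := exec_output ⟨m1, [], out, t + τ1 + 3⟩ h1.n_eq hT rfl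
      refine ⟨m', _, 3 + τ', by omega, hfr, ?_, .inr ⟨hnew, fun _ => rfl⟩⟩
      rw [← add_assoc (t + τ1)]
      exact .ite_true hnew hexec
  have h2 : HasInput G a b k m2 := h1.congr (hfr2 _ (by decide)) (hfr2 _ (by decide))
    (hfr2 _ (by decide))
  obtain ⟨τ3, hτ3, hexec3⟩ := Cmd.exec (c := Cmd.spawn) (by decide) (N := 2 * n)
    ⟨m2, [], out2, s.time + τ1 + τ2⟩ (h2.n_eq.trans_le (by omega)) h2.size.le
  have F2 : Bits (m2 vFar) (G.far b) := by rwa [hfr2 _ (by decide)]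
  have Q2 : Queue m2 (m2 vHead 0) pend := by
    rw [hfr2 vHead (by decide)]
    exact Q1.congr (hfr2 _ (by decide)) (hfr2 _ (by decide)) (hfr2 _ (by decide))
      (hfr2 _ (by decide))
  have htrie : ∀ L : List (Finset (Fin n)), Trie m1 L → Trie (Cmd.spawn.sem m2) L := fun L h =>
    (h.congr (m' := m2) (hfr2 _ (by decide)) (hfr2 _ (by decide)) (hfr2 _ (by decide))).sem _
      (by decide) (by decide) (by decide)
  have hready : ∀ pend' L', Queue (Cmd.spawn.sem m2) (m2 vHead 0) pend' → Trie m1 L' →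
      Ready G a b k pend' L' (Cmd.spawn.sem m2) := fun pend' L' hq ht => by
    refine ⟨h2.sem _ (by decide) (by decide) (by decide), ?_, ?_, htrie _ ht⟩
    · rwa [Cmd.sem_frame (by decide)]
    · rwa [Cmd.sem_frame (x := vHead) (by decide)]
  have hexec : Exec round s ⟨Cmd.spawn.sem m2, [], out2, s.time + τ1 + τ2 + τ3⟩ :=
    .seq hexec1 (.seq hexec2 hexec3)
  have htime : s.time + τ1 + τ2 + τ3 + 6 ≤ s.time + roundTime n := by
    rw [roundTime]
    omega
  have hspawn : Cmd.spawn.sem m2 = Cmd.sem (.ite (.var vGood) Cmd.pushChildren .skip)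
      (Cmd.sem (.ite (.var vNew) Cmd.pushRoots .skip) m2) := rfl
  set A := G.closest τ.X τ.Q with hA
  rcases hcase with ⟨hg, hgood, hnew, ht⟩ | ⟨hg, hgood, hX, hZ, hAb, hT, hcase⟩
  · refine ⟨_, pend, L, found, hexec, hready _ _ ?_ ht, hI.drop hg, rfl, htime, .inl ⟨rfl, ?_⟩⟩
    · have e1 : Cmd.sem (.ite (.var vNew) Cmd.pushRoots .skip) m2 = m2 := by
        rw [Cmd.sem_ite (m := m2) (e := .var vNew) (w := 0)
          (by simp only [Expr.eval, hfr2 vNew (by decide), hnew]), if_neg (not_not.2 rfl), Cmd.sem]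
      rw [hspawn, e1, Cmd.sem_ite (m := m2) (e := .var vGood) (w := 0)
        (by simp only [Expr.eval, hfr2 vGood (by decide), hgood]), if_neg (not_not.2 rfl), Cmd.sem]
      exact Q2
    · rcases hout2 with ⟨-, h⟩ | ⟨h, -⟩
      · exact h
      · exact absurd hnew h
  · have children : ∀ (m3 : Mem) (l : List (SimpleGraph.Task n)), Queue m3 (m2 vHead 0) l →
        (∀ z, z ∉ Cmd.pushRoots.writes → m3 z = m2 z) →
        Queue (Cmd.sem (.ite (.var vGood) Cmd.pushChildren .skip) m3) (m2 vHead 0)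
          (l ++ G.children τ A) := by
      intro m3 l hl hfr3
      rw [Cmd.sem_ite (m := m3) (e := .var vGood) (w := 1) (by
        simp only [Expr.eval, hfr3 vGood (by decide), hfr2 vGood (by decide), hgood]),
        if_pos one_ne_zero]
      have h3 : HasInput G a b k m3 := h2.congr (hfr3 _ (by decide)) (hfr3 _ (by decide))
        (hfr3 _ (by decide))
      refine Cmd.pushChildren_sem h3 ?_ ?_ ?_ ?_ hl
      · rwa [hfr3 _ (by decide), hfr2 _ (by decide)]
      · rwa [hfr3 _ (by decide), hfr2 _ (by decide)]
      · rwa [hfr3 _ (by decide), hfr2 _ (by decide)]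
      · rwa [hfr3 _ (by decide), hfr2 _ (by decide)]
    rcases hcase with ⟨hAL, hnew, ht⟩ | ⟨hAL, hnew, ht⟩
    · have hside : G.IsSide a b k A := (hI.taskOK τ List.mem_cons_self).isSide hg
      have hadd := hI.add hside hAL
      rw [List.cons_append] at hadd
      refine ⟨_, _, L ++ [A], _, hexec, hready _ _ ?_ ht,
        hadd.expand hg (List.mem_append_right _ (List.mem_singleton_self _)), rfl, htime,
        .inr ⟨A, s.time + τ1 + τ2, by simp, rfl, ?_⟩⟩
      · rw [hspawn, Cmd.sem_ite (m := m2) (e := .var vNew) (w := m1 vNew 0)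
          (by simp only [Expr.eval, hfr2 vNew (by decide)]), if_pos hnew]
        refine children _ _ (Cmd.pushRoots_sem h2.n_eq ?_ ?_ F2 Q2)
          fun z hz => Cmd.sem_frame hz m2
        · rwa [hfr2 _ (by decide)]
        · rwa [hfr2 _ (by decide)]
      · rcases hout2 with ⟨h, -⟩ | ⟨-, h⟩
        · exact absurd h hnew
        · exact h hT
    · refine ⟨_, _, L, _, hexec, hready _ _ ?_ ht, hI.expand hg hAL, rfl, htime, .inl ⟨rfl, ?_⟩⟩
      · rw [hspawn, Cmd.sem_ite (m := m2) (e := .var vNew) (w := 0)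
          (by simp only [Expr.eval, hfr2 vNew (by decide), hnew]), if_neg (not_not.2 rfl), Cmd.sem]
        exact children _ _ Q2 fun _ _ => rfl
      · rcases hout2 with ⟨-, h⟩ | ⟨h, -⟩
        · exact h
        · exact absurd hnew h

/-! ### Time bounds along the main loop -/

/-- What holds for the state after `i` rounds, if the first round starts at time `C`. -/
structure Reached (G : SimpleGraph (Fin n)) (a b : Fin n) (k C i : ℕ)
    (pend : List (SimpleGraph.Task n)) (L : List (Finset (Fin n))) (s : State) : Prop where
  ready : Ready G a b k pend L s.mem
  inv : ∃ found, G.Inv a b k i pend L found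
  cur : s.cur = []
  out : s.out.map Prod.fst = L.map fun A => vertexRecord (G.bdry A)
  time : s.time ≤ C + i * roundTime n
  out_time : ∀ j, ∀ hj : j < s.out.length,
    s.out[j].2 ≤ C + SimpleGraph.taskBound n k (j + 1) * roundTime n

/-- The time bound for an output comes from the invariant after the round that makes it: the number
of rounds up to then is bounded in terms of the number of sets found, the new one included. -/
theorem Reached.round {C i : ℕ} {s : State} {τ : SimpleGraph.Task n}
    {pend : List (SimpleGraph.Task n)} {L : List (Finset (Fin n))}
    (h : Reached G a b k C i (τ :: pend) L s) :
    ∃ (s' : State) (pend' : List (SimpleGraph.Task n)) (L' : List (Finset (Fin n))),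
      Exec round (s.tick 6) s' ∧ Reached G a b k C (i + 1) pend' L' s' := by
  obtain ⟨found, hI⟩ := h.inv
  obtain ⟨s', pend', L', found', hexec, hready, hinv, hcur, htime, hout⟩ :=
    exec_round (s := s.tick 6) h.ready hI h.cur
  have htick : (s.tick 6).time = s.time + 6 := rfl
  have hsout : (s.tick 6).out = s.out := rfl
  rw [hsout] at hout
  have hs := h.time
  have ht' : s'.time ≤ C + (i + 1) * roundTime n := by
    rw [Nat.add_mul]
    omega
  refine ⟨s', pend', L', hexec, hready, ⟨found', hinv⟩, hcur, ?_, ht', ?_⟩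
  · rcases hout with ⟨rfl, e⟩ | ⟨A, t, -, rfl, e⟩
    · rw [e]
      exact h.out
    · rw [e, List.map_append, List.map_append]
      exact congrArg (· ++ _) h.out
  · intro j hj
    rcases hout with ⟨rfl, e⟩ | ⟨A, t, ht, rfl, e⟩
    · simp only [e] at hj ⊢
      exact h.out_time j hj
    · have hlen : s.out.length = L.length := by simpa using congrArg List.length h.out
      simp only [e] at hj ⊢
      rcases Nat.lt_or_ge j s.out.length with hlt | hge
      · exact (congrArg Prod.snd (List.getElem_append_left hlt)).trans_le (h.out_time j hlt)
      · have hj' : j = L.length := by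
          rw [List.length_append, List.length_singleton] at hj
          omega
        -- After this round exactly `j + 1` sets are known, so `i + 1` is at most the task bound for
        -- `j + 1`.
        have hb := hinv.le_taskBound
        rw [List.length_append, List.length_singleton, ← hj'] at hb
        have hval : (s.out ++ [(vertexRecord (G.bdry A), t)])[j].2 = t := by
          rw [List.getElem_append_right hge]
          simp
        rw [hval]
        have := Nat.mul_le_mul_right (roundTime n) hb
        omega

/-- The number `d` is fuel. It cannot run out, because there are at most `2 ^ n` sets and the task
bound for so many sets limits the number of rounds. -/
theorem exec_mainLoop {C : ℕ} (d i : ℕ) (s : State) (pend : List (SimpleGraph.Task n))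
    (L : List (Finset (Fin n))) (hd : SimpleGraph.taskBound n k (2 ^ n) < i + d)
    (h : Reached G a b k C i pend L s) :
    ∃ (s' : State) (i' : ℕ) (L' : List (Finset (Fin n))),
      Exec mainLoop s (s'.tick 6) ∧ Reached G a b k C i' [] L' s' := by
  induction d generalizing i s pend L with
  | zero =>
    obtain ⟨found, hI⟩ := h.inv
    have := hI.le_taskBound.trans (SimpleGraph.taskBound_mono n k hI.length_le)
    omega
  | succ d ih =>
    have htail := h.ready.queue.tail_eq
    cases pend with
    | nil =>
      refine ⟨s, i, L, Exec.loop_false ?_, h⟩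
      rw [List.length_nil, Nat.mul_zero] at htail
      simp [Expr.eval, htail]
    | cons τ pend =>
      obtain ⟨s1, pend1, L1, hexec, h1⟩ := h.round
      obtain ⟨s', i', L', hexec', h'⟩ := ih (i + 1) s1 pend1 L1 (by omega) h1
      refine ⟨s', i', L', Exec.loop_true ?_ hexec hexec', h'⟩
      have := Nat.mul_pos a.pos (Nat.succ_pos pend.length)
      rw [List.length_cons] at htail
      have hlt : s.mem vHead 0 < s.mem vTail 0 := by
        rw [htail]
        exact Nat.lt_add_of_pos_right this
      simp [Expr.eval, hlt]

/-- The time before the first round of the main loop. -/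
def startTime (n : ℕ) : ℕ := Cmd.double.time (2 * n) + Cmd.setup.time (2 * n) + 4

theorem double_sem (m : Mem) : Cmd.double.sem m vSize 0 = m vSize 0 + 2 * m 0 0 := by
  rw [Cmd.double, Cmd.sem, Cmd.loop_incr_sem _ _ _ _ (by decide),
    Cmd.loop_incr_sem _ _ _ _ (by decide), Cmd.sem_frame (by decide)]
  omega

theorem inputMem_adj (u v : Fin n) : inputMem G a b k 1 (u * n + v) ≠ 0 ↔ G.Adj u v := by
  have hiff : (∃ u' v' : Fin n, (u : ℕ) * n + v = u' * n + v' ∧ G.Adj u' v') ↔ G.Adj u v := by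
    refine ⟨fun ⟨u', v', e, h⟩ => ?_, fun h => ⟨u, v, rfl, h⟩⟩
    have hq := congrArg (· / n) e
    have hr := congrArg (· % n) e
    simp only [Nat.mul_add_mod_of_lt v.2, Nat.mul_add_mod_of_lt v'.2] at hr
    simp only [Nat.mul_comm _ n, Nat.mul_add_div u.pos, Nat.div_eq_of_lt v.2,
      Nat.div_eq_of_lt v'.2, Nat.add_zero] at hq
    rwa [Fin.ext hq, Fin.ext hr]
  simp [inputMem, hiff]

/-- The program reaches the main loop. -/
theorem exec_start : ∃ s, Reached G a b k (startTime n) 0 [G.firstTask a b] [] s ∧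
    ∀ t, Exec mainLoop s t → Exec enumerate (initial G a b k) t := by
  obtain ⟨τ1, hτ1, hexec1⟩ := Cmd.exec (c := Cmd.double) (by decide) (N := 2 * n)
    (initial G a b k) (by simp [initial, inputMem]; omega) (by simp [initial, inputMem])
  have hsize : Cmd.double.sem (inputMem G a b k) vSize 0 = 2 * n := by
    rw [double_sem]
    simp [inputMem]
  set m1 := Cmd.double.sem (inputMem G a b k) with hm1
  have e1 : ∀ z, z ≠ vV → z ≠ vSize → m1 z = inputMem G a b k z := fun z h0 h1 =>
    Cmd.sem_frame (by simp [Cmd.double, Cmd.writes, h0, h1]) _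
  set m2 := upd m1 2 0 (2 * n) with hm2
  have e2 : ∀ z, z ≠ vV → z ≠ vSize → z ≠ 2 → m2 z = inputMem G a b k z := fun z h0 h1 h2 => by
    rw [hm2, upd_of_ne h2, e1 z h0 h1]
  have h2 : HasInput G a b k m2 := by
    have e20 := e2 0 (by decide) (by decide) (by decide)
    refine ⟨?_, ?_, ?_, ?_, ?_, ?_⟩
    · rw [e20]; simp [inputMem]
    · rw [e20]; simp [inputMem]
    · rw [e20]; simp [inputMem]
    · rw [e20]; simp [inputMem]
    · rw [e2 1 (by decide) (by decide) (by decide)]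
      exact inputMem_adj
    · rw [hm2, upd_self, Function.update_self]
  have hzero : ∀ z, z ≠ vV → z ≠ vSize → z ≠ 2 → z ≠ 0 → z ≠ 1 → ∀ i, m2 z i = 0 :=
    fun z h0 h1 h2 h3 h4 i => by rw [e2 z h0 h1 h2]; simp [inputMem, h3, h4]
  obtain ⟨hF, hQ⟩ := Cmd.setup_sem h2
    (hzero vTail (by decide) (by decide) (by decide) (by decide) (by decide) 0)
  obtain ⟨τ2, hτ2, hexec2⟩ := Cmd.exec (c := Cmd.setup) (by decide) (N := 2 * n)
    ⟨m2, [], [], 0 + τ1 + 4⟩ (h2.n_eq.trans_le (by omega)) h2.size.le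
  have htrie : Trie m2 ([] : List (Finset (Fin n))) :=
    trie_nil (hzero vZero (by decide) (by decide) (by decide) (by decide) (by decide))
      (hzero vOne (by decide) (by decide) (by decide) (by decide) (by decide))
  have hhead : Cmd.setup.sem m2 vHead 0 = 0 := by
    rw [Cmd.sem_frame (by decide)]
    exact hzero vHead (by decide) (by decide) (by decide) (by decide) (by decide) 0
  refine ⟨⟨Cmd.setup.sem m2, [], [], 0 + τ1 + 4 + τ2⟩,
    ⟨⟨h2.sem Cmd.setup (by decide) (by decide) (by decide), hF, ?_,
      htrie.sem Cmd.setup (by decide) (by decide) (by decide)⟩,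
    ⟨[], SimpleGraph.inv_init⟩, rfl, rfl, ?_, fun j hj => absurd hj (Nat.not_lt_zero j)⟩,
    fun t ht => .seq hexec1 (.seq (s' := ⟨m2, [], [], 0 + τ1 + 4⟩) ?_ (.seq hexec2 ht))⟩
  · simp only [hhead]
    exact hQ
  · rw [startTime]
    simp only
    omega
  · have := Exec.set ⟨m1, [], [], 0 + τ1⟩ 2 (.lit 0) (.var vSize)
    simp only [Expr.eval, hsize] at this
    exact this

end RAM

/-! ## The theorem -/

theorem Polynomial.eval_mono_nat (p : Polynomial ℕ) : Monotone fun x => p.eval x := by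
  intro x y h
  simp only [Polynomial.eval_eq_sum_range]
  gcongr

namespace RAM

theorem exists_polynomial_times :
    ∃ p : Polynomial ℕ, ∀ n, startTime n + 6 + (n + 1) ^ 2 * roundTime n ≤ p.eval n := by
  obtain ⟨p1, h1⟩ := Cmd.double.exists_polynomial_time
  obtain ⟨p2, h2⟩ := Cmd.setup.exists_polynomial_time
  obtain ⟨p3, h3⟩ := Cmd.examine.exists_polynomial_time
  obtain ⟨p4, h4⟩ := Cmd.spawn.exists_polynomial_time
  refine ⟨(p1.comp (2 * .X) + p2.comp (2 * .X) + 4) + 6 +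
    (.X + 1) ^ 2 * (p3.comp (2 * .X) + p4.comp (2 * .X) + (18 * .X + 19)), fun n => ?_⟩
  simp [startTime, roundTime, h1, h2, h3, h4]

theorem State.HasDelay.mono {t : State} {f g : ℕ → ℕ} (h : t.HasDelay f)
    (hfg : ∀ R, 1 ≤ R → f R ≤ g R) : t.HasDelay g := fun R hR =>
  have hle : R * f R ≤ R * g R := Nat.mul_le_mul_left R (hfg R hR)
  ⟨fun i hi hiR => ((h R hR).1 i hi hiR).trans hle, fun hlen => ((h R hR).2 hlen).trans hle⟩

/-- The task bound is at most `(n + 1) ^ 2 * (R * min (4 ^ k) R)`. Halting is covered by the same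
estimate, applied to the total number of sets. -/
theorem Reached.hasDelay {n : ℕ} {G : SimpleGraph (Fin n)} {a b : Fin n} {k i : ℕ}
    {L : List (Finset (Fin n))} {s : State} {p : ℕ} (h : Reached G a b k (startTime n) i [] L s)
    (hp : startTime n + 6 + (n + 1) ^ 2 * roundTime n ≤ p) :
    (s.tick 6).HasDelay fun R => p * min (4 ^ k) R := by
  intro R hR
  have hlen : s.out.length = L.length := by simpa using congrArg List.length h.out
  have key : ∀ r ≤ R, startTime n + SimpleGraph.taskBound n k r * roundTime n + 6 ≤
      R * (p * min (4 ^ k) R) := by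
    intro r hr
    -- This lets the fixed cost before the main loop and of the last guard be multiplied by `R * min
    -- (4 ^ k) R` and absorbed into `p`.
    have hpos : 1 ≤ R * min (4 ^ k) R :=
      Nat.mul_pos hR (lt_min (Nat.pow_pos (by norm_num)) hR)
    calc startTime n + SimpleGraph.taskBound n k r * roundTime n + 6
        ≤ (startTime n + 6) * (R * min (4 ^ k) R) +
          (n + 1) ^ 2 * (R * min (4 ^ k) R) * roundTime n := by
          have h1 := Nat.le_mul_of_pos_right (startTime n + 6) hpos
          have h2 := Nat.mul_le_mul_right (roundTime n)
            ((SimpleGraph.taskBound_mono n k hr).trans (SimpleGraph.taskBound_le hR))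
          omega
      _ = (startTime n + 6 + (n + 1) ^ 2 * roundTime n) * (R * min (4 ^ k) R) := by ring
      _ ≤ p * (R * min (4 ^ k) R) := Nat.mul_le_mul_right _ hp
      _ = R * (p * min (4 ^ k) R) := by ring
  refine ⟨fun j hj hjR => ?_, fun hl => ?_⟩
  · have := key (j + 1) hjR
    have := h.out_time j hj
    change s.out[j].2 ≤ R * (p * min (4 ^ k) R)
    omega
  · change s.out.length < R at hl
    obtain ⟨found, hI⟩ := h.inv
    have := key L.length (by omega)
    have := h.time
    have := Nat.mul_le_mul_right (roundTime n) hI.le_taskBound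
    change s.time + 6 ≤ R * (p * min (4 ^ k) R)
    omega

end RAM

theorem theorem1 :
    ∃ (c : RAM.Prog) (p q : Polynomial ℕ),
      ∀ (n : ℕ) (G : SimpleGraph (Fin n)) (a b : Fin n) (k : ℕ),
        ∃ (t : RAM.State) (L : List (Finset (Fin n))),
          -- the program halts on this input, in the state `t`
          RAM.Exec c (RAM.initial G a b k) t ∧
          -- its output is the list `L`
          t.out.map Prod.fst = L.map RAM.vertexRecord ∧ t.cur = [] ∧
          -- `L` lists the minimal separators of size at most `k`, each exactly once
          L.Nodup ∧
          (∀ S : Finset (Fin n), S ∈ L ↔ G.IsMinSep a b S ∧ S.card ≤ k) ∧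
          -- the first `R` of them are output in time `p(n) * R * min(4 ^ k, R)`
          t.HasDelay (fun R => p.eval n * min (4 ^ k) R) ∧
          -- in particular, fixed-parameter delay and incremental polynomial time
          t.HasDelay (fun _ => p.eval n * 4 ^ k) ∧
          t.HasDelay (fun R => q.eval (n + R)) := by
  obtain ⟨p, hp⟩ := RAM.exists_polynomial_times
  -- The choice `q = p * X` works because `p(n) * min (4 ^ k) R ≤ p(n + R) * (n + R)`, the
  -- polynomial `p` being monotone on the natural numbers.
  refine ⟨RAM.enumerate, p, p * .X, fun n G a b k => ?_⟩
  obtain ⟨s, hs, hstart⟩ := RAM.exec_start (G := G) (a := a) (b := b) (k := k)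
  obtain ⟨t, i, L, hexec, ht⟩ :=
    RAM.exec_mainLoop (SimpleGraph.taskBound n k (2 ^ n) + 1) 0 s _ _ (by omega) hs
  obtain ⟨found, hI⟩ := ht.inv
  have hdelay := ht.hasDelay (hp n)
  refine ⟨t.tick 6, L.map G.bdry, hstart _ hexec, ?_, ht.cur, ?_, fun S => ?_, hdelay,
    hdelay.mono fun R _ => Nat.mul_le_mul_left _ (min_le_left _ _), hdelay.mono fun R _ => ?_⟩
  · rw [List.map_map]
    exact ht.out
  · exact hI.nodup.map_on fun A hA B hB h =>
      (hI.isSide A hA).rconn.eq_of_bdry_eq (hI.isSide B hB).rconn h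
  · rw [List.mem_map, ← SimpleGraph.exists_isSide_iff]
    simp only [hI.mem_iff]
  · rw [Polynomial.eval_mul, Polynomial.eval_X]
    exact Nat.mul_le_mul (p.eval_mono_nat (Nat.le_add_right n R))
      ((min_le_right _ _).trans (Nat.le_add_left R n))
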